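/- Let $d\ge 1$, let $\mathbb T^d=\mathbb R^d/\mathbb Z^d$, and let $T>0$. For $s>0$ and $1\le p<\infty$ put $$\|g\|_{B_p^{s,\infty}}=\|g\|_{L^p(\mathbb T^d)}+\sup_{0<|r|\le 1}\frac{\|g(\cdot+r)-g\|_{L^p(\mathbb T^d)}}{|r|^{s}},\qquad \|v\|_{L^q([0,T];B_p^{s,\infty})}=\Big(\int_0^T\|v(t)\|_{B_p^{s,\infty}}^q\,dt\Big)^{1/q}.$$ For every $\nu>0$ let $u^\nu\in L^\infty([0,T];L^2(\mathbb T^d))\cap L^2([0,T];H^1(\mathbb T^d))$, with pressure $p^\nu\in L^1([0,T]\times\mathbb T^d)$, be a Leray solution of $$\partial_t u^\nu+\nabla\cdot(u^\nu\otimes u^\nu)=-\nabla p^\nu+\nu\Delta u^\nu+f^\nu,\qquad \nabla\cdot u^\nu=0,\qquad u^\nu|_{t=0}=u_0^\nu,$$ that is, a distributional solution which satisfies, for a.e. $t\in(0,T)$, the global energy inequality $$\tfrac12\|u^\nu(t)\|_{L^2}^2+\nu\int_0^t\|\nabla u^\nu\|_{L^2}^2\,ds\le\tfrac12\|u_0^\nu\|_{L^2}^2+\int_0^t\int_{\mathbb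 T^d}u^\nu\cdot f^\nu\,dx\,ds .$$ Here $u_0^\nu\in L^2(\mathbb T^d)$ and $f^\nu\in L^2([0,T];L^2(\mathbb T^d))$ are solenoidal. Let $\varepsilon[u^\nu]=\nu|\nabla u^\nu|^2+D[u^\nu]$ be the total dissipation rate, where the distribution $D[u^\nu]$ is the defect in the local energy balance $$\partial_t\big(\tfrac12|u^\nu|^2\big)+\nabla\cdot\Big[\big(\tfrac12|u^\nu|^2+p^\nu\big)u^\nu-\nu\nabla\tfrac12|u^\nu|^2\Big]=-\nu|\nabla u^\nu|^2-D[u^\nu]+u^\nu\cdot f^\nu ,$$ and let $\int_0^T\!\int_{\mathbb T^d}\varepsilon[u^\nu]\,dx\,dt$ denote its mass on $(0,T)\times\mathbb T^d$, that is, the supremum of $\langle\varepsilon[u^\nu],\psi\otimes 1\rangle$ over $\psi\in C_c^\infty((0,T))$ with $0\le\psi\le1$. Let $\alpha\in[0,1)$ and let $\sigma\in(0,1]$ satisfy $\sigma>\frac{2\alpha}{3-\alpha}$. (This holds for every $\sigma\in(0,1]$ if $\alpha=0$, and for every $\sigma\ge\sigma_\alpha$ in general, where $\sigma_\alpha:=\frac{1+\alpha}{3-\alpha}\in[1/3,1)$.)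 Suppose that $\|u_0^\nu\|_{B_2^{\sigma,\infty}}$ and $\|f^\nu\|_{L^2([0,T];B_2^{\sigma,\infty})}$ are bounded uniformly in $\nu>0$, and that $$\int_0^T\int_{\mathbb T^d}\varepsilon[u^\nu]\,dx\,dt\ \ge\ \nu^\alpha L(\nu)\qquad\text{for all }\nu>0,$$ where $L:(0,\infty)\to(0,\infty)$ is slowly varying at $0$ in the sense of Karamata: $\lim_{\nu\to0}L(\lambda\nu)/L(\nu)=1$ for every $\lambda>0$. Then for no $\epsilon>0$ are the norms $\|u^\nu\|_{L^3([0,T];B_3^{\sigma_\alpha+\epsilon,\infty}(\mathbb T^d))}$ bounded uniformly in $\nu>0$. -/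

import Mathlib

open MeasureTheory Set Filter Topology
open scoped ENNReal NNReal ContDiff

noncomputable section

namespace NSE

/-- The flat torus `𝕋^d = ℝ^d / ℤ^d`, with its Haar probability measure `volume`. -/
abbrev Torus (d : ℕ) : Type := UnitAddTorus (Fin d)

/-- Values of vector fields, with the Euclidean norm. -/
abbrev Vec (d : ℕ) : Type := EuclideanSpace ℝ (Fin d)

/-- The projection `ℝ^d → 𝕋^d`. -/
def proj {d : ℕ} (y : Fin d → ℝ) : Torus d := fun i => (y i : UnitAddCircle)

/-- The measure `dx dt` on `(0,T) × 𝕋^d`. -/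
abbrev spaceTime (d : ℕ) (T : ℝ) : Measure (ℝ × Torus d) :=
  (volume.restrict (Ioo 0 T)).prod volume

/-! ### Besov spaces -/

/-- The norm of `B_p^{σ,∞}(𝕋^d)`: `‖g‖_{L^p} + sup_{0 < |r| ≤ 1} ‖g(· + r) - g‖_{L^p} / |r|^σ`. -/
def besovNorm {d : ℕ} (σ : ℝ) (p : ℝ≥0∞) (g : Torus d → Vec d) : ℝ≥0∞ :=
  eLpNorm g p volume +
    ⨆ r : Vec d, ⨆ _ : 0 < ‖r‖ ∧ ‖r‖ ≤ 1,
      eLpNorm (fun x => g (x + proj (fun i => r i)) - g x) p volume / ENNReal.ofReal (‖r‖ ^ σ)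

/-- The norm of `L^q([0,T]; B_p^{σ,∞}(𝕋^d))`. -/
def timeBesovNorm {d : ℕ} (T q σ : ℝ) (p : ℝ≥0∞) (v : ℝ → Torus d → Vec d) : ℝ≥0∞ :=
  (∫⁻ t in Ioo 0 T, besovNorm σ p (v t) ^ q) ^ (1 / q)

/-! ### Calculus on the torus -/

/-- The classical partial derivative `∂_i g` on the torus. -/
def pderiv {d : ℕ} {F : Type*} [NormedAddCommGroup F] [NormedSpace ℝ F]
    (i : Fin d) (g : Torus d → F) (x : Torus d) : F :=
  deriv (fun s : ℝ => g (x + proj (Pi.single i s))) 0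

/-- The classical Laplacian on the torus. -/
def laplacian {d : ℕ} {F : Type*} [NormedAddCommGroup F] [NormedSpace ℝ F]
    (g : Torus d → F) (x : Torus d) : F :=
  ∑ i, pderiv i (pderiv i g) x

/-- The classical time derivative. -/
def tderiv {d : ℕ} {F : Type*} [NormedAddCommGroup F] [NormedSpace ℝ F]
    (φ : ℝ → Torus d → F) (t : ℝ) (x : Torus d) : F :=
  deriv (fun s : ℝ => φ s x) t

/-- `C^∞(𝕋^d)`. -/
def SmoothOnTorus {d : ℕ} (g : Torus d → ℝ) : Prop :=
  ContDiff ℝ ∞ (fun y : Fin d → ℝ => g (proj y))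

/-- Smooth vector-valued functions of `(t,x)`. -/
def SmoothOnSpaceTime {d : ℕ} (φ : ℝ → Torus d → Vec d) : Prop :=
  ContDiff ℝ ∞ (fun q : ℝ × (Fin d → ℝ) => φ q.1 (proj q.2))

/-- `∇ · v = 0` in the sense of distributions on the torus. -/
def IsSolenoidal {d : ℕ} (v : Torus d → Vec d) : Prop :=
  ∀ g : Torus d → ℝ, SmoothOnTorus g → ∫ x, ∑ j, v x j * pderiv j g x = 0

/-- `G j` is the weak derivative `∂_j v` of `v`, for every `j`. -/
def IsWeakGradient {d : ℕ} (v : Torus d → Vec d) (G : Torus d → Fin d → Vec d) : Prop :=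
  ∀ j, ∀ g : Torus d → ℝ, SmoothOnTorus g →
    ∫ x, pderiv j g x • v x = -∫ x, g x • G x j

/-! ### Leray solutions -/

/-- Admissible data: a solenoidal initial velocity in `L²(𝕋^d)` and a solenoidal body force in
`L²([0,T]; L²(𝕋^d))`. -/
structure IsData {d : ℕ} (T : ℝ) (u₀ : Torus d → Vec d) (f : ℝ → Torus d → Vec d) : Prop where
  initial_memLp : MemLp u₀ 2 volume
  initial_solenoidal : IsSolenoidal u₀
  force_memLp : MemLp (fun z : ℝ × Torus d => f z.1 z.2) 2 (spaceTime d T)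
  force_solenoidal : ∀ᵐ t ∂(volume.restrict (Ioo 0 T)), IsSolenoidal (f t)

/-- `u` is a Leray solution on `[0,T] × 𝕋^d` of the Navier–Stokes equations with viscosity `ν`,
initial velocity `u₀` and force `f`; `G = ∇u` is its weak gradient (`G t x j = ∂_j u`) and `p` its
pressure. -/
structure IsLeraySolution {d : ℕ} (ν T : ℝ) (u₀ : Torus d → Vec d) (f : ℝ → Torus d → Vec d)
    (u : ℝ → Torus d → Vec d) (G : ℝ → Torus d → Fin d → Vec d) (p : ℝ → Torus d → ℝ) :
    Prop where
  /-- `u` is measurable on space-time. -/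
  measurable : AEStronglyMeasurable (fun z : ℝ × Torus d => u z.1 z.2) (spaceTime d T)
  /-- `u ∈ L^∞([0,T]; L²)`. -/
  energy_bounded : ∃ C : ℝ≥0, ∀ᵐ t ∂(volume.restrict (Ioo 0 T)), eLpNorm (u t) 2 volume ≤ C
  /-- `G = ∇u`. -/
  gradient : ∀ᵐ t ∂(volume.restrict (Ioo 0 T)), IsWeakGradient (u t) (G t)
  /-- `∇u ∈ L²([0,T]; L²)`. -/
  gradient_memLp : ∀ j, MemLp (fun z : ℝ × Torus d => G z.1 z.2 j) 2 (spaceTime d T)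
  /-- `∇ · u = 0`. -/
  solenoidal : ∀ᵐ t ∂(volume.restrict (Ioo 0 T)), IsSolenoidal (u t)
  /-- The pressure is an integrable function. -/
  pressure_integrable : Integrable (fun z : ℝ × Torus d => p z.1 z.2) (spaceTime d T)
  /-- `∂_t u + ∇ · (u ⊗ u) = -∇p + ν Δu + f` in the sense of distributions, with `u(0) = u₀`. -/
  equation : ∀ φ : ℝ → Torus d → Vec d, SmoothOnSpaceTime φ →
    (∃ b < T, ∀ t, b ≤ t → ∀ x, φ t x = 0) →
    (∫ z, (inner ℝ (u z.1 z.2) (tderiv φ z.1 z.2)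
          + ∑ j, u z.1 z.2 j * inner ℝ (u z.1 z.2) (pderiv j (φ z.1) z.2)
          + p z.1 z.2 * ∑ j, pderiv j (φ z.1) z.2 j
          + ν * inner ℝ (u z.1 z.2) (laplacian (φ z.1) z.2)
          + inner ℝ (f z.1 z.2) (φ z.1 z.2)) ∂(spaceTime d T))
      + ∫ x, inner ℝ (u₀ x) (φ 0 x) = 0
  /-- The global energy inequality. -/
  energy_inequality : ∀ᵐ t ∂(volume.restrict (Ioo 0 T)),
    (1 / 2) * (∫ x, ‖u t x‖ ^ 2)
        + ν * ∫ z, (∑ j, ‖G z.1 z.2 j‖ ^ 2) ∂(spaceTime d t)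
      ≤ (1 / 2) * (∫ x, ‖u₀ x‖ ^ 2)
        + ∫ z, inner ℝ (u z.1 z.2) (f z.1 z.2) ∂(spaceTime d t)

/-! ### Energy dissipation -/

/-- The distribution `D[u]` on `(0,T) × 𝕋^d`, the defect in the local balance of kinetic energy
`∂_t(|u|²/2) + ∇ · [(|u|²/2 + p) u - ν ∇(|u|²/2)] = -ν |∇u|² - D[u] + u · f`,
paired with a test function `φ`. -/
def defect {d : ℕ} (ν T : ℝ) (f u : ℝ → Torus d → Vec d) (G : ℝ → Torus d → Fin d → Vec d)
    (p : ℝ → Torus d → ℝ) (φ : ℝ → Torus d → ℝ) : ℝ :=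
  ∫ z, ((1 / 2) * ‖u z.1 z.2‖ ^ 2 * tderiv φ z.1 z.2
        + ((1 / 2) * ‖u z.1 z.2‖ ^ 2 + p z.1 z.2) * ∑ j, u z.1 z.2 j * pderiv j (φ z.1) z.2
        + ν * ((1 / 2) * ‖u z.1 z.2‖ ^ 2) * laplacian (φ z.1) z.2
        - ν * (∑ j, ‖G z.1 z.2 j‖ ^ 2) * φ z.1 z.2
        + inner ℝ (u z.1 z.2) (f z.1 z.2) * φ z.1 z.2) ∂(spaceTime d T)

/-- The total dissipation rate `ε[u] = ν |∇u|² + D[u]`, a distribution on `(0,T) × 𝕋^d`,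
paired with a test function `φ`. -/
def dissipation {d : ℕ} (ν T : ℝ) (f u : ℝ → Torus d → Vec d) (G : ℝ → Torus d → Fin d → Vec d)
    (p : ℝ → Torus d → ℝ) (φ : ℝ → Torus d → ℝ) : ℝ :=
  (∫ z, ν * (∑ j, ‖G z.1 z.2 j‖ ^ 2) * φ z.1 z.2 ∂(spaceTime d T)) + defect ν T f u G p φ

/-- Smooth cut-offs in time: `ψ ∈ C_c^∞((0,T))` with `0 ≤ ψ ≤ 1`. -/
def IsTimeCutoff (T : ℝ) (ψ : ℝ → ℝ) : Prop :=
  ContDiff ℝ ∞ ψ ∧ (∀ t, 0 ≤ ψ t ∧ ψ t ≤ 1) ∧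
    ∃ a b : ℝ, 0 < a ∧ b < T ∧ ∀ t, t ∉ Icc a b → ψ t = 0

/-- The total dissipation `∫_0^T ∫_{𝕋^d} ε[u] dx dt`: the mass of `ε[u]` on `(0,T) × 𝕋^d`, that is
the supremum of its values on test functions `ψ(t) · 1` with `ψ` approximating the indicator
function of `(0,T)`. (The torus is compact, so when `ε[u] ≥ 0` every test function with values in
`[0,1]` lies below one of these.) -/
def totalDissipation {d : ℕ} (ν T : ℝ) (f u : ℝ → Torus d → Vec d)
    (G : ℝ → Torus d → Fin d → Vec d) (p : ℝ → Torus d → ℝ) : ℝ≥0∞ :=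
  ⨆ ψ : ℝ → ℝ, ⨆ _ : IsTimeCutoff T ψ,
    ENNReal.ofReal (dissipation ν T f u G p (fun t _ => ψ t))

/-- `L : (0,∞) → (0,∞)` is slowly varying at `0` in the sense of Karamata. -/
def SlowlyVaryingAtZero (L : ℝ → ℝ) : Prop :=
  (∀ ν, 0 < ν → 0 < L ν) ∧
    ∀ c : ℝ, 0 < c → Tendsto (fun ν => L (c * ν) / L ν) (𝓝[>] 0) (𝓝 1)

end NSE

end

open NSE

/-! Argue by contradiction: let `u` be bounded in `L³([0,T]; B_3^{β,∞})` with `β = σ_α + ε`, and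
compare two energy balances, that of `u` and that of `u` mollified at scale `ℓ`. Testing the
equation with translates of a mollifier, squaring and integrating in space gives an exact balance
for the mollified energy (`IsLeraySolution.mollified_balance`). All its terms are bilinear forms
whose kernels are correlations of the mollifier with itself or with its derivatives. Even kernels
turn quadratic forms into averages of squared increments (`dotK_eq`). For the flux, odd kernels and
incompressibility leave only cubic increments (`enorm_fluxK_le`). Hence, up to constants, the flux
through scale `ℓ` is at most `ℓ^(3β-1)`, the viscous term at most `ν ℓ^(2β-2)`, and the errors in
the data, the force and the kinetic energy are at most `ℓ^(2σ) + ℓ^(2β)`.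

These bounds are used in two ways. First, for fixed `ν` and `ℓ → 0`, since `β > 1/3` the flux and
all errors vanish, while mollification can only decrease the viscous dissipation. So the total
dissipation is at most `ν ∫∫ |∇u|²`, and the defect contributes nothing beyond this
(`LerayBesov.dissipation_le`). Second, subtracting the mollified balance from the global energy
inequality bounds `ν ∫∫ |∇u|²` itself by the sum of all terms above at every scale `ℓ`
(`LerayBesov.viscousDissipation_le`); the final kinetic energy has the favourable sign because
mollification contracts `L²`.

Now take `ℓ = ν^γ` with `γ = (3-α)/4 = 1/(1+σ_α)`, the choice which balances flux and viscosity when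
`β = σ_α`; both are then of order `ν^α`. The surplus `ε`, the condition `σ > 2α/(3-α)` and `α < 1`
improve every term to `ν^(α+δ)` for some `δ > 0` (`LerayBesov.dissipationBound_rpow_le`). The lower
bound on the dissipation then forces `L(ν) ≤ K ν^δ` for `ν ≤ 1`, which no slowly varying function
satisfies (`SlowlyVaryingAtZero.not_le_rpow`). -/

noncomputable section

namespace NSE

section

/-! ### Weak time derivatives on `(0,T)` -/

/-- Smooth functions of time which vanish near and after `T`. -/
structure IsTimeTest (T : ℝ) (θ : ℝ → ℝ) : Prop where
  contDiff : ContDiff ℝ ∞ θ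
  vanish : ∃ b < T, ∀ t, b ≤ t → θ t = 0

/-- `U` has initial value `U₀` and derivative `H` on `(0,T)` in the weak sense. -/
def HasWeakTimeDeriv (T : ℝ) (U : ℝ → ℝ) (U₀ : ℝ) (H : ℝ → ℝ) : Prop :=
  ∀ θ : ℝ → ℝ, IsTimeTest T θ →
    (∫ t in Ioo 0 T, deriv θ t * U t) + (∫ t in Ioo 0 T, θ t * H t) + θ 0 * U₀ = 0

variable {T : ℝ}

lemma IsTimeTest.absolutelyContinuous {θ : ℝ → ℝ} (hθ : IsTimeTest T θ) (a b : ℝ) :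
    AbsolutelyContinuousOnInterval θ a b :=
  (hθ.contDiff.of_le (by simp)).contDiffOn.absolutelyContinuousOnInterval

lemma IsTimeTest.end_eq_zero {θ : ℝ → ℝ} (hθ : IsTimeTest T θ) : θ T = 0 := by
  obtain ⟨b, hb, h⟩ := hθ.vanish
  exact h T hb.le

lemma primitive_absolutelyContinuous (hT : 0 < T) {H : ℝ → ℝ} (hH : IntegrableOn H (Ioo 0 T))
    (c : ℝ) : AbsolutelyContinuousOnInterval (fun t => c + ∫ s in (0 : ℝ)..t, H s) 0 T := by
  have h1 : IntervalIntegrable H volume 0 T := by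
    rwa [intervalIntegrable_iff_integrableOn_Ioo_of_le hT.le]
  exact (LipschitzOnWith.absolutelyContinuousOnInterval (K := 0)
    (LipschitzWith.const c).lipschitzOnWith).add
    (h1.absolutelyContinuousOnInterval_intervalIntegral (c := 0) (by simp))

lemma primitive_ae_deriv (hT : 0 < T) {H : ℝ → ℝ} (hH : IntegrableOn H (Ioo 0 T)) (c : ℝ) :
    ∀ᵐ t ∂(volume.restrict (Ioo 0 T)),
      HasDerivAt (fun t => c + ∫ s in (0 : ℝ)..t, H s) (H t) t := by
  have h1 : IntervalIntegrable H volume 0 T := by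
    rwa [intervalIntegrable_iff_integrableOn_Ioo_of_le hT.le]
  rw [ae_restrict_iff' measurableSet_Ioo]
  filter_upwards [h1.ae_hasDerivAt_integral] with t ht htT
  refine (ht ?_ 0 (by simp)).const_add c
  rw [uIcc_of_le hT.le]
  exact Ioo_subset_Icc_self htT

/-- Integration by parts of a test function against an absolutely continuous function. -/
lemma AbsolutelyContinuousOnInterval.hasWeakTimeDeriv (hT : 0 < T) {V R : ℝ → ℝ}
    (hV : AbsolutelyContinuousOnInterval V 0 T)
    (hR : ∀ᵐ t ∂(volume.restrict (Ioo 0 T)), HasDerivAt V (R t) t) :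
    HasWeakTimeDeriv T V (V 0) R := by
  intro θ hθ
  have h := AbsolutelyContinuousOnInterval.integral_mul_deriv_eq_deriv_mul
    (hθ.absolutelyContinuous 0 T) hV
  rw [hθ.end_eq_zero, intervalIntegral.integral_of_le hT.le, intervalIntegral.integral_of_le hT.le,
    integral_Ioc_eq_integral_Ioo, integral_Ioc_eq_integral_Ioo] at h
  have h2 : ∫ t in Ioo 0 T, θ t * deriv V t = ∫ t in Ioo 0 T, θ t * R t := by
    refine integral_congr_ae ?_
    filter_upwards [hR] with t ht
    rw [ht.deriv]
  rw [h2] at h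
  rw [h]
  ring

lemma HasWeakTimeDeriv.congr {U V H : ℝ → ℝ} {c : ℝ} (h : HasWeakTimeDeriv T V c H)
    (hUV : U =ᵐ[volume.restrict (Ioo 0 T)] V) : HasWeakTimeDeriv T U c H := by
  intro θ hθ
  have e : ∫ t in Ioo 0 T, deriv θ t * U t = ∫ t in Ioo 0 T, deriv θ t * V t := by
    refine integral_congr_ae ?_
    filter_upwards [hUV] with t ht
    rw [ht]
  rw [e, h θ hθ]

/-- A weak time derivative determines the function as a primitive. -/
theorem HasWeakTimeDeriv.ae_eq (hT : 0 < T) {U H : ℝ → ℝ} {U₀ : ℝ}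
    (hU : IntegrableOn U (Ioo 0 T)) (hH : IntegrableOn H (Ioo 0 T))
    (h : HasWeakTimeDeriv T U U₀ H) :
    U =ᵐ[volume.restrict (Ioo 0 T)] fun t => U₀ + ∫ s in (0 : ℝ)..t, H s := by
  set V : ℝ → ℝ := fun t => U₀ + ∫ s in (0 : ℝ)..t, H s with hVdef
  have hVac := primitive_absolutelyContinuous hT hH U₀
  have hV : HasWeakTimeDeriv T V U₀ H := by
    have := AbsolutelyContinuousOnInterval.hasWeakTimeDeriv hT hVac (primitive_ae_deriv hT hH U₀)
    simpa using this
  have hVint : IntegrableOn V (Ioo 0 T) := by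
    have := hVac.continuousOn
    rw [uIcc_of_le hT.le] at this
    exact (this.integrableOn_Icc).mono_set Ioo_subset_Icc_self
  -- Fundamental lemma of the calculus of variations for `U - V`. Every bump `η` is the derivative
  -- of an admissible test function, because test functions need not vanish at time `0`; the
  -- resulting initial terms of `U` and `V` coincide and cancel.
  have key := IsOpen.ae_eq_zero_of_integral_contDiff_smul_eq_zero (μ := volume)
    (f := fun t => U t - V t)
    (U := Ioo (0 : ℝ) T) isOpen_Ioo (hU.sub hVint).locallyIntegrableOn ?_
  · rw [EventuallyEq, ae_restrict_iff' measurableSet_Ioo]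
    filter_upwards [key] with t ht htT
    exact sub_eq_zero.1 (ht htT)
  intro η hη hηc hηs
  -- the test function `θ(t) = ∫_0^t η - ∫_0^T η`
  set θ : ℝ → ℝ := fun t => (∫ s in (0 : ℝ)..t, η s) - ∫ s in (0 : ℝ)..T, η s with hθdef
  have hd : ∀ t, HasDerivAt θ (η t) t := fun t =>
    ((hη.continuous.integral_hasStrictDerivAt 0 t).hasDerivAt).sub_const _
  have hderiv : deriv θ = η := funext fun t => (hd t).deriv
  have hθ : IsTimeTest T θ := by
    constructor
    · rw [contDiff_infty_iff_deriv]
      exact ⟨fun t => (hd t).differentiableAt, by rwa [hderiv]⟩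
    · -- the support of `η` stays away from `T`
      have hne : (Ioo (0:ℝ) T) ∈ 𝓝ˢ (tsupport η) := isOpen_Ioo.mem_nhdsSet.2 hηs
      obtain ⟨b, hbT, hb⟩ : ∃ b < T, ∀ t, b ≤ t → t ≤ T → η t = 0 := by
        rcases (tsupport η).eq_empty_or_nonempty with he | hne
        · exact ⟨0, hT, fun t _ _ => image_eq_zero_of_notMem_tsupport (by simp [he])⟩
        · obtain ⟨m, hm, hmax⟩ := hηc.isCompact.exists_isMaxOn hne continuousOn_id
          have hmT := (hηs hm).2
          refine ⟨(m + T) / 2, by linarith, fun t ht _ => ?_⟩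
          refine image_eq_zero_of_notMem_tsupport fun hts => ?_
          have h5 : t ≤ m := hmax hts
          linarith
      have hafter : ∀ t, T ≤ t → η t = 0 := fun t ht =>
        image_eq_zero_of_notMem_tsupport fun hts => not_lt.2 ht (hηs hts).2
      refine ⟨b, hbT, fun t ht => ?_⟩
      have hz : ∀ s, b ≤ s → η s = 0 := fun s hs =>
        (le_total s T).elim (hb s hs) (hafter s)
      simp only [hθdef]
      rw [intervalIntegral.integral_interval_sub_left (hη.continuous.intervalIntegrable _ _)
        (hη.continuous.intervalIntegrable _ _)]
      rw [intervalIntegral.integral_congr (g := fun _ => (0 : ℝ))]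
      · simp
      · intro s hs
        refine hz s ?_
        rw [mem_uIcc] at hs
        rcases hs with hs | hs <;> linarith [hs.1]
  have e1 := h θ hθ
  have e2 := hV θ hθ
  rw [hderiv] at e1 e2
  obtain ⟨Cη, hCη⟩ := hηc.exists_bound_of_continuous hη.continuous
  have i1 : IntegrableOn (fun t => η t * U t) (Ioo 0 T) :=
    Integrable.bdd_mul hU hη.continuous.aestronglyMeasurable (ae_of_all _ hCη)
  have i2 : IntegrableOn (fun t => η t * V t) (Ioo 0 T) :=
    Integrable.bdd_mul hVint hη.continuous.aestronglyMeasurable (ae_of_all _ hCη)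
  have e3 : ∫ t in Ioo 0 T, η t * (U t - V t) = 0 := by
    simp_rw [mul_sub]
    rw [integral_sub i1 i2]
    linarith
  rw [← e3]
  simp only [smul_eq_mul]
  rw [setIntegral_eq_integral_of_forall_compl_eq_zero]
  intro t ht
  rw [image_eq_zero_of_notMem_tsupport fun hts => ht (hηs hts), zero_mul]

/-- The square of a function with a weak time derivative. -/
theorem HasWeakTimeDeriv.sq (hT : 0 < T) {W H : ℝ → ℝ} {W₀ : ℝ}
    (hW : IntegrableOn W (Ioo 0 T)) (hH : IntegrableOn H (Ioo 0 T))
    (h : HasWeakTimeDeriv T W W₀ H) :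
    HasWeakTimeDeriv T (fun t => W t ^ 2) (W₀ ^ 2) (fun t => 2 * (W t * H t)) := by
  have hae := h.ae_eq hT hW hH
  have hVac := primitive_absolutelyContinuous hT hH W₀
  -- The product rule is applied to the absolutely continuous primitive, since `W` only agrees with
  -- it almost everywhere.
  have hsq := AbsolutelyContinuousOnInterval.hasWeakTimeDeriv hT
    (V := fun t => (W₀ + ∫ s in (0 : ℝ)..t, H s) * (W₀ + ∫ s in (0 : ℝ)..t, H s))
    (R := fun t => 2 * (W t * H t)) (hVac.fun_mul hVac) ?_
  · simp only [intervalIntegral.integral_same, add_zero, ← pow_two] at hsq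
    refine hsq.congr ?_
    filter_upwards [hae] with t ht
    rw [ht]
  · filter_upwards [primitive_ae_deriv hT hH W₀, hae] with t ht ht2
    refine (ht.fun_mul ht).congr_deriv ?_
    rw [ht2]
    ring

end

section

/-! ### The torus -/

instance : IsProbabilityMeasure (volume : Measure UnitAddCircle) := ⟨UnitAddCircle.measure_univ⟩

instance (d : ℕ) : IsProbabilityMeasure (volume : Measure (Torus d)) := by
  unfold Torus; infer_instance

instance (d : ℕ) : (volume : Measure (Torus d)).IsNegInvariant :=
  Measure.IsAddHaarMeasure.isNegInvariant_of_innerRegular _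

lemma proj_add {d : ℕ} (y z : Fin d → ℝ) : proj (y + z) = proj y + proj z := by
  funext i; simp [proj]

lemma proj_sub {d : ℕ} (y z : Fin d → ℝ) : proj (y - z) = proj y - proj z := by
  funext i; simp [proj]

@[simp] lemma proj_zero {d : ℕ} : proj (0 : Fin d → ℝ) = 0 := by
  funext i; simp [proj]

lemma isOpenQuotientMap_proj {d : ℕ} : IsOpenQuotientMap (proj : (Fin d → ℝ) → Torus d) := by
  have h : ∀ _ : Fin d, IsOpenQuotientMap (fun y : ℝ => (y : UnitAddCircle)) := fun _ =>
    QuotientAddGroup.isOpenQuotientMap_mk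
  exact IsOpenQuotientMap.piMap h

lemma proj_surjective {d : ℕ} : Function.Surjective (proj : (Fin d → ℝ) → Torus d) :=
  isOpenQuotientMap_proj.surjective

lemma SmoothOnTorus.continuous {d : ℕ} {g : Torus d → ℝ} (hg : SmoothOnTorus g) :
    Continuous g :=
  isOpenQuotientMap_proj.isQuotientMap.continuous_iff.2 (ContDiff.continuous hg)

lemma SmoothOnTorus.comp_add {d : ℕ} {g : Torus d → ℝ} (hg : SmoothOnTorus g) (c : Torus d) :
    SmoothOnTorus (fun y => g (y + c)) := by
  obtain ⟨c, rfl⟩ := proj_surjective c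
  unfold SmoothOnTorus at *
  simp_rw [← proj_add]
  exact hg.comp (contDiff_id.add contDiff_const)

lemma pderiv_comp_add {d : ℕ} {F : Type*} [NormedAddCommGroup F] [NormedSpace ℝ F] (j : Fin d)
    (g : Torus d → F) (c : Torus d) :
    pderiv j (fun y => g (y + c)) = fun y => pderiv j g (y + c) := by
  funext y
  simp only [pderiv]
  congr 1
  funext s
  congr 1
  abel

/-! ### Periodization of functions supported near the origin -/

/-- The periodization of a function which vanishes outside of `[-1/4, 1/4]`. -/
def periodize (ψ : ℝ → ℝ) (y : ℝ) : ℝ := ψ (y - round y)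

lemma periodize_periodic (ψ : ℝ → ℝ) : Function.Periodic (periodize ψ) 1 := fun y => by
  simp [periodize]

/-- The periodization as a function on the circle. -/
def onCircle (ψ : ℝ → ℝ) : UnitAddCircle → ℝ := (periodize_periodic ψ).lift

@[simp] lemma onCircle_coe (ψ : ℝ → ℝ) (y : ℝ) : onCircle ψ (y : UnitAddCircle) = periodize ψ y :=
  Function.Periodic.lift_coe _ _

/-- The choice of nearest integer is immaterial: if `n` is not `round y`, then `y` is at distance at
least `3/8` from one of the two integers and at least `1/2` from the other, so both values of `ψ`
vanish. The radius `5/8 = 1/2 + 1/8` leaves room to move `y` by `1/8` while keeping `n` fixed. -/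
lemma periodize_eq {ψ : ℝ → ℝ} (hψ : ∀ y, 1 / 4 ≤ |y| → ψ y = 0) {y : ℝ} {n : ℤ}
    (h : |y - n| ≤ 5 / 8) : periodize ψ y = ψ (y - n) := by
  unfold periodize
  by_cases hn : round y = n
  · rw [hn]
  have h1 : (1 : ℝ) ≤ |((round y : ℤ) : ℝ) - n| := by
    have : (1 : ℤ) ≤ |round y - n| := Int.one_le_abs (sub_ne_zero.2 hn)
    exact_mod_cast this
  have h2 := abs_sub_round y
  have h3 : |((round y : ℤ) : ℝ) - n| ≤ |y - n| + |y - round y| := by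
    have := abs_sub (y - n) (y - round y)
    rwa [show y - n - (y - round y) = (round y : ℝ) - n by ring] at this
  rw [hψ _ (by linarith), hψ _ (by linarith)]

/-- Rounding jumps at half-integers, but the integer can be frozen near `y₀`. Smoothness and
derivatives of `ψ` then pass to its periodization. -/
lemma periodize_eventuallyEq {ψ : ℝ → ℝ} (hψ : ∀ y, 1 / 4 ≤ |y| → ψ y = 0) (y₀ : ℝ) :
    periodize ψ =ᶠ[𝓝 y₀] fun y => ψ (y - round y₀) := by
  filter_upwards [Metric.ball_mem_nhds y₀ (show (0 : ℝ) < 1 / 8 by norm_num)] with y hy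
  refine periodize_eq hψ ?_
  rw [Metric.mem_ball, Real.dist_eq] at hy
  have h2 := abs_sub_round y₀
  have := abs_add_le (y - y₀) (y₀ - round y₀)
  rw [show y - y₀ + (y₀ - round y₀) = y - round y₀ by ring] at this
  linarith

lemma contDiff_periodize {ψ : ℝ → ℝ} (hψ : ∀ y, 1 / 4 ≤ |y| → ψ y = 0) (h : ContDiff ℝ ∞ ψ) :
    ContDiff ℝ ∞ (periodize ψ) :=
  contDiff_iff_contDiffAt.2 fun y₀ =>
    ((h.comp (contDiff_id.sub contDiff_const)).contDiffAt).congr_of_eventuallyEq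
      (periodize_eventuallyEq hψ y₀)

lemma hasDerivAt_periodize {ψ ψ' : ℝ → ℝ} (hψ : ∀ y, 1 / 4 ≤ |y| → ψ y = 0)
    (h : ∀ y, HasDerivAt ψ (ψ' y) y) (y : ℝ) :
    HasDerivAt (periodize ψ) (periodize ψ' y) y := by
  refine HasDerivAt.congr_of_eventuallyEq ?_ (periodize_eventuallyEq hψ y)
  exact (h (y - round y)).comp_sub_const y (round y)

lemma periodize_neg {ψ : ℝ → ℝ} (hψ : ∀ y, 1 / 4 ≤ |y| → ψ y = 0) (c : ℝ)
    (h : ∀ y, ψ (-y) = c * ψ y) (y : ℝ) : periodize ψ (-y) = c * periodize ψ y := by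
  -- At half-integers `round (-y)` may differ from `-round y`, so the integer is prescribed by hand.
  rw [periodize_eq hψ (n := -round y), periodize, ← h]
  · congr 1; push_cast; ring
  · push_cast
    rw [show -y - -(round y : ℝ) = -(y - round y) by ring, abs_neg]
    have := abs_sub_round y
    linarith

lemma integral_onCircle {ψ : ℝ → ℝ} (hψ : ∀ y, 1 / 4 ≤ |y| → ψ y = 0) :
    ∫ x, onCircle ψ x = ∫ y, ψ y := by
  rw [← UnitAddCircle.integral_preimage (-1 / 2)]
  -- The fundamental domain is centred at the origin, so that it contains the support of `ψ`.
  rw [← setIntegral_eq_integral_of_forall_compl_eq_zero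
    (s := Ioc (-1 / 2 : ℝ) (-1 / 2 + 1)) (f := ψ)]
  · refine setIntegral_congr_fun measurableSet_Ioc fun y hy => ?_
    rw [onCircle_coe, periodize_eq hψ (n := 0)]
    · simp
    · rw [Int.cast_zero, sub_zero, abs_le]
      constructor <;> linarith [hy.1, hy.2]
  · intro y hy
    refine hψ y ?_
    by_contra hlt
    rw [not_le, abs_lt] at hlt
    exact hy ⟨by linarith, by linarith⟩

lemma abs_onCircle (ψ : ℝ → ℝ) (x : UnitAddCircle) :
    |onCircle ψ x| = onCircle (fun y => |ψ y|) x := by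
  induction x using QuotientAddGroup.induction_on with
  | H y => exact (congrArg abs (onCircle_coe ψ y)).trans (onCircle_coe (fun y => |ψ y|) y).symm

lemma onCircle_neg {ψ : ℝ → ℝ} (hψ : ∀ y, 1 / 4 ≤ |y| → ψ y = 0) (c : ℝ)
    (h : ∀ y, ψ (-y) = c * ψ y) (x : UnitAddCircle) : onCircle ψ (-x) = c * onCircle ψ x := by
  induction x using QuotientAddGroup.induction_on with
  | H y =>
    have h1 := onCircle_coe ψ (-y)
    have h2 := onCircle_coe ψ y
    rw [AddCircle.coe_neg] at h1
    exact h1.trans ((periodize_neg hψ c h y).trans (congrArg (c * ·) h2.symm))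

lemma exists_of_onCircle_ne_zero {ψ : ℝ → ℝ} {ρ : ℝ} (hψ : ∀ y, ρ ≤ |y| → ψ y = 0)
    {x : UnitAddCircle} (hx : onCircle ψ x ≠ 0) : ∃ r : ℝ, |r| ≤ ρ ∧ x = (r : UnitAddCircle) := by
  induction x using QuotientAddGroup.induction_on with
  | H y =>
    have h1 := onCircle_coe ψ y
    refine ⟨y - round y, ?_, ?_⟩
    · by_contra hlt
      exact hx (h1.trans (hψ _ (not_le.1 hlt).le))
    · rw [AddCircle.coe_sub]
      have : ((round y : ℝ) : UnitAddCircle) = 0 := by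
        rw [AddCircle.coe_eq_zero_iff]
        exact ⟨round y, by simp⟩
      rw [this, sub_zero]

/-! ### Mollifiers -/

/-- `κ` is a mollifier on the torus at scale `ℓ`, with first and second pure partial derivatives
`κ₁`, `κ₂`. -/
structure IsMollifier {d : ℕ} (A ℓ : ℝ) (κ : Torus d → ℝ) (κ₁ κ₂ : Fin d → Torus d → ℝ) :
    Prop where
  smooth : SmoothOnTorus κ
  smooth_fst : ∀ j, SmoothOnTorus (κ₁ j)
  smooth_snd : ∀ j, SmoothOnTorus (κ₂ j)
  pderiv_eq : ∀ j, pderiv j κ = κ₁ j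
  pderiv_fst : ∀ j, pderiv j (κ₁ j) = κ₂ j
  nonneg : ∀ x, 0 ≤ κ x
  even : ∀ x, κ (-x) = κ x
  odd_fst : ∀ j x, κ₁ j (-x) = -κ₁ j x
  even_snd : ∀ j x, κ₂ j (-x) = κ₂ j x
  integral_eq : ∫ x, κ x = 1
  integral_snd : ∀ j, ∫ x, κ₂ j x = 0
  integral_abs_fst : ∀ j, ∫ x, |κ₁ j x| ≤ A / ℓ
  integral_abs_snd : ∀ j, ∫ x, |κ₂ j x| ≤ A / ℓ ^ 2
  support : ∀ x, κ x ≠ 0 → ∃ r : Vec d, ‖r‖ ≤ ℓ / 2 ∧ x = proj (fun i => r i)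
  support_fst : ∀ j x, κ₁ j x ≠ 0 → ∃ r : Vec d, ‖r‖ ≤ ℓ / 2 ∧ x = proj (fun i => r i)
  support_snd : ∀ j x, κ₂ j x ≠ 0 → ∃ r : Vec d, ‖r‖ ≤ ℓ / 2 ∧ x = proj (fun i => r i)

/-- The product of circle functions `ψ (m i)`. -/
def prodKernel {d : ℕ} (ψ : ℕ → ℝ → ℝ) (m : Fin d → ℕ) (x : Torus d) : ℝ :=
  ∏ i, onCircle (ψ (m i)) (x i)

/-- Index of the `n`-th derivative in direction `j`. -/
def dirIndex {d : ℕ} (j : Fin d) (n : ℕ) : Fin d → ℕ := Function.update 0 j n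

section prodKernel

variable {d : ℕ} {ψ : ℕ → ℝ → ℝ} (hψ : ∀ n y, 1 / 4 ≤ |y| → ψ n y = 0)
  (hd : ∀ n y, HasDerivAt (ψ n) (ψ (n + 1) y) y)

include hψ in
lemma smooth_prodKernel (hs : ∀ n, ContDiff ℝ ∞ (ψ n)) (m : Fin d → ℕ) :
    SmoothOnTorus (prodKernel ψ m) := by
  unfold SmoothOnTorus prodKernel
  refine contDiff_prod fun i _ => ?_
  simp only [proj, onCircle_coe]
  exact (contDiff_periodize (hψ _) (hs _)).comp (contDiff_apply ℝ ℝ i)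

include hψ hd in
lemma pderiv_prodKernel (j : Fin d) (n : ℕ) :
    pderiv j (prodKernel ψ (dirIndex j n)) = prodKernel ψ (dirIndex j (n + 1)) := by
  funext x
  obtain ⟨y, rfl⟩ := proj_surjective x
  unfold pderiv prodKernel
  refine HasDerivAt.deriv ?_
  -- Only the factor in direction `j` depends on the differentiation variable; the others are
  -- collected into a constant.
  have hsplit : ∀ (k : ℕ) (z : Torus d), (∏ i, onCircle (ψ (dirIndex j k i)) (z i)) =
      onCircle (ψ k) (z j) * ∏ i ∈ Finset.univ.erase j, onCircle (ψ 0) (z i) := by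
    intro k z
    rw [← Finset.mul_prod_erase _ _ (Finset.mem_univ j)]
    congr 1
    · simp [dirIndex]
    · refine Finset.prod_congr rfl fun i hi => ?_
      rw [dirIndex, Function.update_of_ne (Finset.ne_of_mem_erase hi)]
      rfl
  simp_rw [hsplit, ← proj_add]
  have hconst : ∀ s : ℝ, (∏ i ∈ Finset.univ.erase j,
      onCircle (ψ 0) (proj (y + Pi.single j s) i)) =
      ∏ i ∈ Finset.univ.erase j, onCircle (ψ 0) (proj y i) := fun s => by
    refine Finset.prod_congr rfl fun i hi => ?_
    simp [proj, Pi.single_eq_of_ne (Finset.ne_of_mem_erase hi)]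
  simp_rw [hconst]
  refine HasDerivAt.mul_const ?_ _
  simp only [proj, onCircle_coe, Pi.add_apply, Pi.single_eq_same]
  have := (hasDerivAt_periodize (hψ n) (hd n) (y j + 0)).comp_const_add (y j) 0
  simpa using this

lemma integral_prodKernel_dirIndex (h0 : ∫ x, onCircle (ψ 0) x = 1) (j : Fin d) (n : ℕ) :
    ∫ x, prodKernel ψ (dirIndex j n) x = ∫ x, onCircle (ψ n) x := by
  unfold prodKernel
  rw [integral_fintype_prod_volume_eq_prod (fun i x => onCircle (ψ (dirIndex j n i)) x),
    ← Finset.mul_prod_erase _ _ (Finset.mem_univ j), Finset.prod_eq_one, mul_one]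
  · simp [dirIndex]
  · intro i hi
    rw [dirIndex, Function.update_of_ne (Finset.ne_of_mem_erase hi)]
    exact h0

lemma exists_of_prodKernel_ne_zero {ρ ℓ : ℝ} (hρ : 0 ≤ ρ) (hℓ : (d + 1) * ρ ≤ ℓ)
    (hsupp : ∀ n y, ρ ≤ |y| → ψ n y = 0) {m : Fin d → ℕ} {x : Torus d}
    (hx : prodKernel ψ m x ≠ 0) : ∃ r : Vec d, ‖r‖ ≤ ℓ ∧ x = proj (fun i => r i) := by
  have h : ∀ i, ∃ r : ℝ, |r| ≤ ρ ∧ x i = (r : UnitAddCircle) := fun i =>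
    exists_of_onCircle_ne_zero (hsupp (m i)) (Finset.prod_ne_zero_iff.1 hx i (Finset.mem_univ i))
  choose r hr hxr using h
  refine ⟨WithLp.toLp 2 r, ?_, funext fun i => hxr i⟩
  refine le_trans ?_ hℓ
  rw [EuclideanSpace.norm_eq]
  refine Real.sqrt_le_iff.2 ⟨by positivity, ?_⟩
  -- The sharp factor would be `√d`; replacing it by `d + 1` avoids the root and stays positive for
  -- `d = 0`.
  calc ∑ i, ‖r i‖ ^ 2 ≤ ∑ _i : Fin d, ρ ^ 2 := Finset.sum_le_sum fun i _ => by
        rw [Real.norm_eq_abs]; exact pow_le_pow_left₀ (abs_nonneg _) (hr i) 2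
    _ = d * ρ ^ 2 := by simp
    _ ≤ ((d + 1) * ρ) ^ 2 := by
        rw [mul_pow]
        gcongr
        nlinarith [(Nat.cast_nonneg d : (0 : ℝ) ≤ d)]

end prodKernel

end

section

/-! ### Existence of mollifiers -/

/-- A fixed even bump function on the line, of integral one. -/
def bump : ContDiffBump (0 : ℝ) := ⟨1 / 4, 1 / 2, by norm_num, by norm_num⟩

/-- The `n`-th derivative of the fixed bump. -/
def bumpDeriv (n : ℕ) : ℝ → ℝ := iteratedDeriv n (bump.normed volume)

/-- The `n`-th derivative of the bump rescaled to width `ρ`. -/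
def scaledBump (ρ : ℝ) (n : ℕ) (y : ℝ) : ℝ := (ρ ^ (n + 1))⁻¹ * bumpDeriv n (y / ρ)

lemma contDiff_bumpDeriv (n : ℕ) : ContDiff ℝ ∞ (bumpDeriv n) := by
  have h : ContDiff ℝ ∞ (bump.normed volume) := bump.contDiff_normed
  unfold bumpDeriv
  rw [iteratedDeriv_eq_iterate]
  exact ContDiff.iterate_deriv n h

lemma hasDerivAt_bumpDeriv (n : ℕ) (y : ℝ) : HasDerivAt (bumpDeriv n) (bumpDeriv (n + 1) y) y := by
  have h := ((contDiff_bumpDeriv n).differentiable (by simp) y).hasDerivAt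
  have e : bumpDeriv (n + 1) = deriv (bumpDeriv n) := iteratedDeriv_succ
  rwa [e]

lemma tsupport_bumpDeriv (n : ℕ) : tsupport (bumpDeriv n) ⊆ Metric.closedBall 0 (1 / 2) := by
  induction n with
  | zero =>
    have := bump.tsupport_normed_eq (μ := (volume : Measure ℝ))
    simp only [bumpDeriv, iteratedDeriv_zero]
    exact this.le
  | succ n ih =>
    have e : bumpDeriv (n + 1) = deriv (bumpDeriv n) := iteratedDeriv_succ
    rw [e]
    exact (closure_minimal (support_deriv_subset) (isClosed_tsupport _)).trans ih

lemma bumpDeriv_eq_zero (n : ℕ) {y : ℝ} (hy : 1 ≤ |y|) : bumpDeriv n y = 0 := by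
  refine image_eq_zero_of_notMem_tsupport fun h => ?_
  have := tsupport_bumpDeriv n h
  rw [Metric.mem_closedBall, dist_zero_right, Real.norm_eq_abs] at this
  linarith

lemma hasCompactSupport_bumpDeriv (n : ℕ) : HasCompactSupport (bumpDeriv n) :=
  (isCompact_closedBall (0 : ℝ) (1 / 2)).of_isClosed_subset (isClosed_tsupport _)
    (tsupport_bumpDeriv n)

lemma integrable_bumpDeriv (n : ℕ) : Integrable (bumpDeriv n) :=
  (contDiff_bumpDeriv n).continuous.integrable_of_hasCompactSupport (hasCompactSupport_bumpDeriv n)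

lemma bumpDeriv_neg (n : ℕ) (y : ℝ) : bumpDeriv n (-y) = (-1) ^ n * bumpDeriv n y := by
  have h := iteratedDeriv_comp_neg n (bump.normed (volume : Measure ℝ)) y
  simp_rw [bump.normed_neg] at h
  unfold bumpDeriv
  rw [h, smul_eq_mul, ← mul_assoc, ← mul_pow]
  simp

lemma integral_bumpDeriv_zero : ∫ y, bumpDeriv 0 y = 1 := by
  simp only [bumpDeriv, iteratedDeriv_zero]
  exact bump.integral_normed

/-- The mean-zero property is what later lets the viscous term see only increments of the velocity.
-/
lemma integral_bumpDeriv_succ (n : ℕ) : ∫ y, bumpDeriv (n + 1) y = 0 :=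
  integral_eq_zero_of_hasDerivAt_of_integrable (hasDerivAt_bumpDeriv n) (integrable_bumpDeriv _)
    (integrable_bumpDeriv _)

variable {ρ : ℝ}

lemma contDiff_scaledBump (n : ℕ) : ContDiff ℝ ∞ (scaledBump ρ n) :=
  contDiff_const.mul ((contDiff_bumpDeriv n).comp (contDiff_id.div_const ρ))

lemma hasDerivAt_scaledBump (n : ℕ) (y : ℝ) :
    HasDerivAt (scaledBump ρ n) (scaledBump ρ (n + 1) y) y := by
  have h1 : HasDerivAt (fun y : ℝ => y / ρ) (1 / ρ) y := (hasDerivAt_id y).div_const ρ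
  have h := ((hasDerivAt_bumpDeriv n (y / ρ)).comp y h1).const_mul (ρ ^ (n + 1))⁻¹
  refine h.congr_deriv ?_
  rw [scaledBump, pow_succ ρ (n + 1), mul_inv]
  ring

lemma scaledBump_eq_zero (hρ : 0 < ρ) (n : ℕ) {y : ℝ} (hy : ρ ≤ |y|) : scaledBump ρ n y = 0 := by
  rw [scaledBump, bumpDeriv_eq_zero, mul_zero]
  rwa [abs_div, abs_of_pos hρ, le_div_iff₀ hρ, one_mul]

lemma scaledBump_neg (n : ℕ) (y : ℝ) : scaledBump ρ n (-y) = (-1) ^ n * scaledBump ρ n y := by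
  rw [scaledBump, neg_div, bumpDeriv_neg, scaledBump]
  ring

lemma integral_scaledBump_zero (hρ : 0 < ρ) : ∫ y, scaledBump ρ 0 y = 1 := by
  unfold scaledBump
  rw [integral_const_mul, Measure.integral_comp_div, integral_bumpDeriv_zero, abs_of_pos hρ]
  field_simp
  simp

lemma integral_scaledBump_succ (n : ℕ) : ∫ y, scaledBump ρ (n + 1) y = 0 := by
  unfold scaledBump
  rw [integral_const_mul, Measure.integral_comp_div, integral_bumpDeriv_succ]
  simp

lemma integral_abs_scaledBump (hρ : 0 < ρ) (n : ℕ) :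
    ∫ y, |scaledBump ρ n y| = (∫ y, |bumpDeriv n y|) / ρ ^ n := by
  unfold scaledBump
  simp_rw [abs_mul]
  rw [integral_const_mul, Measure.integral_comp_div (fun y => |bumpDeriv n y|), abs_of_pos hρ,
    abs_of_pos (by positivity), smul_eq_mul]
  field_simp
  ring

/-- Mollifiers exist at all scales. -/
theorem exists_isMollifier (d : ℕ) : ∃ A : ℝ, 0 ≤ A ∧ ∀ ℓ : ℝ, 0 < ℓ → ℓ ≤ 1 →
    ∃ (κ : Torus d → ℝ) (κ₁ κ₂ : Fin d → Torus d → ℝ), IsMollifier A ℓ κ κ₁ κ₂ := by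
  -- With `ρ = ℓ / N` one has `(d + 1) ρ = ℓ / 4`. This places the support within `ℓ / 2`, and gives
  -- `ρ ≤ 1/4`, as periodization requires.
  set N : ℝ := 4 * (d + 1) with hN
  have hN0 : 0 < N := by positivity
  set I₁ := ∫ y, |bumpDeriv 1 y|
  set I₂ := ∫ y, |bumpDeriv 2 y|
  have hI₁ : 0 ≤ I₁ := integral_nonneg fun _ => abs_nonneg _
  have hI₂ : 0 ≤ I₂ := integral_nonneg fun _ => abs_nonneg _
  -- One constant, depending only on `d`, serves the first and the second derivatives; each estimate
  -- discards the other summand.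
  refine ⟨I₁ * N + I₂ * N ^ 2, by positivity, fun ℓ hℓ0 hℓ1 => ?_⟩
  set ρ : ℝ := ℓ / N with hρdef
  have hρ : 0 < ρ := by positivity
  have hdρ : (d + 1) * ρ ≤ ℓ / 2 := by
    have : (d + 1) * ρ = ℓ / 4 := by rw [hρdef, hN]; field_simp
    rw [this]; linarith
  have hρ4 : ρ ≤ 1 / 4 := by
    have : (1 : ℝ) * ρ ≤ (d + 1) * ρ :=
      mul_le_mul_of_nonneg_right (by linarith [(Nat.cast_nonneg d : (0 : ℝ) ≤ d)]) hρ.le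
    have h2 : (d + 1) * ρ = ℓ / 4 := by rw [hρdef, hN]; field_simp
    linarith
  have hsupp : ∀ n y, ρ ≤ |y| → scaledBump ρ n y = 0 := fun n y => scaledBump_eq_zero hρ n
  have hψ : ∀ n y, 1 / 4 ≤ |y| → scaledBump ρ n y = 0 := fun n y h => hsupp n y (hρ4.trans h)
  have hneg : ∀ (m : Fin d → ℕ) (x : Torus d), prodKernel (scaledBump ρ) m (-x)
      = (∏ i, (-1 : ℝ) ^ m i) * prodKernel (scaledBump ρ) m x := by
    intro m x
    unfold prodKernel
    rw [← Finset.prod_mul_distrib]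
    exact Finset.prod_congr rfl fun i _ => onCircle_neg (hψ _) _ (scaledBump_neg _) _
  have hsign : ∀ (j : Fin d) (n : ℕ), (∏ i, (-1 : ℝ) ^ (dirIndex j n i)) = (-1) ^ n := by
    intro j n
    rw [← Finset.mul_prod_erase _ _ (Finset.mem_univ j), Finset.prod_eq_one, mul_one]
    · simp [dirIndex]
    · intro i hi
      rw [dirIndex, Function.update_of_ne (Finset.ne_of_mem_erase hi)]
      simp
  have habs : ∀ n, ∫ x, |onCircle (scaledBump ρ n) x| = (∫ y, |bumpDeriv n y|) / ρ ^ n := by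
    intro n
    simp_rw [abs_onCircle]
    rw [integral_onCircle (fun y hy => by rw [hψ n y hy, abs_zero]), integral_abs_scaledBump hρ]
  have h0 : ∫ x, onCircle (scaledBump ρ 0) x = 1 := by
    rw [integral_onCircle (hψ 0), integral_scaledBump_zero hρ]
  have hbump0 : ∀ y, 0 ≤ scaledBump ρ 0 y := by
    intro y
    refine mul_nonneg (by positivity) ?_
    simp only [bumpDeriv, iteratedDeriv_zero]
    exact bump.nonneg_normed _
  have hcirc0 : ∀ x, 0 ≤ onCircle (scaledBump ρ 0) x := by
    intro x
    have := abs_onCircle (scaledBump ρ 0) x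
    simp_rw [abs_of_nonneg (hbump0 _)] at this
    rw [← this]
    exact abs_nonneg _
  have hprodabs : ∀ (j : Fin d) (n : ℕ), ∫ x, |prodKernel (scaledBump ρ) (dirIndex j n) x|
      = (∫ y, |bumpDeriv n y|) / ρ ^ n := by
    intro j n
    have e1 : ∀ x : Torus d, |prodKernel (scaledBump ρ) (dirIndex j n) x|
        = ∏ i, (fun i z => |onCircle (scaledBump ρ (dirIndex j n i)) z|) i (x i) := fun x => by
      simp only [prodKernel]
      exact Finset.abs_prod _ _
    simp_rw [e1]
    rw [integral_fintype_prod_volume_eq_prod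
      (fun i z => |onCircle (scaledBump ρ (dirIndex j n i)) z|),
      ← Finset.mul_prod_erase _ _ (Finset.mem_univ j), Finset.prod_eq_one, mul_one]
    · simp only [dirIndex, Function.update_self]
      exact habs n
    · intro i hi
      rw [dirIndex, Function.update_of_ne (Finset.ne_of_mem_erase hi)]
      simp only [Pi.zero_apply]
      simp_rw [abs_of_nonneg (hcirc0 _)]
      exact h0
  have hz : ∀ j : Fin d, dirIndex j 0 = 0 := fun j => by simp [dirIndex]
  have hbase : ∀ j : Fin d, prodKernel (scaledBump ρ) (0 : Fin d → ℕ)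
      = prodKernel (scaledBump ρ) (dirIndex j 0) := fun j => by rw [hz]
  refine ⟨prodKernel (scaledBump ρ) 0, fun j => prodKernel (scaledBump ρ) (dirIndex j 1),
    fun j => prodKernel (scaledBump ρ) (dirIndex j 2),
    { smooth := smooth_prodKernel hψ contDiff_scaledBump _
      smooth_fst := fun j => smooth_prodKernel hψ contDiff_scaledBump _
      smooth_snd := fun j => smooth_prodKernel hψ contDiff_scaledBump _
      pderiv_eq := fun j => by
        rw [hbase j]
        exact pderiv_prodKernel hψ hasDerivAt_scaledBump j 0
      pderiv_fst := fun j => pderiv_prodKernel hψ hasDerivAt_scaledBump j 1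
      nonneg := fun x => Finset.prod_nonneg fun i _ => hcirc0 _
      even := fun x => by rw [hneg]; simp
      odd_fst := fun j x => by rw [hneg, hsign]; simp
      even_snd := fun j x => by rw [hneg, hsign]; simp
      integral_eq := ?_
      integral_snd := fun j => by
        rw [integral_prodKernel_dirIndex h0, integral_onCircle (hψ 2), integral_scaledBump_succ]
      integral_abs_fst := fun j => ?_
      integral_abs_snd := fun j => ?_
      support := fun x hx => exists_of_prodKernel_ne_zero hρ.le hdρ hsupp hx
      support_fst := fun j x hx => exists_of_prodKernel_ne_zero hρ.le hdρ hsupp hx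
      support_snd := fun j x hx => exists_of_prodKernel_ne_zero hρ.le hdρ hsupp hx }⟩
  · unfold prodKernel
    rw [integral_fintype_prod_volume_eq_prod
      (fun i z => onCircle (scaledBump ρ ((0 : Fin d → ℕ) i)) z)]
    exact Finset.prod_eq_one fun i _ => h0
  · rw [hprodabs, hρdef]
    change I₁ / (ℓ / N) ^ 1 ≤ _
    rw [pow_one, div_div_eq_mul_div]
    gcongr
    have : 0 ≤ I₂ * N ^ 2 := by positivity
    linarith
  · rw [hprodabs, hρdef]
    change I₂ / (ℓ / N) ^ 2 ≤ _
    rw [div_pow, div_div_eq_mul_div]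
    gcongr
    have : 0 ≤ I₁ * N := by positivity
    linarith

end

section

variable {d : ℕ}

/-! ### Convolution kernels on the torus -/

/-- The correlation `c ↦ ∫ κ(a) m(a + c) da`. -/
def corr (κ m : Torus d → ℝ) (c : Torus d) : ℝ := ∫ a, κ a * m (a + c)

/-- The average `x ↦ ∫ m(y - x) a(y) dy`. -/
def average (m a : Torus d → ℝ) (x : Torus d) : ℝ := ∫ y, m (y - x) * a y

/-- The bilinear form `∫∫ m(y - z) a(y) b(z) dy dz`. -/
def bil (m a b : Torus d → ℝ) : ℝ := ∫ q : Torus d × Torus d, m (q.1 - q.2) * (a q.1 * b q.2)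

lemma exists_bound_of_continuous {m : Torus d → ℝ} (hm : Continuous m) :
    ∃ C : ℝ, 0 ≤ C ∧ ∀ x, |m x| ≤ C := by
  obtain ⟨C, hC⟩ := isCompact_univ.exists_bound_of_continuousOn hm.continuousOn
  exact ⟨C, (norm_nonneg _).trans (hC 0 (mem_univ _)), fun x => hC x (mem_univ x)⟩

lemma Continuous.integrable_torus {m : Torus d → ℝ} (hm : Continuous m) : Integrable m :=
  hm.integrable_of_hasCompactSupport (HasCompactSupport.of_compactSpace m)

lemma integrable_continuous_mul {α : Type*} [MeasurableSpace α] {μ : Measure α}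
    {m : Torus d → ℝ} (hm : Continuous m) {g : α → Torus d} (hg : Measurable g) {F : α → ℝ}
    (hF : Integrable F μ) : Integrable (fun x => m (g x) * F x) μ := by
  obtain ⟨C, -, hC⟩ := exists_bound_of_continuous hm
  exact Integrable.bdd_mul hF (hm.measurable.comp hg).aestronglyMeasurable
    (ae_of_all _ fun x => hC (g x))

lemma continuous_corr {κ m : Torus d → ℝ} (hκ : Continuous κ) (hm : Continuous m) :
    Continuous (corr κ m) := by
  unfold corr
  simp_rw [← setIntegral_univ (μ := (volume : Measure (Torus d)))]
  refine continuous_parametric_integral_of_continuous ?_ isCompact_univ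
  fun_prop

lemma integral_corr {κ m : Torus d → ℝ} (hκ : Continuous κ) (hm : Continuous m) :
    ∫ c, corr κ m c = (∫ a, κ a) * ∫ a, m a := by
  unfold corr
  rw [integral_integral_swap]
  · simp_rw [integral_const_mul, integral_add_left_eq_self, integral_mul_const]
  · exact Continuous.integrable_of_hasCompactSupport (by fun_prop)
      (HasCompactSupport.of_compactSpace _)

/-- Young's inequality in `L¹`: the correlation is dominated by that of the absolute values, whose
integral factorizes. -/
lemma integral_abs_corr_le {κ m : Torus d → ℝ} (hκ : Continuous κ) (hm : Continuous m) :
    ∫ c, |corr κ m c| ≤ (∫ a, |κ a|) * ∫ a, |m a| := by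
  rw [← integral_corr hκ.abs hm.abs]
  refine integral_mono (Continuous.integrable_torus (continuous_corr hκ hm).abs)
    (Continuous.integrable_torus (continuous_corr hκ.abs hm.abs)) fun c => ?_
  refine (abs_integral_le_integral_abs).trans_eq ?_
  simp_rw [abs_mul]
  rfl

lemma corr_neg {κ m : Torus d → ℝ} (e : ℝ) (hκ : ∀ x, κ (-x) = κ x) (hm : ∀ x, m (-x) = e * m x)
    (c : Torus d) : corr κ m (-c) = e * corr κ m c := by
  unfold corr
  rw [← integral_neg_eq_self, ← integral_const_mul]
  refine integral_congr_ae (ae_of_all _ fun a => ?_)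
  simp only [hκ, ← neg_add, hm]
  ring

/-- A point of the support is a difference of points of the two supports; this is why mollifiers are
required to live at radius `ℓ / 2`. -/
lemma support_corr {κ m : Torus d → ℝ} {ℓ : ℝ}
    (hκ : ∀ x, κ x ≠ 0 → ∃ r : Vec d, ‖r‖ ≤ ℓ / 2 ∧ x = proj (fun i => r i))
    (hm : ∀ x, m x ≠ 0 → ∃ r : Vec d, ‖r‖ ≤ ℓ / 2 ∧ x = proj (fun i => r i))
    {c : Torus d} (hc : corr κ m c ≠ 0) : ∃ r : Vec d, ‖r‖ ≤ ℓ ∧ c = proj (fun i => r i) := by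
  obtain ⟨a, ha⟩ : ∃ a, κ a * m (a + c) ≠ 0 := by
    by_contra! h
    exact hc (by simp [corr, h])
  obtain ⟨r₁, h₁, e₁⟩ := hκ a (left_ne_zero_of_mul ha)
  obtain ⟨r₂, h₂, e₂⟩ := hm (a + c) (right_ne_zero_of_mul ha)
  refine ⟨r₂ - r₁, ?_, ?_⟩
  · calc ‖r₂ - r₁‖ ≤ ‖r₂‖ + ‖r₁‖ := norm_sub_le _ _
      _ ≤ ℓ := by linarith
  · have : c = (a + c) - a := by abel
    rw [this, e₂, e₁, ← proj_sub]
    rfl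

/-- Integrals over the product of a kernel and a function of the first variable. -/
lemma integral_kernel_fst {m c : Torus d → ℝ} (hm : Continuous m) (hc : Integrable c) :
    ∫ q : Torus d × Torus d, m (q.1 - q.2) * c q.1 = (∫ x, m x) * ∫ x, c x := by
  have hint : Integrable (fun q : Torus d × Torus d => m (q.1 - q.2) * c q.1)
      (volume.prod volume) :=
    integrable_continuous_mul hm (by fun_prop) (hc.comp_fst _)
  rw [Measure.volume_eq_prod, integral_prod _ hint]
  simp_rw [integral_mul_const, integral_sub_left_eq_self m, integral_const_mul]

lemma integral_kernel_snd {m c : Torus d → ℝ} (hm : Continuous m) (hc : Integrable c) :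
    ∫ q : Torus d × Torus d, m (q.1 - q.2) * c q.2 = (∫ x, m x) * ∫ x, c x := by
  have hint : Integrable (fun q : Torus d × Torus d => m (q.1 - q.2) * c q.2)
      (volume.prod volume) :=
    integrable_continuous_mul hm (by fun_prop) (hc.comp_snd _)
  rw [Measure.volume_eq_prod, integral_prod_symm _ hint]
  simp_rw [integral_mul_const, integral_sub_right_eq_self m, integral_const_mul]

lemma integrable_bil {m a b : Torus d → ℝ} (hm : Continuous m) (ha : Integrable a)
    (hb : Integrable b) :
    Integrable (fun q : Torus d × Torus d => m (q.1 - q.2) * (a q.1 * b q.2)) :=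
  integrable_continuous_mul hm (by fun_prop) (ha.mul_prod hb)

lemma bil_swap (e : ℝ) {m a b : Torus d → ℝ} (hm : ∀ x, m (-x) = e * m x) :
    bil m a b = e * bil m b a := by
  unfold bil
  rw [Measure.volume_eq_prod, ← integral_prod_swap, ← integral_const_mul]
  refine integral_congr_ae (ae_of_all _ fun q => ?_)
  simp only [Prod.fst_swap, Prod.snd_swap]
  rw [← neg_sub, hm]
  ring

lemma bil_eq_iterated {m a b : Torus d → ℝ} (hm : Continuous m) (ha : Integrable a)
    (hb : Integrable b) : bil m a b = ∫ z, b z * ∫ y, m (y - z) * a y := by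
  unfold bil
  rw [Measure.volume_eq_prod, integral_prod_symm _ (integrable_bil hm ha hb)]
  refine integral_congr_ae (ae_of_all _ fun z => ?_)
  simp only
  rw [← integral_const_mul]
  refine integral_congr_ae (ae_of_all _ fun y => ?_)
  simp only
  ring

/-- The pairing of two averages. -/
lemma integral_average_mul_average {κ m a b : Torus d → ℝ} (hκ : Continuous κ) (hm : Continuous m)
    (ha : Integrable a) (hb : Integrable b) :
    ∫ x, average κ a x * average m b x = bil (corr κ m) b a := by
  have h1 : ∀ x, average κ a x * average m b x
      = ∫ q : Torus d × Torus d, m (q.1 - x) * (κ (q.2 - x) * (b q.1 * a q.2)) := by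
    intro x
    have := integral_prod_mul (μ := (volume : Measure (Torus d)))
      (ν := (volume : Measure (Torus d))) (fun y => m (y - x) * b y) (fun z => κ (z - x) * a z)
    rw [average, average, mul_comm, ← this, Measure.volume_eq_prod]
    refine integral_congr_ae (ae_of_all _ fun q => ?_)
    simp only
    ring
  simp_rw [h1]
  rw [integral_integral_swap]
  · unfold bil
    refine integral_congr_ae (ae_of_all _ fun q => ?_)
    simp only
    -- The substitution `a = q.2 - x` recovers the two kernels centred at `x`.
    rw [corr, ← integral_sub_left_eq_self (fun a => κ a * m (a + (q.1 - q.2))) volume q.2,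
      ← integral_mul_const]
    refine integral_congr_ae (ae_of_all _ fun x => ?_)
    simp only
    rw [show q.2 - x + (q.1 - q.2) = q.1 - x by abel]
    ring
  · have h2 : Integrable (fun p : Torus d × (Torus d × Torus d) => b p.2.1 * a p.2.2)
        (volume.prod volume) := (hb.mul_prod ha).comp_snd volume
    exact integrable_continuous_mul hm (g := fun p : Torus d × (Torus d × Torus d) => p.2.1 - p.1)
      (by fun_prop)
      (integrable_continuous_mul hκ (g := fun p : Torus d × (Torus d × Torus d) => p.2.2 - p.1)
        (by fun_prop) h2)

/-- A bilinear form with an even kernel in terms of increments. -/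
lemma integral_kernel_increments {m a b : Torus d → ℝ} (hm : Continuous m)
    (heven : ∀ x, m (-x) = m x) (ha : Integrable a) (hb : Integrable b)
    (hab : Integrable (fun x => a x * b x)) :
    ∫ q : Torus d × Torus d, m (q.1 - q.2) * ((a q.1 - a q.2) * (b q.1 - b q.2))
      = 2 * (∫ x, m x) * (∫ x, a x * b x) - 2 * bil m a b := by
  have hg : Measurable (fun q : Torus d × Torus d => q.1 - q.2) := by fun_prop
  have i1 : Integrable (fun q : Torus d × Torus d => m (q.1 - q.2) * (a q.1 * b q.1)) :=
    integrable_continuous_mul hm hg (hab.comp_fst (volume : Measure (Torus d)))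
  have i2 : Integrable (fun q : Torus d × Torus d => m (q.1 - q.2) * (a q.2 * b q.2)) :=
    integrable_continuous_mul hm hg (hab.comp_snd (volume : Measure (Torus d)))
  have i3 := integrable_bil hm ha hb
  have i4 : Integrable (fun q : Torus d × Torus d => m (q.1 - q.2) * (a q.2 * b q.1)) := by
    simpa only [mul_comm (a _)] using integrable_bil hm hb ha
  have e : ∀ q : Torus d × Torus d, m (q.1 - q.2) * ((a q.1 - a q.2) * (b q.1 - b q.2))
      = m (q.1 - q.2) * (a q.1 * b q.1) + m (q.1 - q.2) * (a q.2 * b q.2)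
        - (m (q.1 - q.2) * (a q.1 * b q.2) + m (q.1 - q.2) * (a q.2 * b q.1)) := fun q => by ring
  simp_rw [e]
  rw [integral_sub (i1.fun_add i2) (i3.fun_add i4), integral_add i1 i2, integral_add i3 i4,
    integral_kernel_fst hm hab, integral_kernel_snd hm hab]
  have e4 : ∫ q : Torus d × Torus d, m (q.1 - q.2) * (a q.2 * b q.1) = bil m a b := by
    rw [bil_swap 1 (by simpa using heven), one_mul, bil]
    simp only [mul_comm (a _)]
  rw [e4, ← bil]
  ring

/-- A trilinear form with an odd kernel in terms of increments. -/
lemma integral_kernel_cubic_increments {m a b : Torus d → ℝ} (hm : Continuous m)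
    (hodd : ∀ x, m (-x) = -m x) (ha : Integrable a) (hb : Integrable b)
    (haa : Integrable (fun x => a x * a x)) (hab : Integrable (fun x => a x * b x))
    (haab : Integrable (fun x => b x * (a x * a x))) :
    ∫ q : Torus d × Torus d, m (q.1 - q.2) * ((b q.1 - b q.2) * (a q.1 - a q.2) ^ 2)
      = 2 * bil m b (fun x => a x * a x) - 4 * bil m (fun x => a x * b x) a := by
  have hg : Measurable (fun q : Torus d × Torus d => q.1 - q.2) := by fun_prop
  have i1 : Integrable (fun q : Torus d × Torus d => m (q.1 - q.2) * (b q.1 * (a q.1 * a q.1))) :=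
    integrable_continuous_mul hm hg (haab.comp_fst (volume : Measure (Torus d)))
  have i2 : Integrable (fun q : Torus d × Torus d => m (q.1 - q.2) * (b q.2 * (a q.2 * a q.2))) :=
    integrable_continuous_mul hm hg (haab.comp_snd (volume : Measure (Torus d)))
  have i3 := integrable_bil hm hb haa
  have i4 := integrable_bil hm haa hb
  have i5 := integrable_bil hm hab ha
  have i6 := integrable_bil hm ha hab
  -- The terms living at a single point have equal integrals and cancel. In the other two groups,
  -- oddness makes the subtracted term the negative of its partner, so each difference doubles.
  have e : ∀ q : Torus d × Torus d, m (q.1 - q.2) * ((b q.1 - b q.2) * (a q.1 - a q.2) ^ 2)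
      = (m (q.1 - q.2) * (b q.1 * (a q.1 * a q.1)) - m (q.1 - q.2) * (b q.2 * (a q.2 * a q.2)))
        + (m (q.1 - q.2) * (b q.1 * (a q.2 * a q.2)) - m (q.1 - q.2) * (a q.1 * a q.1 * b q.2))
        - (2 * (m (q.1 - q.2) * (a q.1 * b q.1 * a q.2))
          - 2 * (m (q.1 - q.2) * (a q.1 * (a q.2 * b q.2)))) := fun q => by ring
  simp_rw [e]
  rw [integral_sub ((i1.sub' i2).fun_add (i3.sub' i4)) ((i5.const_mul 2).sub' (i6.const_mul 2)),
    integral_add (i1.sub' i2) (i3.sub' i4), integral_sub i1 i2, integral_sub i3 i4,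
    integral_sub (i5.const_mul 2) (i6.const_mul 2), integral_const_mul, integral_const_mul,
    integral_kernel_fst hm haab, integral_kernel_snd hm haab]
  have e3 : (∫ q : Torus d × Torus d, m (q.1 - q.2) * (b q.1 * (a q.2 * a q.2)))
    = bil m b (fun x => a x * a x) := rfl
  have e4 : (∫ q : Torus d × Torus d, m (q.1 - q.2) * (a q.1 * a q.1 * b q.2))
    = bil m (fun x => a x * a x) b := rfl
  have e5 : (∫ q : Torus d × Torus d, m (q.1 - q.2) * (a q.1 * b q.1 * a q.2))
    = bil m (fun x => a x * b x) a := rfl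
  have e6 : (∫ q : Torus d × Torus d, m (q.1 - q.2) * (a q.1 * (a q.2 * b q.2)))
    = bil m a (fun x => a x * b x) := rfl
  rw [e3, e4, e5, e6, bil_swap (-1) (a := fun x => a x * a x) (by simpa using hodd),
    bil_swap (-1) (a := a) (by simpa using hodd)]
  ring

/-- Kernels whose averages of a vector field vanish. -/
lemma sum_bil_eq_zero {m b : Fin d → Torus d → ℝ} (hm : ∀ j, Continuous (m j))
    (hb : ∀ j, Integrable (b j)) (hdiv : ∀ c, ∑ j, ∫ y, m j (y + c) * b j y = 0)
    {c : Torus d → ℝ} (hc : Integrable c) : ∑ j, bil (m j) (b j) c = 0 := by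
  have hi : ∀ j, Integrable (fun z => c z * ∫ y, m j (y - z) * b j y) := by
    intro j
    have := (integrable_bil (hm j) (hb j) hc).integral_prod_right
    refine this.congr (ae_of_all _ fun z => ?_)
    simp only
    rw [← integral_const_mul]
    refine integral_congr_ae (ae_of_all _ fun y => ?_)
    simp only
    ring
  simp_rw [bil_eq_iterated (hm _) (hb _) hc]
  rw [← integral_finsetSum _ fun j _ => hi j]
  simp_rw [← Finset.mul_sum, sub_eq_add_neg, hdiv, mul_zero, integral_zero]

/-- A kernel identity passes to bilinear forms. -/
lemma bil_eq_neg_bil {m m' v g b : Torus d → ℝ} (hm : Continuous m) (hm' : Continuous m')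
    (hv : Integrable v) (hg : Integrable g)
    (h : ∀ c, ∫ y, m' (y + c) * v y = -∫ y, m (y + c) * g y) (hb : Integrable b) :
    bil m' v b = -bil m g b := by
  rw [bil_eq_iterated hm' hv hb, bil_eq_iterated hm hg hb, ← integral_neg]
  simp_rw [sub_eq_add_neg, h, mul_neg]

/-- By Fubini, a correlation kernel acts as a superposition of translates of `m` with weight `κ`.
Linear identities valid for every translate of `m` therefore pass to `corr κ m`, which is how
integration by parts and incompressibility are transferred below. -/
lemma integral_corr_mul {κ m v : Torus d → ℝ} (hκ : Continuous κ) (hm : Continuous m)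
    (hv : Integrable v) (c : Torus d) :
    ∫ y, corr κ m (y + c) * v y = ∫ a, κ a * ∫ y, m (y + (a + c)) * v y := by
  unfold corr
  simp_rw [← integral_mul_const, ← integral_const_mul]
  rw [integral_integral_swap]
  · refine integral_congr_ae (ae_of_all _ fun a => ?_)
    refine integral_congr_ae (ae_of_all _ fun y => ?_)
    simp only
    rw [show a + (y + c) = y + (a + c) by abel, mul_assoc]
  · have h1 : Integrable (fun p : Torus d × Torus d => v p.1) (volume.prod volume) :=
      hv.comp_fst volume
    have h2 := integrable_continuous_mul hκ (g := fun p : Torus d × Torus d => p.2)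
      (by fun_prop) (integrable_continuous_mul hm
        (g := fun p : Torus d × Torus d => p.2 + (p.1 + c)) (by fun_prop) h1)
    refine h2.congr (ae_of_all _ fun p => ?_)
    simp only [Function.uncurry, mul_assoc]

lemma corr_weak_deriv {κ m m' v g : Torus d → ℝ} (hκ : Continuous κ) (hm : Continuous m)
    (hm' : Continuous m') (hv : Integrable v) (hg : Integrable g)
    (h : ∀ c, ∫ y, m' (y + c) * v y = -∫ y, m (y + c) * g y) (c : Torus d) :
    ∫ y, corr κ m' (y + c) * v y = -∫ y, corr κ m (y + c) * g y := by
  rw [integral_corr_mul hκ hm' hv, integral_corr_mul hκ hm hg, ← integral_neg]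
  simp_rw [h, mul_neg]

lemma corr_div_free {κ : Torus d → ℝ} {m b : Fin d → Torus d → ℝ} (hκ : Continuous κ)
    (hm : ∀ j, Continuous (m j)) (hb : ∀ j, Integrable (b j))
    (h : ∀ c, ∑ j, ∫ y, m j (y + c) * b j y = 0) (c : Torus d) :
    ∑ j, ∫ y, corr κ (m j) (y + c) * b j y = 0 := by
  simp_rw [integral_corr_mul hκ (hm _) (hb _)]
  rw [← integral_finsetSum]
  · simp_rw [← Finset.mul_sum, h, mul_zero, integral_zero]
  · intro j _
    have h1 : Integrable (fun p : Torus d × Torus d => b j p.2) (volume.prod volume) :=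
      (hb j).comp_snd volume
    have h2 := integrable_continuous_mul hκ (g := fun p : Torus d × Torus d => p.1)
      (by fun_prop) (integrable_continuous_mul (hm j)
        (g := fun p : Torus d × Torus d => p.2 + (p.1 + c)) (by fun_prop) h1)
    refine h2.integral_prod_left.congr (ae_of_all _ fun a => ?_)
    simp only
    rw [integral_const_mul]

end

section

variable {d : ℕ} {T : ℝ}

/-! ### The equation tested with functions of the form `θ(t) g(x) e_i` -/

lemma SmoothOnTorus.differentiableAt_line {g : Torus d → ℝ} (hg : SmoothOnTorus g) (j : Fin d)
    (x : Torus d) : DifferentiableAt ℝ (fun s : ℝ => g (x + proj (Pi.single j s))) 0 := by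
  obtain ⟨y, rfl⟩ := proj_surjective x
  simp_rw [← proj_add]
  have h1 : Differentiable ℝ (fun y : Fin d → ℝ => g (proj y)) :=
    ContDiff.differentiable hg (by simp)
  have h2 : Differentiable ℝ (fun s : ℝ => y + Pi.single j s) :=
    (differentiable_const y).add (differentiable_pi.2 fun i => by
      by_cases h : i = j
      · subst h; simp [differentiable_fun_id]
      · simp [h])
  exact (h1.comp h2).differentiableAt

lemma pderiv_smul_const {g : Torus d → ℝ} (hg : SmoothOnTorus g) (j : Fin d) (c : ℝ) (e : Vec d) :
    pderiv j (fun y => c • g y • e) = fun y => c • pderiv j g y • e := by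
  funext y
  have hd := hg.differentiableAt_line j y
  unfold pderiv
  rw [deriv_fun_const_smul c (hd.smul_const e), deriv_smul_const hd]

lemma smoothOnSpaceTime_smul {θ : ℝ → ℝ} (hθ : ContDiff ℝ ∞ θ) {g : Torus d → ℝ}
    (hg : SmoothOnTorus g) (e : Vec d) : SmoothOnSpaceTime (fun t y => θ t • g y • e) := by
  unfold SmoothOnSpaceTime
  unfold SmoothOnTorus at hg
  exact (hθ.comp contDiff_fst).smul ((hg.comp contDiff_snd).smul contDiff_const)

lemma MemLp.component {α : Type*} [MeasurableSpace α] {μ : Measure α} {p : ℝ≥0∞} {v : α → Vec d}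
    (hv : MemLp v p μ) (i : Fin d) : MemLp (fun z => v z i) p μ :=
  (EuclideanSpace.proj (𝕜 := ℝ) i : Vec d →L[ℝ] ℝ).comp_memLp' hv

lemma MemLp.component_integrable {α : Type*} [MeasurableSpace α] {μ : Measure α}
    [IsFiniteMeasure μ] {v : α → Vec d} (hv : MemLp v 2 μ) (i : Fin d) :
    Integrable (fun z => v z i) μ :=
  (MemLp.component hv i).integrable (by norm_num)

lemma MemLp.component_mul_integrable {α : Type*} [MeasurableSpace α] {μ : Measure α}
    {v w : α → Vec d} (hv : MemLp v 2 μ) (hw : MemLp w 2 μ) (i j : Fin d) :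
    Integrable (fun z => v z i * w z j) μ :=
  MemLp.integrable_mul (MemLp.component hv i) (MemLp.component hw j)

lemma integral_spaceTime {F : ℝ × Torus d → ℝ} (hF : Integrable F (spaceTime d T)) :
    ∫ z, F z ∂(spaceTime d T) = ∫ s in Ioo 0 T, ∫ x, F (s, x) :=
  integral_prod F hF

lemma integrableOn_time_mul {c : ℝ → ℝ} (hc : Continuous c) {U : ℝ → ℝ}
    (hU : IntegrableOn U (Ioo 0 T)) : IntegrableOn (fun s => c s * U s) (Ioo 0 T) := by
  obtain ⟨C, hC⟩ := (isCompact_Icc (a := (0 : ℝ)) (b := T)).exists_bound_of_continuousOn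
    hc.continuousOn
  refine Integrable.bdd_mul (c := C) hU hc.aestronglyMeasurable ?_
  filter_upwards [ae_restrict_mem measurableSet_Ioo] with s hs using hC _ (Ioo_subset_Icc_self hs)

lemma integrable_time_mul {c : ℝ → ℝ} (hc : Continuous c) {F : ℝ × Torus d → ℝ}
    (hF : Integrable F (spaceTime d T)) :
    Integrable (fun z : ℝ × Torus d => c z.1 * F z) (spaceTime d T) := by
  obtain ⟨C, hC⟩ := (isCompact_Icc (a := (0 : ℝ)) (b := T)).exists_bound_of_continuousOn
    hc.continuousOn
  refine Integrable.bdd_mul (c := C) hF (hc.measurable.comp measurable_fst).aestronglyMeasurable ?_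
  have : ∀ᵐ s ∂(volume.restrict (Ioo 0 T)), ‖c s‖ ≤ C := by
    filter_upwards [ae_restrict_mem measurableSet_Ioo] with s hs
      using hC _ (Ioo_subset_Icc_self hs)
  exact Measure.quasiMeasurePreserving_fst.ae this

/-- The equation of motion for the components of `u` tested against a fixed function. -/
lemma IsLeraySolution.hasWeakTimeDeriv {ν : ℝ} {u₀ : Torus d → Vec d} {f u : ℝ → Torus d → Vec d}
    {G : ℝ → Torus d → Fin d → Vec d} {p : ℝ → Torus d → ℝ} (hu : IsLeraySolution ν T u₀ f u G p)
    (hu2 : MemLp (fun z : ℝ × Torus d => u z.1 z.2) 2 (spaceTime d T))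
    (hf2 : MemLp (fun z : ℝ × Torus d => f z.1 z.2) 2 (spaceTime d T))
    {g : Torus d → ℝ} {g₁ g₂ : Fin d → Torus d → ℝ} (hg : SmoothOnTorus g)
    (hg₁ : ∀ j, SmoothOnTorus (g₁ j)) (hg₂ : ∀ j, SmoothOnTorus (g₂ j))
    (hgd : ∀ j, pderiv j g = g₁ j) (hgd₂ : ∀ j, pderiv j (g₁ j) = g₂ j) (i : Fin d) :
    HasWeakTimeDeriv T (fun s => ∫ y, g y * u s y i) (∫ y, g y * u₀ y i)
      (fun s => ∫ y, ((∑ j, g₁ j y * (u s y j * u s y i)) + g₁ i y * p s y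
        + ν * (∑ j, g₂ j y * u s y i) + g y * f s y i)) := by
  intro θ hθ
  set e : Vec d := EuclideanSpace.single i 1 with he
  have hin : ∀ (v : Vec d) (a b : ℝ), inner ℝ v (a • b • e) = a * (b * v i) := by
    intro v a b
    rw [inner_smul_right, inner_smul_right, he, EuclideanSpace.inner_single_right]
    simp
  have htest := hu.equation (fun t y => θ t • g y • e)
    (smoothOnSpaceTime_smul hθ.contDiff hg e) (by
      obtain ⟨b, hb, h⟩ := hθ.vanish
      exact ⟨b, hb, fun t ht x => by rw [h t ht, zero_smul]⟩)
  have hθd : ∀ t, DifferentiableAt ℝ θ t := fun t =>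
    (hθ.contDiff.differentiable (by simp)) t
  have ht : ∀ t x, tderiv (fun t y => θ t • g y • e) t x = deriv θ t • g x • e := fun t x => by
    unfold tderiv
    rw [deriv_smul_const (hθd t)]
  have h1 : ∀ t j, pderiv j (fun y => θ t • g y • e) = fun y => θ t • g₁ j y • e := fun t j => by
    rw [pderiv_smul_const hg, hgd]
  have h2 : ∀ t j, pderiv j (fun y => θ t • g₁ j y • e) = fun y => θ t • g₂ j y • e :=
    fun t j => by rw [pderiv_smul_const (hg₁ j), hgd₂]
  have hl : ∀ t x, laplacian (fun y => θ t • g y • e) x = ∑ j, θ t • g₂ j x • e := fun t x => by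
    unfold laplacian
    simp_rw [h1, h2]
  simp only [ht, h1, hl, hin, inner_sum] at htest
  have i0 : Integrable (fun z : ℝ × Torus d => g z.2 * u z.1 z.2 i) (spaceTime d T) :=
    integrable_continuous_mul hg.continuous measurable_snd (MemLp.component_integrable hu2 i)
  have i1 : Integrable (fun z : ℝ × Torus d => ∑ j, g₁ j z.2 * (u z.1 z.2 j * u z.1 z.2 i))
      (spaceTime d T) := integrable_finsetSum _ fun j _ =>
    integrable_continuous_mul (hg₁ j).continuous measurable_snd
      (MemLp.component_mul_integrable hu2 hu2 j i)
  have i2 : Integrable (fun z : ℝ × Torus d => g₁ i z.2 * p z.1 z.2) (spaceTime d T) :=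
    integrable_continuous_mul (hg₁ i).continuous measurable_snd hu.pressure_integrable
  have i3 : Integrable (fun z : ℝ × Torus d => ∑ j, g₂ j z.2 * u z.1 z.2 i) (spaceTime d T) :=
    integrable_finsetSum _ fun j _ =>
      integrable_continuous_mul (hg₂ j).continuous measurable_snd
        (MemLp.component_integrable hu2 i)
  have i4 : Integrable (fun z : ℝ × Torus d => g z.2 * f z.1 z.2 i) (spaceTime d T) :=
    integrable_continuous_mul hg.continuous measurable_snd (MemLp.component_integrable hf2 i)
  have iH := ((i1.add i2).add (i3.const_mul ν)).add i4
  have j0 := integrable_time_mul (hθ.contDiff.continuous_deriv (by simp)) i0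
  have jH := integrable_time_mul hθ.contDiff.continuous iH
  have e1 := integral_spaceTime j0
  have e2 := integral_spaceTime jH
  simp only [integral_const_mul, Pi.add_apply] at e1 e2
  simp only [Pi.add_apply] at jH
  rw [← e1, ← e2, ← integral_add j0 jH]
  refine Eq.trans ?_ htest
  congr 1
  · refine integral_congr_ae (ae_of_all _ fun z => ?_)
    -- The test field points in direction `e_i`, so its divergence retains a single derivative, the
    -- one paired with the pressure.
    have hdiv : ∑ j, (θ z.1 • g₁ j z.2 • e) j = θ z.1 * g₁ i z.2 := by
      rw [Finset.sum_eq_single i]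
      · simp [he]
      · intro j _ hj
        simp [he, hj]
      · simp
    simp only
    rw [hdiv]
    simp only [Finset.mul_sum, mul_add, ← add_assoc]
    congr 1
    · congr 1
      · congr 1
        · congr 1
          exact Finset.sum_congr rfl fun j _ => by ring
        · ring
      · exact Finset.sum_congr rfl fun j _ => by ring
  · rw [← integral_const_mul]

/-! ### Averages of space-time functions -/

lemma integrable_kernel_mul {m : Torus d → ℝ} (hm : Continuous m) {F : ℝ → Torus d → ℝ}
    (hF : Integrable (fun z : ℝ × Torus d => F z.1 z.2) (spaceTime d T)) :
    Integrable (fun q : (ℝ × Torus d) × Torus d => m (q.2 - q.1.2) * F q.1.1 q.2)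
      ((spaceTime d T).prod volume) := by
  have hmp : MeasurePreserving (Prod.map Prod.fst id : (ℝ × Torus d) × Torus d → ℝ × Torus d)
      ((spaceTime d T).prod volume) (spaceTime d T) :=
    MeasurePreserving.prod measurePreserving_fst (MeasurePreserving.id volume)
  exact integrable_continuous_mul hm (g := fun q : (ℝ × Torus d) × Torus d => q.2 - q.1.2)
    (by fun_prop) ((hmp.integrable_comp hF.aestronglyMeasurable).2 hF)

lemma integrable_average {m : Torus d → ℝ} (hm : Continuous m) {F : ℝ → Torus d → ℝ}
    (hF : Integrable (fun z : ℝ × Torus d => F z.1 z.2) (spaceTime d T)) :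
    Integrable (fun z : ℝ × Torus d => average m (F z.1) z.2) (spaceTime d T) :=
  (integrable_kernel_mul hm hF).integral_prod_left

lemma integrable_average_slice {m : Torus d → ℝ} (hm : Continuous m) {F : ℝ → Torus d → ℝ}
    (hF : Integrable (fun z : ℝ × Torus d => F z.1 z.2) (spaceTime d T)) (x : Torus d) :
    IntegrableOn (fun s => average m (F s) x) (Ioo 0 T) :=
  (integrable_continuous_mul hm (g := fun z : ℝ × Torus d => z.2 - x) (by fun_prop)
    hF).integral_prod_left

end

section

/-! ### Averages of Leray solutions -/

variable {d : ℕ} {T : ℝ}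

lemma HasWeakTimeDeriv.congr_deriv {U H H' : ℝ → ℝ} {c : ℝ} (h : HasWeakTimeDeriv T U c H)
    (hH : H' =ᵐ[volume.restrict (Ioo 0 T)] H) : HasWeakTimeDeriv T U c H' := by
  intro θ hθ
  have e : ∫ t in Ioo 0 T, θ t * H' t = ∫ t in Ioo 0 T, θ t * H t := by
    refine integral_congr_ae ?_
    filter_upwards [hH] with t ht
    rw [ht]
  rw [e, h θ hθ]

lemma HasWeakTimeDeriv.sum {ι : Type*} (s : Finset ι) {U H : ι → ℝ → ℝ} {c : ι → ℝ}
    (hU : ∀ i ∈ s, IntegrableOn (U i) (Ioo 0 T)) (hH : ∀ i ∈ s, IntegrableOn (H i) (Ioo 0 T))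
    (h : ∀ i ∈ s, HasWeakTimeDeriv T (U i) (c i) (H i)) :
    HasWeakTimeDeriv T (fun t => ∑ i ∈ s, U i t) (∑ i ∈ s, c i) (fun t => ∑ i ∈ s, H i t) := by
  intro θ hθ
  simp_rw [Finset.mul_sum]
  rw [integral_finsetSum _ fun i hi =>
      integrableOn_time_mul (hθ.contDiff.continuous_deriv (by simp)) (hU i hi),
    integral_finsetSum _ fun i hi => integrableOn_time_mul hθ.contDiff.continuous (hH i hi),
    ← Finset.sum_add_distrib, ← Finset.sum_add_distrib]
  exact Finset.sum_eq_zero fun i hi => h i hi θ hθ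

/-- Weak time derivatives at the points of the torus may be integrated in space. -/
lemma HasWeakTimeDeriv.integral {W H : ℝ → Torus d → ℝ} {W₀ : Torus d → ℝ}
    (hW : Integrable (fun z : ℝ × Torus d => W z.1 z.2) (spaceTime d T))
    (hH : Integrable (fun z : ℝ × Torus d => H z.1 z.2) (spaceTime d T)) (hW₀ : Integrable W₀)
    (h : ∀ x, HasWeakTimeDeriv T (fun s => W s x) (W₀ x) (fun s => H s x)) :
    HasWeakTimeDeriv T (fun s => ∫ x, W s x) (∫ x, W₀ x) (fun s => ∫ x, H s x) := by
  intro θ hθ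
  have i1 := integrable_time_mul (hθ.contDiff.continuous_deriv (by simp)) hW
  have i2 := integrable_time_mul hθ.contDiff.continuous hH
  have e1 := integral_integral_swap (f := fun (s : ℝ) x => deriv θ s * W s x)
    (μ := volume.restrict (Ioo 0 T)) (ν := (volume : Measure (Torus d))) i1
  have e2 := integral_integral_swap (f := fun (s : ℝ) x => θ s * H s x)
    (μ := volume.restrict (Ioo 0 T)) (ν := (volume : Measure (Torus d))) i2
  simp_rw [← integral_const_mul]
  rw [e1, e2, ← integral_add i1.integral_prod_right i2.integral_prod_right, ← integral_add
    (i1.integral_prod_right.fun_add i2.integral_prod_right) (hW₀.const_mul _)]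
  refine (integral_congr_ae (ae_of_all _ fun x => h x θ hθ)).trans (integral_zero _ _)

/-- The sum of `bil` over components. -/
def dotK (m : Torus d → ℝ) (v w : Torus d → Vec d) : ℝ :=
  ∑ i, bil m (fun x => v x i) (fun x => w x i)

/-- The cubic energy flux with kernels `m j`. -/
def fluxK (m : Fin d → Torus d → ℝ) (v : Torus d → Vec d) : ℝ :=
  ∑ i, ∑ j, bil (m j) (fun x => v x j * v x i) (fun x => v x i)

lemma continuous_average {m a : Torus d → ℝ} (hm : Continuous m) (ha : Integrable a) :
    Continuous (average m a) := by
  obtain ⟨C, -, hC⟩ := exists_bound_of_continuous hm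
  refine continuous_of_dominated (bound := fun y => C * |a y|) (fun x => ?_)
    (fun x => ae_of_all _ fun y => ?_) (ha.abs.const_mul C) (ae_of_all _ fun y => by fun_prop)
  · exact (integrable_continuous_mul hm (g := fun y => y - x) (by fun_prop)
      ha).aestronglyMeasurable
  · rw [norm_mul]
    exact mul_le_mul_of_nonneg_right (hC _) (abs_nonneg _)

section Leray

variable {ν : ℝ} {u₀ : Torus d → Vec d} {f u : ℝ → Torus d → Vec d}
    {G : ℝ → Torus d → Fin d → Vec d} {p : ℝ → Torus d → ℝ}

lemma ae_slice_memLp {p : ℝ≥0∞} (hp : p ≠ 0) (hp' : p ≠ ⊤) {v : ℝ → Torus d → Vec d}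
    (hv : MemLp (fun z : ℝ × Torus d => v z.1 z.2) p (spaceTime d T)) :
    ∀ᵐ s ∂(volume.restrict (Ioo 0 T)), MemLp (v s) p volume := by
  have h1 := hv.aestronglyMeasurable.prodMk_left
  have h2 := (hv.integrable_norm_rpow hp hp').prod_right_ae
  filter_upwards [h1, h2] with s hs1 hs2
  exact (integrable_norm_rpow_iff hs1 hp hp').1 hs2

/-- The averages of `u` are bounded. -/
lemma IsLeraySolution.average_bounded (hu : IsLeraySolution ν T u₀ f u G p) {m : Torus d → ℝ}
    (hm : Continuous m) (i : Fin d) :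
    ∃ C : ℝ, ∀ᵐ z ∂(spaceTime d T), ‖average m (fun y => u z.1 y i) z.2‖ ≤ C := by
  obtain ⟨C₀, hC₀⟩ := hu.energy_bounded
  obtain ⟨C, hC0, hC⟩ := exists_bound_of_continuous hm
  refine ⟨C * C₀, ?_⟩
  have h : ∀ᵐ s ∂(volume.restrict (Ioo 0 T)),
      ∀ x, ‖average m (fun y => u s y i) x‖ ≤ C * C₀ := by
    filter_upwards [hC₀, hu.measurable.prodMk_left] with s hs hms x
    have hms' : AEStronglyMeasurable (u s) volume := hms
    have hL2 : MemLp (u s) 2 volume := ⟨hms', hs.trans_lt ENNReal.coe_lt_top⟩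
    have hint : Integrable (u s) := hL2.integrable (by norm_num)
    -- The torus has measure one, so the `L¹` norm is at most the `L²` norm.
    have h1 : ∫ y, ‖u s y‖ ≤ C₀ := by
      have hle : eLpNorm (u s) 1 volume ≤ C₀ :=
        (eLpNorm_le_eLpNorm_of_exponent_le (by norm_num) hms').trans hs
      rw [integral_norm_eq_lintegral_enorm hms', ← eLpNorm_one_eq_lintegral_enorm]
      exact ENNReal.toReal_le_of_le_ofReal C₀.coe_nonneg (by simpa using hle)
    calc ‖average m (fun y => u s y i) x‖ ≤ ∫ y, C * ‖u s y‖ := by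
          refine norm_integral_le_of_norm_le (hint.norm.const_mul C) (ae_of_all _ fun y => ?_)
          rw [norm_mul]
          exact mul_le_mul (hC _) (PiLp.norm_apply_le _ _) (norm_nonneg _) hC0
      _ = C * ∫ y, ‖u s y‖ := integral_const_mul _ _
      _ ≤ C * C₀ := mul_le_mul_of_nonneg_left h1 hC0
  have h2 := (Measure.quasiMeasurePreserving_fst
    (μ := volume.restrict (Ioo 0 T)) (ν := (volume : Measure (Torus d)))).ae h
  filter_upwards [h2] with z hz using hz z.2

/-- The space integral of the product of an average of `u` and of another average. -/
lemma IsLeraySolution.integrable_average_mul (hu : IsLeraySolution ν T u₀ f u G p)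
    (hu2 : MemLp (fun z : ℝ × Torus d => u z.1 z.2) 2 (spaceTime d T))
    {κ m : Torus d → ℝ} (hκ : Continuous κ) (hm : Continuous m) (i : Fin d)
    {F : ℝ → Torus d → ℝ} (hF : Integrable (fun z : ℝ × Torus d => F z.1 z.2) (spaceTime d T)) :
    Integrable (fun z : ℝ × Torus d => average κ (fun y => u z.1 y i) z.2 * average m (F z.1) z.2)
      (spaceTime d T) := by
  -- One bounded factor is needed, since the other may average the pressure or a product `u_j u_i`,
  -- known only to be integrable.
  obtain ⟨C, hC⟩ := hu.average_bounded hκ i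
  exact Integrable.bdd_mul (integrable_average hm hF)
    (integrable_average (F := fun s y => u s y i) hκ
      (MemLp.component_integrable hu2 i)).aestronglyMeasurable hC

lemma IsLeraySolution.ae_integral_average_mul
    (hu2 : MemLp (fun z : ℝ × Torus d => u z.1 z.2) 2 (spaceTime d T))
    {κ m : Torus d → ℝ} (hκ : Continuous κ) (hm : Continuous m) (i : Fin d)
    {F : ℝ → Torus d → ℝ} (hF : Integrable (fun z : ℝ × Torus d => F z.1 z.2) (spaceTime d T)) :
    (fun s => ∫ x, average κ (fun y => u s y i) x * average m (F s) x)
      =ᵐ[volume.restrict (Ioo 0 T)] fun s => bil (corr κ m) (F s) (fun x => u s x i) := by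
  filter_upwards [ae_slice_memLp (by norm_num) (by norm_num) hu2, hF.prod_right_ae] with s h1 h2
  exact integral_average_mul_average hκ hm (MemLp.component_integrable h1 i) h2

/-- Integrability in time, measurability included, is inherited through Fubini from the product of
two averages on space-time. -/
lemma IsLeraySolution.integrableOn_bil (hu : IsLeraySolution ν T u₀ f u G p)
    (hu2 : MemLp (fun z : ℝ × Torus d => u z.1 z.2) 2 (spaceTime d T))
    {κ m : Torus d → ℝ} (hκ : Continuous κ) (hm : Continuous m) (i : Fin d)
    {F : ℝ → Torus d → ℝ} (hF : Integrable (fun z : ℝ × Torus d => F z.1 z.2) (spaceTime d T)) :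
    IntegrableOn (fun s => bil (corr κ m) (F s) (fun x => u s x i)) (Ioo 0 T) :=
  (hu.integrable_average_mul hu2 hκ hm i hF).integral_prod_left.congr
    (IsLeraySolution.ae_integral_average_mul hu2 hκ hm i hF)

/-- Averages of `u` at a point solve the averaged equation. -/
lemma IsLeraySolution.average_hasWeakTimeDeriv (hu : IsLeraySolution ν T u₀ f u G p)
    (hu2 : MemLp (fun z : ℝ × Torus d => u z.1 z.2) 2 (spaceTime d T))
    (hf2 : MemLp (fun z : ℝ × Torus d => f z.1 z.2) 2 (spaceTime d T))
    {A ℓ : ℝ} {κ : Torus d → ℝ} {κ₁ κ₂ : Fin d → Torus d → ℝ} (hκ : IsMollifier A ℓ κ κ₁ κ₂)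
    (i : Fin d) (x : Torus d) :
    HasWeakTimeDeriv T (fun s => average κ (fun y => u s y i) x) (average κ (fun y => u₀ y i) x)
      (fun s => (∑ j, average (κ₁ j) (fun y => u s y j * u s y i) x) + average (κ₁ i) (p s) x
        + ν * (∑ j, average (κ₂ j) (fun y => u s y i) x) + average κ (fun y => f s y i) x) := by
  have h := hu.hasWeakTimeDeriv hu2 hf2 (g := fun y => κ (y + -x))
    (g₁ := fun j y => κ₁ j (y + -x)) (g₂ := fun j y => κ₂ j (y + -x))
    (hκ.smooth.comp_add _) (fun j => (hκ.smooth_fst j).comp_add _)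
    (fun j => (hκ.smooth_snd j).comp_add _) (fun j => by rw [pderiv_comp_add, hκ.pderiv_eq])
    (fun j => by rw [pderiv_comp_add, hκ.pderiv_fst]) i
  simp only [← sub_eq_add_neg] at h
  refine h.congr_deriv ?_
  filter_upwards [ae_slice_memLp (by norm_num) (by norm_num) hu2,
    ae_slice_memLp (by norm_num) (by norm_num) hf2, hu.pressure_integrable.prod_right_ae]
    with s h1 h2 h3
  have hg : Measurable (fun y : Torus d => y - x) := by fun_prop
  have i1 : ∀ j, Integrable (fun y => κ₁ j (y - x) * (u s y j * u s y i)) := fun j =>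
    integrable_continuous_mul (hκ.smooth_fst j).continuous hg
      (MemLp.component_mul_integrable h1 h1 j i)
  have i2 : Integrable (fun y => κ₁ i (y - x) * p s y) :=
    integrable_continuous_mul (hκ.smooth_fst i).continuous hg h3
  have i3 : ∀ j, Integrable (fun y => κ₂ j (y - x) * u s y i) := fun j =>
    integrable_continuous_mul (hκ.smooth_snd j).continuous hg (MemLp.component_integrable h1 i)
  have i4 : Integrable (fun y => κ (y - x) * f s y i) :=
    integrable_continuous_mul hκ.smooth.continuous hg (MemLp.component_integrable h2 i)
  have i1' := integrable_finsetSum Finset.univ fun j _ => i1 j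
  have i3' := (integrable_finsetSum Finset.univ fun j _ => i3 j).const_mul ν
  rw [integral_add ((i1'.fun_add i2).fun_add i3') i4, integral_add (i1'.fun_add i2) i3',
    integral_add i1' i2, integral_finsetSum _ fun j _ => i1 j, integral_const_mul,
    integral_finsetSum _ fun j _ => i3 j]
  rfl

end Leray

end

section

/-! ### The mollified energy balance -/

variable {d : ℕ} {T : ℝ}

/-- This is weak incompressibility tested with a translate of the mollifier. -/
lemma IsMollifier.solenoidal_kernel {A ℓ : ℝ} {κ : Torus d → ℝ} {κ₁ κ₂ : Fin d → Torus d → ℝ}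
    (hκ : IsMollifier A ℓ κ κ₁ κ₂) {v : Torus d → Vec d} (hv : MemLp v 2 volume)
    (hdiv : IsSolenoidal v) (c : Torus d) : ∑ j, ∫ y, κ₁ j (y + c) * v y j = 0 := by
  have h := hdiv (fun y => κ (y + c)) (hκ.smooth.comp_add c)
  simp_rw [pderiv_comp_add, hκ.pderiv_eq] at h
  rw [← h, integral_finsetSum]
  · simp_rw [mul_comm]
  · intro j _
    simp_rw [mul_comm (v _ j)]
    exact integrable_continuous_mul (hκ.smooth_fst j).continuous (by fun_prop)
      (MemLp.component_integrable hv j)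

lemma IsWeakGradient.component {v : Torus d → Vec d} {G : Torus d → Fin d → Vec d}
    (h : IsWeakGradient v G) (hv : MemLp v 2 volume) (hG : ∀ j, MemLp (fun x => G x j) 2 volume)
    {g g' : Torus d → ℝ} (hg : SmoothOnTorus g) {j : Fin d} (hg' : SmoothOnTorus g')
    (hd : pderiv j g = g') (i : Fin d) (c : Torus d) :
    ∫ y, g' (y + c) * v y i = -∫ y, g (y + c) * G y j i := by
  have h1 := h j (fun y => g (y + c)) (hg.comp_add c)
  simp_rw [pderiv_comp_add, hd] at h1
  have hvi : Integrable v := hv.integrable (by norm_num)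
  have hGi : Integrable (fun x => G x j) := (hG j).integrable (by norm_num)
  obtain ⟨C, -, hC⟩ := exists_bound_of_continuous hg.continuous
  obtain ⟨C', -, hC'⟩ := exists_bound_of_continuous hg'.continuous
  have m1 : Continuous (fun y : Torus d => g (y + c)) :=
    hg.continuous.comp (continuous_id.add continuous_const)
  have m2 : Continuous (fun y : Torus d => g' (y + c)) :=
    hg'.continuous.comp (continuous_id.add continuous_const)
  have e1 := (EuclideanSpace.proj (𝕜 := ℝ) i : Vec d →L[ℝ] ℝ).integral_comp_comm
    (hvi.bdd_smul C' m2.aestronglyMeasurable (ae_of_all _ fun y => hC' (y + c)))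
  have e2 := (EuclideanSpace.proj (𝕜 := ℝ) i : Vec d →L[ℝ] ℝ).integral_comp_comm
    (hGi.bdd_smul C m1.aestronglyMeasurable (ae_of_all _ fun y => hC (y + c)))
  have e3 := congrArg (EuclideanSpace.proj (𝕜 := ℝ) i : Vec d →L[ℝ] ℝ) h1
  simp only [Pi.smul_apply'] at e1 e2
  rw [map_neg, ← e1, ← e2] at e3
  simpa using e3

/-- The pressure does not contribute to the energy balance. -/
lemma IsMollifier.sum_bil_pressure {A ℓ : ℝ} {κ : Torus d → ℝ} {κ₁ κ₂ : Fin d → Torus d → ℝ}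
    (hκ : IsMollifier A ℓ κ κ₁ κ₂) {v : Torus d → Vec d} (hv : MemLp v 2 volume)
    (hdiv : IsSolenoidal v) {p : Torus d → ℝ} (hp : Integrable p) :
    ∑ j, bil (corr κ (κ₁ j)) (fun x => v x j) p = 0 :=
  sum_bil_eq_zero (fun j => continuous_corr hκ.smooth.continuous (hκ.smooth_fst j).continuous)
    (fun j => MemLp.component_integrable hv j)
    (corr_div_free hκ.smooth.continuous (fun j => (hκ.smooth_fst j).continuous)
      (fun j => MemLp.component_integrable hv j) (hκ.solenoidal_kernel hv hdiv)) hp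

lemma IsMollifier.corr_odd {A ℓ : ℝ} {κ : Torus d → ℝ} {κ₁ κ₂ : Fin d → Torus d → ℝ}
    (hκ : IsMollifier A ℓ κ κ₁ κ₂) (j : Fin d) (x : Torus d) :
    corr κ (κ₁ j) (-x) = -corr κ (κ₁ j) x := by
  rw [corr_neg (-1) hκ.even (by simpa using hκ.odd_fst j), neg_one_mul]

lemma IsMollifier.corr_even {A ℓ : ℝ} {κ : Torus d → ℝ} {κ₁ κ₂ : Fin d → Torus d → ℝ}
    (hκ : IsMollifier A ℓ κ κ₁ κ₂) (x : Torus d) : corr κ κ (-x) = corr κ κ x := by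
  rw [corr_neg 1 hκ.even (by simpa using hκ.even), one_mul]

lemma IsMollifier.corr_even_snd {A ℓ : ℝ} {κ : Torus d → ℝ} {κ₁ κ₂ : Fin d → Torus d → ℝ}
    (hκ : IsMollifier A ℓ κ κ₁ κ₂) (j : Fin d) (x : Torus d) :
    corr κ (κ₂ j) (-x) = corr κ (κ₂ j) x := by
  rw [corr_neg 1 hκ.even (by simpa using hκ.even_snd j), one_mul]

/-- The viscous term of the mollified balance in terms of the gradient. -/
lemma IsMollifier.dotK_snd {A ℓ : ℝ} {κ : Torus d → ℝ} {κ₁ κ₂ : Fin d → Torus d → ℝ}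
    (hκ : IsMollifier A ℓ κ κ₁ κ₂) {v : Torus d → Vec d} {G : Torus d → Fin d → Vec d}
    (hv : MemLp v 2 volume) (hG : ∀ j, MemLp (fun x => G x j) 2 volume)
    (h : IsWeakGradient v G) (j : Fin d) :
    dotK (corr κ (κ₂ j)) v v = -dotK (corr κ κ) (fun x => G x j) (fun x => G x j) := by
  unfold dotK
  rw [← Finset.sum_neg_distrib]
  refine Finset.sum_congr rfl fun i _ => ?_
  have c0 := hκ.smooth.continuous
  have c1 := (hκ.smooth_fst j).continuous
  have c2 := (hκ.smooth_snd j).continuous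
  have hvi := MemLp.component_integrable hv i
  have hGi := MemLp.component_integrable (hG j) i
  -- Two integrations by parts, one on each copy of `v`. Between them the odd kernel is reflected to
  -- exchange the slots, and the three signs combine to a minus.
  rw [bil_eq_neg_bil (continuous_corr c0 c1) (continuous_corr c0 c2) hvi hGi
    (corr_weak_deriv c0 c1 c2 hvi hGi (h.component hv hG (hκ.smooth_fst j) (hκ.smooth_snd j)
      (hκ.pderiv_fst j) i)) hvi,
    bil_swap (-1) (by simpa using hκ.corr_odd j),
    bil_eq_neg_bil (continuous_corr c0 c0) (continuous_corr c0 c1) hvi hGi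
    (corr_weak_deriv c0 c0 c1 hvi hGi (h.component hv hG hκ.smooth (hκ.smooth_fst j)
      (hκ.pderiv_eq j) i)) hGi]
  ring

/-- The right-hand side of the mollified energy balance. -/
def balanceRate (ν : ℝ) (k : Torus d → ℝ) (k₁ k₂ : Fin d → Torus d → ℝ)
    (f u : Torus d → Vec d) : ℝ :=
  fluxK k₁ u + ν * (∑ j, dotK (k₂ j) u u) + dotK k f u

section Leray

variable {ν : ℝ} {u₀ : Torus d → Vec d} {f u : ℝ → Torus d → Vec d}
    {G : ℝ → Torus d → Fin d → Vec d} {p : ℝ → Torus d → ℝ}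

lemma sum_balance (ν : ℝ) (a q b F : Fin d → ℝ) (hq : ∑ i, q i = 0) :
    ∑ i, 2 * (a i + q i + ν * b i + F i) = 2 * (∑ i, a i + ν * ∑ i, b i + ∑ i, F i) := by
  rw [← Finset.mul_sum]
  simp only [Finset.sum_add_distrib, ← Finset.mul_sum]
  rw [hq]
  ring

/-- The energy balance of the mollified solution. -/
theorem IsLeraySolution.mollified_balance (hu : IsLeraySolution ν T u₀ f u G p)
    (hu2 : MemLp (fun z : ℝ × Torus d => u z.1 z.2) 2 (spaceTime d T))
    (hf2 : MemLp (fun z : ℝ × Torus d => f z.1 z.2) 2 (spaceTime d T))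
    (hu₀ : MemLp u₀ 2 volume)
    {A ℓ : ℝ} {κ : Torus d → ℝ} {κ₁ κ₂ : Fin d → Torus d → ℝ} (hκ : IsMollifier A ℓ κ κ₁ κ₂)
    (hT : 0 < T) :
    HasWeakTimeDeriv T (fun s => dotK (corr κ κ) (u s) (u s)) (dotK (corr κ κ) u₀ u₀)
      (fun s => 2 * balanceRate ν (corr κ κ) (fun j => corr κ (κ₁ j)) (fun j => corr κ (κ₂ j))
        (f s) (u s)) := by
  have c0 := hκ.smooth.continuous
  have c1 := fun j => (hκ.smooth_fst j).continuous
  have c2 := fun j => (hκ.smooth_snd j).continuous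
  have hui := fun i => MemLp.component_integrable hu2 i
  have huu := fun i j => MemLp.component_mul_integrable hu2 hu2 i j
  have hfi := fun i => MemLp.component_integrable hf2 i
  have hp := hu.pressure_integrable
  set w : Fin d → ℝ → Torus d → ℝ := fun i s x => average κ (fun y => u s y i) x with hw
  set H : Fin d → ℝ → Torus d → ℝ := fun i s x =>
    (∑ j, average (κ₁ j) (fun y => u s y j * u s y i) x) + average (κ₁ i) (p s) x
        + ν * (∑ j, average (κ₂ j) (fun y => u s y i) x) + average κ (fun y => f s y i) x with hH
  -- integrability in space-time
  have iA : ∀ i, Integrable (fun z : ℝ × Torus d => w i z.1 z.2 ^ 2) (spaceTime d T) := by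
    intro i
    simp_rw [pow_two]
    exact hu.integrable_average_mul hu2 c0 c0 i (F := fun s y => u s y i) (hui i)
  have iH : ∀ i, Integrable (fun z : ℝ × Torus d => 2 * (w i z.1 z.2 * H i z.1 z.2))
      (spaceTime d T) := by
    intro i
    refine Integrable.const_mul ?_ 2
    simp only [hH, mul_add, Finset.mul_sum]
    refine ((Integrable.add ?_ ?_).add ?_).add ?_
    · exact integrable_finsetSum _ fun j _ => hu.integrable_average_mul hu2 c0 (c1 j) i
        (F := fun s y => u s y j * u s y i) (huu j i)
    · exact hu.integrable_average_mul hu2 c0 (c1 i) i hp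
    · refine integrable_finsetSum _ fun j _ => ?_
      simp_rw [mul_left_comm _ ν]
      exact (hu.integrable_average_mul hu2 c0 (c2 j) i (F := fun s y => u s y i)
        (hui i)).const_mul ν
    · exact hu.integrable_average_mul hu2 c0 c0 i (F := fun s y => f s y i) (hfi i)
  have iHs : ∀ i x, IntegrableOn (fun s => H i s x) (Ioo 0 T) := by
    intro i x
    refine ((Integrable.add ?_ ?_).add ?_).add ?_
    · exact integrable_finsetSum _ fun j _ => integrable_average_slice (c1 j)
        (F := fun s y => u s y j * u s y i) (huu j i) x
    · exact integrable_average_slice (c1 i) hp x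
    · exact (integrable_finsetSum _ fun j _ => integrable_average_slice (c2 j)
        (F := fun s y => u s y i) (hui i) x).const_mul ν
    · exact integrable_average_slice c0 (F := fun s y => f s y i) (hfi i) x
  have i0 : ∀ i, Integrable (fun x => average κ (fun y => u₀ y i) x ^ 2) := fun i =>
    Continuous.integrable_torus
      ((continuous_average c0 (MemLp.component_integrable hu₀ i)).pow 2)
  have key : ∀ i, HasWeakTimeDeriv T (fun s => ∫ x, w i s x ^ 2)
      (∫ x, average κ (fun y => u₀ y i) x ^ 2) (fun s => ∫ x, 2 * (w i s x * H i s x)) := by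
    intro i
    -- At a fixed `x` the averaged component is a scalar function of time with integrable weak
    -- derivative, so the chain rule for squares applies before integrating in `x`.
    refine HasWeakTimeDeriv.integral (iA i) (iH i) (i0 i) fun x => ?_
    exact HasWeakTimeDeriv.sq hT (integrable_average_slice c0 (F := fun s y => u s y i) (hui i) x)
      (iHs i x) (hu.average_hasWeakTimeDeriv hu2 hf2 hκ i x)
  have hsum := HasWeakTimeDeriv.sum Finset.univ (fun i _ => (iA i).integral_prod_left)
    (fun i _ => (iH i).integral_prod_left) (fun i _ => key i)
  have hinit : ∑ i, ∫ x, average κ (fun y => u₀ y i) x ^ 2 = dotK (corr κ κ) u₀ u₀ := by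
    refine Finset.sum_congr rfl fun i _ => ?_
    simp_rw [pow_two]
    have := MemLp.component_integrable hu₀ i
    exact integral_average_mul_average c0 c0 this this
  rw [hinit] at hsum
  refine (hsum.congr ?_).congr_deriv ?_
  · filter_upwards [ae_slice_memLp (by norm_num) (by norm_num) hu2] with s hs
    refine Finset.sum_congr rfl fun i _ => ?_
    simp_rw [pow_two]
    have := MemLp.component_integrable hs i
    exact (integral_average_mul_average c0 c0 this this).symm
  · filter_upwards [ae_slice_memLp (by norm_num) (by norm_num) hu2,
      ae_slice_memLp (by norm_num) (by norm_num) hf2, hp.prod_right_ae, hu.solenoidal]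
      with s h1 h2 h3 h4
    have s1 := fun i => MemLp.component_integrable h1 i
    have s2 := fun i => MemLp.component_integrable h2 i
    have s3 := fun i j => MemLp.component_mul_integrable h1 h1 i j
    have hone : ∀ i, ∫ x, 2 * (w i s x * H i s x)
        = 2 * ((∑ j, bil (corr κ (κ₁ j)) (fun x => u s x j * u s x i) (fun x => u s x i))
          + bil (corr κ (κ₁ i)) (p s) (fun x => u s x i)
          + ν * (∑ j, bil (corr κ (κ₂ j)) (fun x => u s x i) (fun x => u s x i))
          + bil (corr κ κ) (fun x => f s x i) (fun x => u s x i)) := by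
      intro i
      have cw := continuous_average c0 (s1 i)
      have t1 : ∀ j, Integrable (fun x => w i s x *
          average (κ₁ j) (fun y => u s y j * u s y i) x) := fun j =>
        Continuous.integrable_torus (cw.mul (continuous_average (c1 j) (s3 j i)))
      have t2 : Integrable (fun x => w i s x * average (κ₁ i) (p s) x) :=
        Continuous.integrable_torus (cw.mul (continuous_average (c1 i) h3))
      have t3 : ∀ j, Integrable (fun x => w i s x * average (κ₂ j) (fun y => u s y i) x) :=
        fun j => Continuous.integrable_torus (cw.mul (continuous_average (c2 j) (s1 i)))
      have t4 : Integrable (fun x => w i s x * average κ (fun y => f s y i) x) :=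
        Continuous.integrable_torus (cw.mul (continuous_average c0 (s2 i)))
      have e : ∀ x, w i s x * H i s x
          = (∑ j, w i s x * average (κ₁ j) (fun y => u s y j * u s y i) x)
            + w i s x * average (κ₁ i) (p s) x
            + ν * (∑ j, w i s x * average (κ₂ j) (fun y => u s y i) x)
            + w i s x * average κ (fun y => f s y i) x := fun x => by
        simp only [hH, Finset.mul_sum, mul_add, mul_left_comm _ ν]
      have t1' := integrable_finsetSum Finset.univ fun j _ => t1 j
      have t3' := (integrable_finsetSum Finset.univ fun j _ => t3 j).const_mul ν
      simp_rw [e]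
      rw [integral_const_mul, integral_add ((t1'.fun_add t2).fun_add t3') t4,
        integral_add (t1'.fun_add t2) t3', integral_add t1' t2, integral_finsetSum _ fun j _ => t1 j,
        integral_const_mul, integral_finsetSum _ fun j _ => t3 j,
        integral_average_mul_average c0 (c1 i) (s1 i) h3,
        integral_average_mul_average c0 c0 (s1 i) (s2 i)]
      rw [Finset.sum_congr rfl fun j _ => integral_average_mul_average c0 (c1 j) (s1 i) (s3 j i),
        Finset.sum_congr rfl fun j _ => integral_average_mul_average c0 (c2 j) (s1 i) (s1 i)]
    -- The pressure sits in the first slot here; reflecting the odd kernel moves the velocity there,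
    -- where incompressibility acts.
    have hpress : ∑ i, bil (corr κ (κ₁ i)) (p s) (fun x => u s x i) = 0 := by
      have h := hκ.sum_bil_pressure h1 h4 h3
      rw [← neg_eq_zero, ← Finset.sum_neg_distrib, ← h]
      refine Finset.sum_congr rfl fun i _ => ?_
      rw [bil_swap (-1) (by simpa using hκ.corr_odd i)]
      ring
    rw [Finset.sum_congr rfl fun i _ => hone i, sum_balance _ _ _ _ _ hpress, balanceRate, fluxK]
    unfold dotK
    congr 4
    exact Finset.sum_comm

lemma IsLeraySolution.integrableOn_dotK (hu : IsLeraySolution ν T u₀ f u G p)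
    (hu2 : MemLp (fun z : ℝ × Torus d => u z.1 z.2) 2 (spaceTime d T))
    {κ m : Torus d → ℝ} (hκ : Continuous κ) (hm : Continuous m) {v : ℝ → Torus d → Vec d}
    (hv : MemLp (fun z : ℝ × Torus d => v z.1 z.2) 2 (spaceTime d T)) :
    IntegrableOn (fun s => dotK (corr κ m) (v s) (u s)) (Ioo 0 T) :=
  integrable_finsetSum _ fun i _ => hu.integrableOn_bil hu2 hκ hm i (F := fun s x => v s x i)
    (MemLp.component_integrable hv i)

lemma IsLeraySolution.integrableOn_fluxK (hu : IsLeraySolution ν T u₀ f u G p)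
    (hu2 : MemLp (fun z : ℝ × Torus d => u z.1 z.2) 2 (spaceTime d T))
    {κ : Torus d → ℝ} {m : Fin d → Torus d → ℝ} (hκ : Continuous κ) (hm : ∀ j, Continuous (m j)) :
    IntegrableOn (fun s => fluxK (fun j => corr κ (m j)) (u s)) (Ioo 0 T) :=
  integrable_finsetSum _ fun i _ => integrable_finsetSum _ fun j _ =>
    hu.integrableOn_bil hu2 hκ (hm j) i (F := fun s x => u s x j * u s x i)
      (MemLp.component_mul_integrable hu2 hu2 j i)

end Leray

end

section

variable {d : ℕ} {T : ℝ}

/-! ### Bounds by increments -/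

/-- The moment `∫∫ |m(y - z)| |v(y) - v(z)|^n dy dz`. -/
def incr (n : ℕ) (m : Torus d → ℝ) (v : Torus d → Vec d) : ℝ≥0∞ :=
  ∫⁻ q : Torus d × Torus d, ‖m (q.1 - q.2)‖ₑ * ‖v q.1 - v q.2‖ₑ ^ n

lemma inner_eq_sum (a b : Vec d) : inner ℝ a b = ∑ i, a i * b i := by
  rw [PiLp.inner_apply]
  exact Finset.sum_congr rfl fun i _ => by simp [mul_comm]

lemma enorm_component_le (a : Vec d) (i : Fin d) : ‖a i‖ₑ ≤ ‖a‖ₑ := by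
  rw [← ofReal_norm, ← ofReal_norm]
  exact ENNReal.ofReal_le_ofReal (PiLp.norm_apply_le a i)

lemma memLp_two_inner_integrable {α : Type*} [MeasurableSpace α] {μ : Measure α} {v w : α → Vec d}
    (hv : MemLp v 2 μ) (hw : MemLp w 2 μ) : Integrable (fun z => inner ℝ (v z) (w z)) μ := by
  simp_rw [inner_eq_sum]
  exact integrable_finsetSum _ fun i _ => MemLp.component_mul_integrable hv hw i i

lemma memLp_comp_fst_sub_comp_snd {v : Torus d → Vec d} (hv : MemLp v 2 volume) :
    MemLp (fun q : Torus d × Torus d => v q.1 - v q.2) 2 volume :=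
  (hv.comp_measurePreserving (measurePreserving_fst (ν := (volume : Measure (Torus d))))).sub
    (hv.comp_measurePreserving (measurePreserving_snd (μ := (volume : Measure (Torus d)))))

/-- `dotK` in terms of increments. -/
lemma dotK_eq {m : Torus d → ℝ} (hm : Continuous m) (heven : ∀ x, m (-x) = m x)
    {v w : Torus d → Vec d} (hv : MemLp v 2 volume) (hw : MemLp w 2 volume) :
    dotK m v w = (∫ x, m x) * (∫ x, inner ℝ (v x) (w x))
      - 1 / 2 * ∫ q : Torus d × Torus d,
        m (q.1 - q.2) * inner ℝ (v q.1 - v q.2) (w q.1 - w q.2) := by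
  have h := fun i => integral_kernel_increments hm heven (MemLp.component_integrable hv i)
    (MemLp.component_integrable hw i) (MemLp.component_mul_integrable hv hw i i)
  have hd := fun i => MemLp.component_mul_integrable (memLp_comp_fst_sub_comp_snd hv)
    (memLp_comp_fst_sub_comp_snd hw) i i
  have e1 : ∫ x, inner ℝ (v x) (w x) = ∑ i, ∫ x, v x i * w x i := by
    simp_rw [inner_eq_sum]
    exact integral_finsetSum _ fun i _ => MemLp.component_mul_integrable hv hw i i
  have e2 : ∫ q : Torus d × Torus d, m (q.1 - q.2) * inner ℝ (v q.1 - v q.2) (w q.1 - w q.2)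
      = ∑ i, ∫ q : Torus d × Torus d,
        m (q.1 - q.2) * ((v q.1 i - v q.2 i) * (w q.1 i - w q.2 i)) := by
    simp_rw [inner_eq_sum, Finset.mul_sum]
    exact integral_finsetSum _ fun i _ => integrable_continuous_mul hm (by fun_prop) (hd i)
  rw [e1, e2, Finset.mul_sum, Finset.mul_sum, ← Finset.sum_sub_distrib, dotK]
  refine Finset.sum_congr rfl fun i _ => ?_
  rw [h i]
  ring

lemma enorm_integral_kernel_inner_le (m : Torus d → ℝ) (v w : Torus d → Vec d) :
    ‖∫ q : Torus d × Torus d, m (q.1 - q.2) * inner ℝ (v q.1 - v q.2) (w q.1 - w q.2)‖ₑ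
      ≤ ∫⁻ q : Torus d × Torus d, ‖m (q.1 - q.2)‖ₑ * (‖v q.1 - v q.2‖ₑ * ‖w q.1 - w q.2‖ₑ) := by
  refine (enorm_integral_le_lintegral_enorm _).trans (lintegral_mono fun q => ?_)
  rw [enorm_mul]
  gcongr
  rw [← ofReal_norm, ← ofReal_norm, ← ofReal_norm, ← ENNReal.ofReal_mul (norm_nonneg _)]
  exact ENNReal.ofReal_le_ofReal (norm_inner_le_norm _ _)

lemma enorm_half_mul_le (x : ℝ) : ‖1 / 2 * x‖ₑ ≤ ‖x‖ₑ := by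
  rw [enorm_mul]
  refine mul_le_of_le_one_left' ?_
  rw [← ofReal_norm, ← ENNReal.ofReal_one]
  exact ENNReal.ofReal_le_ofReal (by norm_num)

/-- The bound for `dotK` with a kernel of vanishing integral. -/
lemma enorm_dotK_self_le {m : Torus d → ℝ} (hm : Continuous m) (heven : ∀ x, m (-x) = m x)
    (h0 : ∫ x, m x = 0) {v : Torus d → Vec d} (hv : MemLp v 2 volume) :
    ‖dotK m v v‖ₑ ≤ incr 2 m v := by
  rw [dotK_eq hm heven hv hv, h0, zero_mul, zero_sub, enorm_neg]
  refine (enorm_half_mul_le _).trans ((enorm_integral_kernel_inner_le m v v).trans_eq ?_)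
  simp only [incr, pow_two]

/-- The error in replacing the inner product by `dotK`. -/
lemma enorm_inner_sub_dotK_le {m : Torus d → ℝ} (hm : Continuous m) (heven : ∀ x, m (-x) = m x)
    (h1 : ∫ x, m x = 1) {v w : Torus d → Vec d} (hv : MemLp v 2 volume) (hw : MemLp w 2 volume) :
    ‖(∫ x, inner ℝ (v x) (w x)) - dotK m v w‖ₑ ≤ incr 2 m v + incr 2 m w := by
  rw [dotK_eq hm heven hv hw, h1, one_mul, sub_sub_cancel]
  refine (enorm_half_mul_le _).trans ((enorm_integral_kernel_inner_le m v w).trans ?_)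
  have hmeas : AEMeasurable (fun q : Torus d × Torus d =>
      ‖m (q.1 - q.2)‖ₑ * ‖v q.1 - v q.2‖ₑ ^ 2) volume := by
    refine AEMeasurable.mul ?_ ((memLp_comp_fst_sub_comp_snd hv).aestronglyMeasurable.enorm.pow_const 2)
    exact ((hm.measurable.comp (by fun_prop : Measurable fun q : Torus d × Torus d =>
      q.1 - q.2)).enorm).aemeasurable
  rw [incr, incr, ← lintegral_add_left' hmeas]
  refine lintegral_mono fun q => ?_
  rw [← mul_add]
  gcongr
  -- A product is at most the square of its larger factor, hence at most the sum of both squares.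
  rcases le_total ‖v q.1 - v q.2‖ₑ ‖w q.1 - w q.2‖ₑ with h | h
  · exact (mul_le_mul_left h _).trans ((pow_two _).symm.le.trans le_add_self)
  · exact (mul_le_mul_right h _).trans ((pow_two _).symm.le.trans le_self_add)

/-- Mollification contracts `L²`: by `dotK_eq` the loss is half the weighted mean square increment.
It is applied to the gradient and to the kinetic energy at a single time. -/
lemma inner_sub_dotK_nonneg {m : Torus d → ℝ} (hm : Continuous m) (heven : ∀ x, m (-x) = m x)
    (h1 : ∫ x, m x = 1) (hpos : ∀ x, 0 ≤ m x) {v : Torus d → Vec d} (hv : MemLp v 2 volume) :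
    dotK m v v ≤ ∫ x, ‖v x‖ ^ 2 := by
  rw [dotK_eq hm heven hv hv, h1, one_mul]
  simp_rw [real_inner_self_eq_norm_sq]
  have : 0 ≤ ∫ q : Torus d × Torus d, m (q.1 - q.2) * ‖v q.1 - v q.2‖ ^ 2 :=
    integral_nonneg fun q => mul_nonneg (hpos _) (by positivity)
  linarith

/-- The bound of the flux by the third moment of the increments. -/
lemma enorm_fluxK_le {m : Fin d → Torus d → ℝ} (hm : ∀ j, Continuous (m j))
    (hodd : ∀ j x, m j (-x) = -m j x) {v : Torus d → Vec d} (hv : MemLp v 3 volume)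
    (hdiv : ∀ c, ∑ j, ∫ y, m j (y + c) * v y j = 0) :
    ‖fluxK m v‖ₑ ≤ d * ∑ j, incr 3 (m j) v := by
  have hv2 : MemLp v 2 volume := hv.mono_exponent (by norm_num)
  have hvi := fun i => MemLp.component_integrable hv2 i
  have hvv := fun i j => MemLp.component_mul_integrable hv2 hv2 i j
  have hvvv : ∀ i j, Integrable (fun x => v x j * (v x i * v x i)) := by
    intro i j
    have h3 := fun i => MemLp.component hv i
    -- Cubic products are integrable by Hölder with exponents `3, 3, 3`, applied in two stages.
    have : ENNReal.HolderTriple 3 3 (3 / 2) := ⟨by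
      rw [ENNReal.inv_div (by simp) (by simp), ENNReal.div_eq_inv_mul, mul_two]⟩
    have h32 : MemLp (fun x => v x i * v x i) (3 / 2) volume := (h3 i).mul' (h3 i)
    have : ENNReal.HolderTriple 3 (3 / 2) 1 := ⟨by
      rw [ENNReal.inv_div (by simp) (by simp), inv_one, ENNReal.div_eq_inv_mul]
      have : (3 : ℝ≥0∞)⁻¹ + 3⁻¹ * 2 = 3⁻¹ * 3 := by
        rw [show (3 : ℝ≥0∞) = 1 + 2 by norm_num, mul_add, mul_one]
      rw [this, ENNReal.inv_mul_cancel (by simp) (by simp)]⟩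
    exact MemLp.integrable_mul (h3 j) h32
  -- Incompressibility removes the terms in which `v_j` stands alone in a slot, so the sum of the
  -- cubic increments is exactly `-4` times the flux.
  have hz : ∀ i, ∑ j, bil (m j) (fun x => v x j) (fun x => v x i * v x i) = 0 := fun i =>
    sum_bil_eq_zero hm hvi hdiv (hvv i i)
  have h := fun i j => integral_kernel_cubic_increments (hm j) (hodd j) (hvi i) (hvi j) (hvv i i)
    (hvv i j) (hvvv i j)
  have e : fluxK m v = -(1 / 4) * ∑ i, ∑ j, ∫ q : Torus d × Torus d,
      m j (q.1 - q.2) * ((v q.1 j - v q.2 j) * (v q.1 i - v q.2 i) ^ 2) := by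
    simp_rw [h, Finset.sum_sub_distrib, ← Finset.mul_sum, hz]
    rw [fluxK, Finset.mul_sum]
    simp_rw [mul_comm (v _ _) (v _ _)]
    simp only [mul_zero, Finset.sum_const_zero, zero_sub]
    ring
  rw [e, enorm_mul]
  refine (mul_le_of_le_one_left' ?_).trans ?_
  · rw [← ofReal_norm, ← ENNReal.ofReal_one]
    exact ENNReal.ofReal_le_ofReal (by norm_num)
  · refine (enorm_sum_le _ _).trans ?_
    have hi : ∀ i ∈ Finset.univ, ‖∑ j, ∫ q : Torus d × Torus d,
        m j (q.1 - q.2) * ((v q.1 j - v q.2 j) * (v q.1 i - v q.2 i) ^ 2)‖ₑ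
        ≤ ∑ j, incr 3 (m j) v := by
      intro i _
      refine (enorm_sum_le _ _).trans (Finset.sum_le_sum fun j _ => ?_)
      refine (enorm_integral_le_lintegral_enorm _).trans (lintegral_mono fun q => ?_)
      rw [enorm_mul, enorm_mul, enorm_pow, pow_succ' _ 2]
      gcongr
      · exact enorm_component_le (v q.1 - v q.2) j
      · exact enorm_component_le (v q.1 - v q.2) i
    refine (Finset.sum_le_sum hi).trans_eq ?_
    simp

end

section

/-! ### Moments of increments and Besov norms -/

variable {d : ℕ} {T : ℝ}

/-- The field is only almost everywhere measurable on space-time, so a shift may be composed with it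
only if preimages of null sets are null. -/
lemma quasiMeasurePreserving_shift :
    Measure.QuasiMeasurePreserving
      (fun q : (ℝ × Torus d) × Torus d => (q.1.1, q.1.2 - q.2))
      ((spaceTime d T).prod volume) (spaceTime d T) := by
  have h1 : Measure.QuasiMeasurePreserving (fun q : Torus d × Torus d => q.1 - q.2)
      (volume.prod volume) volume := quasiMeasurePreserving_sub volume volume
  have h2 := QuasiMeasurePreserving.prodMap
    (Measure.QuasiMeasurePreserving.id (volume.restrict (Ioo 0 T))) h1
  exact h2.comp (measurePreserving_prodAssoc (volume.restrict (Ioo 0 T))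
    (volume : Measure (Torus d)) (volume : Measure (Torus d))).quasiMeasurePreserving

/-- The space-time moment of increments, by the increments for single shifts. -/
lemma lintegral_incr_le {n : ℕ} {m : Torus d → ℝ} (hm : Continuous m) {v : ℝ → Torus d → Vec d}
    (hv : AEStronglyMeasurable (fun z : ℝ × Torus d => v z.1 z.2) (spaceTime d T)) {B : ℝ≥0∞}
    (hB : ∀ a, m a ≠ 0 →
      ∫⁻ z, ‖v z.1 z.2 - v z.1 (z.2 - a)‖ₑ ^ n ∂(spaceTime d T) ≤ B) :
    ∫⁻ s in Ioo 0 T, incr n m (v s) ≤ ENNReal.ofReal (∫ a, |m a|) * B := by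
  set g : ℝ × Torus d → Torus d → ℝ≥0∞ := fun z a =>
    ‖m a‖ₑ * ‖v z.1 z.2 - v z.1 (z.2 - a)‖ₑ ^ n with hg
  have hgm : AEMeasurable (Function.uncurry g) ((spaceTime d T).prod volume) := by
    have h1 : AEMeasurable (fun q : (ℝ × Torus d) × Torus d => ‖m q.2‖ₑ)
        ((spaceTime d T).prod volume) :=
      (hm.measurable.comp measurable_snd).enorm.aemeasurable
    exact h1.mul (((hv.comp_fst).sub
      (hv.comp_quasiMeasurePreserving quasiMeasurePreserving_shift)).enorm.pow_const n)
  have h1 : ∀ s, incr n m (v s) ≤ ∫⁻ y, ∫⁻ a, g (s, y) a := by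
    intro s
    -- An upper bound suffices here, so no measurability of the individual time slice is needed. The
    -- shift is then introduced by `a = y - z`.
    refine (lintegral_prod_le _).trans_eq (lintegral_congr fun y => ?_)
    rw [← lintegral_sub_left_eq_self (fun a => g (s, y) a) y]
    refine lintegral_congr fun z => ?_
    simp only [hg, sub_sub_cancel]
  calc ∫⁻ s in Ioo 0 T, incr n m (v s) ≤ ∫⁻ s in Ioo 0 T, ∫⁻ y, ∫⁻ a, g (s, y) a :=
        lintegral_mono h1
    _ = ∫⁻ z, (∫⁻ a, g z a) ∂(spaceTime d T) :=
        (lintegral_prod _ hgm.lintegral_prod_right').symm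
    _ = ∫⁻ a : Torus d, (∫⁻ z, g z a ∂(spaceTime d T)) := lintegral_lintegral_swap hgm
    _ ≤ ∫⁻ a, ‖m a‖ₑ * B := by
        refine lintegral_mono fun a => ?_
        simp only [hg]
        rw [lintegral_const_mul' _ _ enorm_ne_top]
        by_cases ha : m a = 0
        · simp [ha]
        · gcongr
          exact hB a ha
    _ = ENNReal.ofReal (∫ a, |m a|) * B := by
        rw [lintegral_mul_const _ hm.measurable.enorm,
          ← ofReal_integral_norm_eq_lintegral_enorm (Continuous.integrable_torus hm)]
        rfl

/-- The moment of the increments of a function, by the increments for single shifts. -/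
lemma incr_le {n : ℕ} {m : Torus d → ℝ} (hm : Continuous m) {v : Torus d → Vec d}
    (hv : AEStronglyMeasurable v volume) {B : ℝ≥0∞}
    (hB : ∀ a, m a ≠ 0 → ∫⁻ x, ‖v x - v (x - a)‖ₑ ^ n ≤ B) :
    incr n m v ≤ ENNReal.ofReal (∫ a, |m a|) * B := by
  -- A stationary field on the unit time interval reduces the claim to the space-time version.
  have h := lintegral_incr_le (T := 1) (n := n) (v := fun _ => v) (B := B) hm
    (hv.comp_snd) (fun a ha => ?_)
  · simpa using h
  · refine (lintegral_prod_le _).trans ?_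
    simpa using hB a ha

lemma eLpNorm_natCast_pow {α : Type*} [MeasurableSpace α] {μ : Measure α} {n : ℕ} (hn : n ≠ 0)
    (g : α → Vec d) : eLpNorm g n μ ^ n = ∫⁻ x, ‖g x‖ₑ ^ n ∂μ := by
  have h := eLpNorm_nnreal_pow_eq_lintegral (μ := μ) (f := g) (p := n) (by exact_mod_cast hn)
  simpa using h

lemma eLpNorm_increment_le {σ : ℝ} {p : ℝ≥0∞} (g : Torus d → Vec d) {r : Vec d} (h0 : 0 < ‖r‖)
    (h1 : ‖r‖ ≤ 1) : eLpNorm (fun x => g (x + proj (fun i => r i)) - g x) p volume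
      ≤ besovNorm σ p g * ENNReal.ofReal (‖r‖ ^ σ) := by
  have hpos : 0 < ‖r‖ ^ σ := Real.rpow_pos_of_pos h0 σ
  rw [← ENNReal.div_le_iff (by simpa using hpos) ENNReal.ofReal_ne_top, besovNorm]
  refine le_trans ?_ le_add_self
  exact le_iSup₂_of_le r ⟨h0, h1⟩ le_rfl

lemma lintegral_increment_le {σ ℓ : ℝ} (hσ : 0 ≤ σ) (hℓ1 : ℓ ≤ 1) {n : ℕ}
    (hn : n ≠ 0) (g : Torus d → Vec d) {a : Torus d}
    (ha : ∃ r : Vec d, ‖r‖ ≤ ℓ ∧ a = proj (fun i => r i)) :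
    ∫⁻ x, ‖g x - g (x - a)‖ₑ ^ n ≤ besovNorm σ n g ^ n * ENNReal.ofReal (ℓ ^ σ) ^ n := by
  obtain ⟨r, hr, rfl⟩ := ha
  -- The Besov supremum excludes the zero shift, whose increment vanishes anyway. For the others a
  -- translation turns the backward difference into a forward one.
  rcases eq_or_ne r 0 with rfl | hr0
  · have : (proj (fun i => (0 : Vec d) i) : Torus d) = 0 := proj_zero
    rw [this]
    simp [hn]
  · have h0 : 0 < ‖r‖ := norm_pos_iff.2 hr0
    rw [← lintegral_add_right_eq_self _ (proj (fun i => r i) : Torus d)]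
    simp only [add_sub_cancel_right]
    rw [← eLpNorm_natCast_pow hn (fun x => g (x + proj (fun i => r i)) - g x), ← mul_pow]
    refine pow_le_pow_left' ((eLpNorm_increment_le (σ := σ) g h0 (hr.trans hℓ1)).trans ?_) n
    gcongr

lemma lintegral_besovNorm_le {σ C : ℝ} {n : ℕ} (hn : n ≠ 0)
    {v : ℝ → Torus d → Vec d} (h : timeBesovNorm T n σ n v ≤ ENNReal.ofReal C) :
    ∫⁻ s in Ioo 0 T, besovNorm σ n (v s) ^ n ≤ ENNReal.ofReal C ^ n := by
  have hn' : (n : ℝ) ≠ 0 := by exact_mod_cast hn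
  have h2 := ENNReal.rpow_le_rpow h (Nat.cast_nonneg n)
  rw [timeBesovNorm, ← ENNReal.rpow_mul, one_div, inv_mul_cancel₀ hn', ENNReal.rpow_one] at h2
  simpa only [ENNReal.rpow_natCast] using h2

/-- Increments in space-time are controlled by the norm in `L^n([0,T]; B_n^{σ,∞})`. -/
lemma lintegral_spaceTime_increment_le {σ ℓ C : ℝ} (hσ : 0 ≤ σ) (hℓ0 : 0 ≤ ℓ) (hℓ1 : ℓ ≤ 1)
    (hC : 0 ≤ C) {n : ℕ} (hn : n ≠ 0) {v : ℝ → Torus d → Vec d}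
    (h : timeBesovNorm T n σ n v ≤ ENNReal.ofReal C) {a : Torus d}
    (ha : ∃ r : Vec d, ‖r‖ ≤ ℓ ∧ a = proj (fun i => r i)) :
    ∫⁻ z, ‖v z.1 z.2 - v z.1 (z.2 - a)‖ₑ ^ n ∂(spaceTime d T)
      ≤ ENNReal.ofReal ((C * ℓ ^ σ) ^ n) := by
  refine (lintegral_prod_le _).trans ?_
  refine (lintegral_mono fun s => lintegral_increment_le hσ hℓ1 hn (v s) ha).trans ?_
  rw [lintegral_mul_const' _ _ (by finiteness), ENNReal.ofReal_pow (by positivity),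
    ENNReal.ofReal_mul hC, mul_pow]
  gcongr
  exact lintegral_besovNorm_le hn h

lemma memLp_of_timeBesovNorm {σ C : ℝ} {n : ℕ} (hn : n ≠ 0) {v : ℝ → Torus d → Vec d}
    (hv : AEStronglyMeasurable (fun z : ℝ × Torus d => v z.1 z.2) (spaceTime d T))
    (h : timeBesovNorm T n σ n v ≤ ENNReal.ofReal C) :
    MemLp (fun z : ℝ × Torus d => v z.1 z.2) n (spaceTime d T) := by
  refine ⟨hv, ?_⟩
  have h1 : eLpNorm (fun z : ℝ × Torus d => v z.1 z.2) n (spaceTime d T) ^ n < ⊤ := by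
    rw [eLpNorm_natCast_pow hn]
    refine (lintegral_prod_le _).trans_lt ?_
    refine (lintegral_mono fun s => ?_).trans_lt
      ((lintegral_besovNorm_le hn h).trans_lt (by finiteness))
    rw [← eLpNorm_natCast_pow hn (v s)]
    exact pow_le_pow_left' le_self_add n
  exact (ENNReal.pow_lt_top_iff.1 h1).resolve_right hn

/-- Quadratic increments by cubic increments. -/
lemma lintegral_sq_increment_le {B : ℝ} (hB : 0 ≤ B) {D : ℝ × Torus d → Vec d}
    (hD : AEStronglyMeasurable D (spaceTime d T))
    (h : ∫⁻ z, ‖D z‖ₑ ^ 3 ∂(spaceTime d T) ≤ ENNReal.ofReal (B ^ 3)) (hT : 0 ≤ T) :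
    ∫⁻ z, ‖D z‖ₑ ^ 2 ∂(spaceTime d T) ≤ ENNReal.ofReal ((B * T ^ (1 / 6 : ℝ)) ^ 2) := by
  have h3 : eLpNorm D 3 (spaceTime d T) ≤ ENNReal.ofReal B := by
    have := eLpNorm_natCast_pow (μ := spaceTime d T) (n := 3) (by norm_num) D
    rw [← this, ENNReal.ofReal_pow hB] at h
    exact (ENNReal.pow_le_pow_left_iff (by norm_num)).1 h
  -- Hölder on space-time, of total measure `T`, costs `T^(1/2 - 1/3)`; this is the origin of the
  -- power `1/6`.
  have h2 := eLpNorm_le_eLpNorm_mul_rpow_measure_univ (p := 2) (q := 3)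
    (μ := spaceTime d T) (by norm_num) hD
  have huniv : (spaceTime d T) univ = ENNReal.ofReal T := by
    rw [← univ_prod_univ, Measure.prod_prod]
    simp
  have hexp : (1 / (2 : ℝ≥0∞).toReal - 1 / (3 : ℝ≥0∞).toReal) = (1 / 6 : ℝ) := by norm_num
  rw [huniv, hexp, ENNReal.ofReal_rpow_of_nonneg hT (by norm_num)] at h2
  have := eLpNorm_natCast_pow (μ := spaceTime d T) (n := 2) (by norm_num) D
  rw [← this, ENNReal.ofReal_pow (by positivity), ENNReal.ofReal_mul hB]
  exact pow_le_pow_left' (h2.trans (by gcongr)) 2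

end

section

/-! ### Solutions bounded in Besov spaces -/

variable {d : ℕ} {T : ℝ}

lemma IsMollifier.integral_abs {A ℓ : ℝ} {κ : Torus d → ℝ} {κ₁ κ₂ : Fin d → Torus d → ℝ}
    (hκ : IsMollifier A ℓ κ κ₁ κ₂) : ∫ x, |κ x| = 1 := by
  simp_rw [abs_of_nonneg (hκ.nonneg _)]
  exact hκ.integral_eq

lemma aemeasurable_incr {v : ℝ → Torus d → Vec d}
    (hv : AEStronglyMeasurable (fun z : ℝ × Torus d => v z.1 z.2) (spaceTime d T))
    {m : Torus d → ℝ} (hm : Continuous m) (n : ℕ) :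
    AEMeasurable (fun s => incr n m (v s)) (volume.restrict (Ioo 0 T)) := by
  have hq1 : Measure.QuasiMeasurePreserving
      (fun q : ℝ × (Torus d × Torus d) => (q.1, q.2.1))
      ((volume.restrict (Ioo 0 T)).prod volume) (spaceTime d T) :=
    ((MeasurePreserving.id (volume.restrict (Ioo 0 T))).prod
      (measurePreserving_fst (ν := (volume : Measure (Torus d))))).quasiMeasurePreserving
  have hq2 : Measure.QuasiMeasurePreserving
      (fun q : ℝ × (Torus d × Torus d) => (q.1, q.2.2))
      ((volume.restrict (Ioo 0 T)).prod volume) (spaceTime d T) :=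
    ((MeasurePreserving.id (volume.restrict (Ioo 0 T))).prod
      (measurePreserving_snd (μ := (volume : Measure (Torus d))))).quasiMeasurePreserving
  have h1 : AEMeasurable (fun q : ℝ × (Torus d × Torus d) =>
      ‖m (q.2.1 - q.2.2)‖ₑ * ‖v q.1 q.2.1 - v q.1 q.2.2‖ₑ ^ n)
      ((volume.restrict (Ioo 0 T)).prod volume) := by
    refine AEMeasurable.mul ?_ (((hv.comp_quasiMeasurePreserving hq1).sub
      (hv.comp_quasiMeasurePreserving hq2)).enorm.pow_const n)
    exact ((hm.measurable.comp (by fun_prop : Measurable fun q : ℝ × (Torus d × Torus d) =>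
      q.2.1 - q.2.2)).enorm).aemeasurable
  exact h1.lintegral_prod_right'

/-- A Leray solution with data and velocity bounded in Besov spaces. -/
structure LerayBesov {d : ℕ} (T ν σ β C : ℝ) (u₀ : Torus d → Vec d) (f u : ℝ → Torus d → Vec d)
    (G : ℝ → Torus d → Fin d → Vec d) (p : ℝ → Torus d → ℝ) : Prop where
  T_pos : 0 < T
  ν_pos : 0 < ν
  σ_pos : 0 < σ
  β_pos : 0 < β
  C_nonneg : 0 ≤ C
  data : IsData T u₀ f
  leray : IsLeraySolution ν T u₀ f u G p
  initial_le : besovNorm σ 2 u₀ ≤ ENNReal.ofReal C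
  force_le : timeBesovNorm T 2 σ 2 f ≤ ENNReal.ofReal C
  velocity_le : timeBesovNorm T 3 β 3 u ≤ ENNReal.ofReal C

namespace LerayBesov

variable {ν σ β C : ℝ} {u₀ : Torus d → Vec d} {f u : ℝ → Torus d → Vec d}
    {G : ℝ → Torus d → Fin d → Vec d} {p : ℝ → Torus d → ℝ}

lemma memLp_three (h : LerayBesov T ν σ β C u₀ f u G p) :
    MemLp (fun z : ℝ × Torus d => u z.1 z.2) 3 (spaceTime d T) := by
  have := memLp_of_timeBesovNorm (n := 3) (by norm_num) h.leray.measurable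
    (by exact_mod_cast h.velocity_le)
  exact_mod_cast this

lemma memLp_two (h : LerayBesov T ν σ β C u₀ f u G p) :
    MemLp (fun z : ℝ × Torus d => u z.1 z.2) 2 (spaceTime d T) :=
  h.memLp_three.mono_exponent (by norm_num)

/-- The bound for quadratic increments of the velocity at scale `ℓ`. -/
def velocityBound (T β C ℓ : ℝ) : ℝ := (C * ℓ ^ β * T ^ (1 / 6 : ℝ)) ^ 2

/-- The bound for quadratic increments of the data at scale `ℓ`. -/
def dataBound (σ C ℓ : ℝ) : ℝ := (C * ℓ ^ σ) ^ 2

lemma velocityBound_nonneg (T β C ℓ : ℝ) : 0 ≤ velocityBound T β C ℓ := sq_nonneg _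

lemma dataBound_nonneg (σ C ℓ : ℝ) : 0 ≤ dataBound σ C ℓ := sq_nonneg _

variable {ℓ : ℝ} {m : Torus d → ℝ}

lemma lintegral_incr_three (h : LerayBesov T ν σ β C u₀ f u G p) (hℓ0 : 0 < ℓ) (hℓ1 : ℓ ≤ 1)
    (hm : Continuous m)
    (hs : ∀ a, m a ≠ 0 → ∃ r : Vec d, ‖r‖ ≤ ℓ ∧ a = proj (fun i => r i)) :
    ∫⁻ s in Ioo 0 T, incr 3 m (u s)
      ≤ ENNReal.ofReal ((∫ a, |m a|) * (C * ℓ ^ β) ^ 3) := by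
  rw [ENNReal.ofReal_mul (integral_nonneg fun _ => abs_nonneg _)]
  exact lintegral_incr_le hm h.leray.measurable fun a ha =>
    lintegral_spaceTime_increment_le h.β_pos.le hℓ0.le hℓ1 h.C_nonneg (by norm_num)
      (by exact_mod_cast h.velocity_le) (hs a ha)

lemma lintegral_incr_two (h : LerayBesov T ν σ β C u₀ f u G p) (hℓ0 : 0 < ℓ) (hℓ1 : ℓ ≤ 1)
    (hm : Continuous m)
    (hs : ∀ a, m a ≠ 0 → ∃ r : Vec d, ‖r‖ ≤ ℓ ∧ a = proj (fun i => r i)) :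
    ∫⁻ s in Ioo 0 T, incr 2 m (u s)
      ≤ ENNReal.ofReal ((∫ a, |m a|) * velocityBound T β C ℓ) := by
  rw [ENNReal.ofReal_mul (integral_nonneg fun _ => abs_nonneg _)]
  refine lintegral_incr_le hm h.leray.measurable fun a ha => ?_
  have hq : Measure.QuasiMeasurePreserving (fun z : ℝ × Torus d => (z.1, z.2 - a))
      (spaceTime d T) (spaceTime d T) :=
    ((MeasurePreserving.id (volume.restrict (Ioo 0 T))).prod
      (measurePreserving_sub_right volume a)).quasiMeasurePreserving
  refine lintegral_sq_increment_le (by have := h.C_nonneg; positivity)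
    (h.leray.measurable.sub (h.leray.measurable.comp_quasiMeasurePreserving hq)) ?_ h.T_pos.le
  exact lintegral_spaceTime_increment_le h.β_pos.le hℓ0.le hℓ1 h.C_nonneg (by norm_num)
      (by exact_mod_cast h.velocity_le) (hs a ha)

lemma lintegral_incr_force (h : LerayBesov T ν σ β C u₀ f u G p) (hℓ0 : 0 < ℓ) (hℓ1 : ℓ ≤ 1)
    (hm : Continuous m)
    (hs : ∀ a, m a ≠ 0 → ∃ r : Vec d, ‖r‖ ≤ ℓ ∧ a = proj (fun i => r i)) :
    ∫⁻ s in Ioo 0 T, incr 2 m (f s)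
      ≤ ENNReal.ofReal ((∫ a, |m a|) * dataBound σ C ℓ) := by
  rw [ENNReal.ofReal_mul (integral_nonneg fun _ => abs_nonneg _)]
  exact lintegral_incr_le hm h.data.force_memLp.aestronglyMeasurable fun a ha =>
    lintegral_spaceTime_increment_le h.σ_pos.le hℓ0.le hℓ1 h.C_nonneg (by norm_num)
      (by exact_mod_cast h.force_le) (hs a ha)

lemma incr_initial (h : LerayBesov T ν σ β C u₀ f u G p) (hℓ0 : 0 < ℓ) (hℓ1 : ℓ ≤ 1)
    (hm : Continuous m)
    (hs : ∀ a, m a ≠ 0 → ∃ r : Vec d, ‖r‖ ≤ ℓ ∧ a = proj (fun i => r i)) :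
    incr 2 m u₀ ≤ ENNReal.ofReal ((∫ a, |m a|) * dataBound σ C ℓ) := by
  rw [ENNReal.ofReal_mul (integral_nonneg fun _ => abs_nonneg _)]
  refine incr_le hm h.data.initial_memLp.aestronglyMeasurable fun a ha => ?_
  refine (lintegral_increment_le h.σ_pos.le hℓ1 (by norm_num) u₀ (hs a ha)).trans ?_
  have hC := h.C_nonneg
  rw [dataBound, ENNReal.ofReal_pow (by positivity), ENNReal.ofReal_mul hC, mul_pow]
  gcongr
  exact_mod_cast h.initial_le

variable {A : ℝ} {κ : Torus d → ℝ} {κ₁ κ₂ : Fin d → Torus d → ℝ}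

lemma corr_integral_abs_le (hκ : IsMollifier A ℓ κ κ₁ κ₂) {m : Torus d → ℝ} (hm : Continuous m)
    {B : ℝ} (hB : ∫ x, |m x| ≤ B) : ∫ x, |corr κ m x| ≤ B := by
  refine (integral_abs_corr_le hκ.smooth.continuous hm).trans ?_
  rwa [hκ.integral_abs, one_mul]

/-- The bound of the energy flux through scale `ℓ`. -/
lemma lintegral_fluxK_le (h : LerayBesov T ν σ β C u₀ f u G p) (hκ : IsMollifier A ℓ κ κ₁ κ₂)
    (hℓ0 : 0 < ℓ) (hℓ1 : ℓ ≤ 1) :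
    ∫⁻ s in Ioo 0 T, ‖fluxK (fun j => corr κ (κ₁ j)) (u s)‖ₑ
      ≤ ENNReal.ofReal (d * (d * (A / ℓ * (C * ℓ ^ β) ^ 3))) := by
  have c0 := hκ.smooth.continuous
  have c1 := fun j => (hκ.smooth_fst j).continuous
  have cc := fun j => continuous_corr c0 (c1 j)
  have hC := h.C_nonneg
  have hae : ∀ᵐ s ∂(volume.restrict (Ioo 0 T)), ‖fluxK (fun j => corr κ (κ₁ j)) (u s)‖ₑ
      ≤ d * ∑ j, incr 3 (corr κ (κ₁ j)) (u s) := by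
    filter_upwards [ae_slice_memLp (by norm_num) (by norm_num) h.memLp_three, h.leray.solenoidal]
      with s h3 hdiv
    have h2 : MemLp (u s) 2 volume := h3.mono_exponent (by norm_num)
    exact enorm_fluxK_le cc hκ.corr_odd h3 (corr_div_free c0 c1
      (fun j => MemLp.component_integrable h2 j) (hκ.solenoidal_kernel h2 hdiv))
  refine (lintegral_mono_ae hae).trans ?_
  -- One factor `d` comes from the sum over velocity components in `enorm_fluxK_le`, the other from
  -- the sum over the kernels.
  rw [lintegral_const_mul' _ _ (by finiteness), lintegral_finsetSum' _ fun j _ =>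
      aemeasurable_incr h.leray.measurable (cc j) 3,
    ENNReal.ofReal_mul (Nat.cast_nonneg d), ENNReal.ofReal_mul (Nat.cast_nonneg d),
    ENNReal.ofReal_natCast]
  gcongr
  refine (Finset.sum_le_sum fun j _ => (h.lintegral_incr_three hℓ0 hℓ1 (cc j) fun a ha =>
    support_corr hκ.support (hκ.support_fst j) ha).trans (ENNReal.ofReal_le_ofReal
    (mul_le_mul_of_nonneg_right (corr_integral_abs_le hκ (c1 j) (hκ.integral_abs_fst j))
      (by positivity)))).trans_eq ?_
  simp

/-- The bound of the viscous term at scale `ℓ`. -/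
lemma lintegral_viscous_le (h : LerayBesov T ν σ β C u₀ f u G p) (hκ : IsMollifier A ℓ κ κ₁ κ₂)
    (hℓ0 : 0 < ℓ) (hℓ1 : ℓ ≤ 1) (j : Fin d) :
    ∫⁻ s in Ioo 0 T, ‖dotK (corr κ (κ₂ j)) (u s) (u s)‖ₑ
      ≤ ENNReal.ofReal (A / ℓ ^ 2 * velocityBound T β C ℓ) := by
  have c0 := hκ.smooth.continuous
  have c2 := (hκ.smooth_snd j).continuous
  have cc := continuous_corr c0 c2
  have hae : ∀ᵐ s ∂(volume.restrict (Ioo 0 T)), ‖dotK (corr κ (κ₂ j)) (u s) (u s)‖ₑ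
      ≤ incr 2 (corr κ (κ₂ j)) (u s) := by
    filter_upwards [ae_slice_memLp (by norm_num) (by norm_num) h.memLp_two] with s h2
    refine enorm_dotK_self_le cc (hκ.corr_even_snd j) ?_ h2
    rw [integral_corr c0 c2, hκ.integral_snd, mul_zero]
  refine (lintegral_mono_ae hae).trans ((h.lintegral_incr_two hℓ0 hℓ1 cc fun a ha =>
    support_corr hκ.support (hκ.support_snd j) ha).trans (ENNReal.ofReal_le_ofReal
    (mul_le_mul_of_nonneg_right (corr_integral_abs_le hκ c2 (hκ.integral_abs_snd j))
      (velocityBound_nonneg _ _ _ _))))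

lemma integral_corr_self (hκ : IsMollifier A ℓ κ κ₁ κ₂) : ∫ x, corr κ κ x = 1 := by
  rw [integral_corr hκ.smooth.continuous hκ.smooth.continuous, hκ.integral_eq, one_mul]

lemma corr_self_nonneg (hκ : IsMollifier A ℓ κ κ₁ κ₂) (x : Torus d) : 0 ≤ corr κ κ x :=
  integral_nonneg fun _ => mul_nonneg (hκ.nonneg _) (hκ.nonneg _)

lemma integral_abs_corr_self (hκ : IsMollifier A ℓ κ κ₁ κ₂) : ∫ x, |corr κ κ x| = 1 := by
  simp_rw [abs_of_nonneg (corr_self_nonneg hκ _)]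
  exact integral_corr_self hκ

/-- The error in mollifying the power of the force. -/
lemma lintegral_force_le (h : LerayBesov T ν σ β C u₀ f u G p) (hκ : IsMollifier A ℓ κ κ₁ κ₂)
    (hℓ0 : 0 < ℓ) (hℓ1 : ℓ ≤ 1) :
    ∫⁻ s in Ioo 0 T, ‖(∫ x, inner ℝ (f s x) (u s x)) - dotK (corr κ κ) (f s) (u s)‖ₑ
      ≤ ENNReal.ofReal (dataBound σ C ℓ + velocityBound T β C ℓ) := by
  have c0 := hκ.smooth.continuous
  have cc := continuous_corr c0 c0
  have hsupp : ∀ a, corr κ κ a ≠ 0 → ∃ r : Vec d, ‖r‖ ≤ ℓ ∧ a = proj (fun i => r i) :=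
    fun a ha => support_corr hκ.support hκ.support ha
  have hae : ∀ᵐ s ∂(volume.restrict (Ioo 0 T)),
      ‖(∫ x, inner ℝ (f s x) (u s x)) - dotK (corr κ κ) (f s) (u s)‖ₑ
        ≤ incr 2 (corr κ κ) (f s) + incr 2 (corr κ κ) (u s) := by
    filter_upwards [ae_slice_memLp (by norm_num) (by norm_num) h.memLp_two,
      ae_slice_memLp (by norm_num) (by norm_num) h.data.force_memLp] with s h2 hf
    exact enorm_inner_sub_dotK_le cc hκ.corr_even (integral_corr_self hκ) hf h2
  refine (lintegral_mono_ae hae).trans ?_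
  rw [lintegral_add_right' _ (aemeasurable_incr h.leray.measurable cc 2),
    ENNReal.ofReal_add (dataBound_nonneg _ _ _) (velocityBound_nonneg _ _ _ _)]
  have h1 := h.lintegral_incr_force hℓ0 hℓ1 cc hsupp
  have h2 := h.lintegral_incr_two hℓ0 hℓ1 cc hsupp
  rw [integral_abs_corr_self hκ, one_mul] at h1 h2
  exact add_le_add h1 h2

/-- The error in mollifying the kinetic energy. -/
lemma lintegral_energy_le (h : LerayBesov T ν σ β C u₀ f u G p) (hκ : IsMollifier A ℓ κ κ₁ κ₂)
    (hℓ0 : 0 < ℓ) (hℓ1 : ℓ ≤ 1) :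
    ∫⁻ s in Ioo 0 T, ‖(∫ x, ‖u s x‖ ^ 2) - dotK (corr κ κ) (u s) (u s)‖ₑ
      ≤ ENNReal.ofReal (2 * velocityBound T β C ℓ) := by
  have c0 := hκ.smooth.continuous
  have cc := continuous_corr c0 c0
  have hae : ∀ᵐ s ∂(volume.restrict (Ioo 0 T)),
      ‖(∫ x, ‖u s x‖ ^ 2) - dotK (corr κ κ) (u s) (u s)‖ₑ
        ≤ 2 * incr 2 (corr κ κ) (u s) := by
    filter_upwards [ae_slice_memLp (by norm_num) (by norm_num) h.memLp_two] with s h2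
    have := enorm_inner_sub_dotK_le cc hκ.corr_even (integral_corr_self hκ) h2 h2
    simp_rw [real_inner_self_eq_norm_sq] at this
    rwa [two_mul]
  refine (lintegral_mono_ae hae).trans ?_
  have h2 := h.lintegral_incr_two hℓ0 hℓ1 cc fun a ha => support_corr hκ.support hκ.support ha
  rw [integral_abs_corr_self hκ, one_mul] at h2
  rw [lintegral_const_mul' _ _ (by finiteness), ENNReal.ofReal_mul (by norm_num)]
  simpa using mul_le_mul_right h2 2

lemma initial_energy_le (h : LerayBesov T ν σ β C u₀ f u G p) (hκ : IsMollifier A ℓ κ κ₁ κ₂)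
    (hℓ0 : 0 < ℓ) (hℓ1 : ℓ ≤ 1) :
    (∫ x, ‖u₀ x‖ ^ 2) - dotK (corr κ κ) u₀ u₀ ≤ 2 * dataBound σ C ℓ := by
  have c0 := hκ.smooth.continuous
  have cc := continuous_corr c0 c0
  have h1 := enorm_inner_sub_dotK_le cc hκ.corr_even (integral_corr_self hκ)
    h.data.initial_memLp h.data.initial_memLp
  have h2 := h.incr_initial hℓ0 hℓ1 cc fun a ha => support_corr hκ.support hκ.support ha
  rw [integral_abs_corr_self hκ, one_mul] at h2
  simp_rw [real_inner_self_eq_norm_sq] at h1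
  have hd := dataBound_nonneg σ C ℓ
  have h3 := h1.trans (add_le_add h2 h2)
  rw [← ENNReal.ofReal_add hd hd, ← two_mul, ← ofReal_norm,
    ENNReal.ofReal_le_ofReal_iff (by positivity)] at h3
  exact (le_abs_self _).trans h3

end LerayBesov

end

section

/-! ### The dissipation against a cut-off -/

variable {d : ℕ} {T : ℝ}

lemma abs_integral_mul_le {α : Type*} [MeasurableSpace α] {μ : Measure α} {c X : α → ℝ}
    {M B : ℝ} (hM : 0 ≤ M) (hB : 0 ≤ B) (hc : ∀ s, |c s| ≤ M)
    (hX : ∫⁻ s, ‖X s‖ₑ ∂μ ≤ ENNReal.ofReal B) : |∫ s, c s * X s ∂μ| ≤ M * B := by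
  have h : ‖∫ s, c s * X s ∂μ‖ₑ ≤ ENNReal.ofReal (M * B) := by
    refine (enorm_integral_le_lintegral_enorm _).trans ?_
    rw [ENNReal.ofReal_mul hM]
    calc ∫⁻ s, ‖c s * X s‖ₑ ∂μ ≤ ∫⁻ s, ENNReal.ofReal M * ‖X s‖ₑ ∂μ := by
          refine lintegral_mono fun s => ?_
          rw [enorm_mul, ← ofReal_norm (c s)]
          gcongr
          exact hc s
      _ = ENNReal.ofReal M * ∫⁻ s, ‖X s‖ₑ ∂μ := lintegral_const_mul' _ _ ENNReal.ofReal_ne_top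
      _ ≤ _ := by gcongr
  rwa [← ofReal_norm, ENNReal.ofReal_le_ofReal_iff (by positivity)] at h

lemma spaceTime_mono {t : ℝ} (ht : t ≤ T) : spaceTime d t ≤ spaceTime d T :=
  Measure.prod_mono (Measure.restrict_mono (Ioo_subset_Ioo_right ht) le_rfl) le_rfl

namespace LerayBesov

variable {ν σ β C : ℝ} {u₀ : Torus d → Vec d} {f u : ℝ → Torus d → Vec d}
    {G : ℝ → Torus d → Fin d → Vec d} {p : ℝ → Torus d → ℝ}

lemma integrable_gradient_sq (h : LerayBesov T ν σ β C u₀ f u G p) :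
    Integrable (fun z : ℝ × Torus d => ∑ j, ‖G z.1 z.2 j‖ ^ 2) (spaceTime d T) :=
  integrable_finsetSum _ fun j _ => (h.leray.gradient_memLp j).integrable_norm_pow (by norm_num)

lemma integrable_velocity_sq (h : LerayBesov T ν σ β C u₀ f u G p) :
    Integrable (fun z : ℝ × Torus d => ‖u z.1 z.2‖ ^ 2) (spaceTime d T) :=
  h.memLp_two.integrable_norm_pow (by norm_num)

lemma integrable_power (h : LerayBesov T ν σ β C u₀ f u G p) :
    Integrable (fun z : ℝ × Torus d => inner ℝ (f z.1 z.2) (u z.1 z.2)) (spaceTime d T) :=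
  memLp_two_inner_integrable h.data.force_memLp h.memLp_two

/-- The total viscous dissipation. -/
def viscousDissipation (ν T : ℝ) (G : ℝ → Torus d → Fin d → Vec d) : ℝ :=
  ν * ∫ s in Ioo 0 T, ∫ x, ∑ j, ‖G s x j‖ ^ 2

variable {A ℓ : ℝ} {κ : Torus d → ℝ} {κ₁ κ₂ : Fin d → Torus d → ℝ}

lemma integrableOn_flux (h : LerayBesov T ν σ β C u₀ f u G p) (hκ : IsMollifier A ℓ κ κ₁ κ₂) :
    IntegrableOn (fun s => fluxK (fun j => corr κ (κ₁ j)) (u s)) (Ioo 0 T) :=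
  h.leray.integrableOn_fluxK h.memLp_two hκ.smooth.continuous
    fun j => (hκ.smooth_fst j).continuous

lemma integrableOn_viscous (h : LerayBesov T ν σ β C u₀ f u G p)
    (hκ : IsMollifier A ℓ κ κ₁ κ₂) :
    IntegrableOn (fun s => ν * ∑ j, dotK (corr κ (κ₂ j)) (u s) (u s)) (Ioo 0 T) :=
  Integrable.const_mul (integrable_finsetSum _ fun j _ =>
    h.leray.integrableOn_dotK h.memLp_two hκ.smooth.continuous (hκ.smooth_snd j).continuous
      h.memLp_two) ν

lemma integrableOn_force (h : LerayBesov T ν σ β C u₀ f u G p)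
    (hκ : IsMollifier A ℓ κ κ₁ κ₂) :
    IntegrableOn (fun s => dotK (corr κ κ) (f s) (u s)) (Ioo 0 T) :=
  h.leray.integrableOn_dotK h.memLp_two hκ.smooth.continuous hκ.smooth.continuous
    h.data.force_memLp

lemma integrableOn_energy (h : LerayBesov T ν σ β C u₀ f u G p)
    (hκ : IsMollifier A ℓ κ κ₁ κ₂) :
    IntegrableOn (fun s => dotK (corr κ κ) (u s) (u s)) (Ioo 0 T) :=
  h.leray.integrableOn_dotK h.memLp_two hκ.smooth.continuous hκ.smooth.continuous h.memLp_two

/-- The error of the mollified energy balance against time weights with values in `[-1,1]`: the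
energy flux and the power of the force on small scales. -/
def balanceError (d : ℕ) (T A σ β C ℓ : ℝ) : ℝ :=
  d * (d * (A / ℓ * (C * ℓ ^ β) ^ 3)) + (dataBound σ C ℓ + velocityBound T β C ℓ)

/-- The viscous term of the mollified balance is bounded by the viscous dissipation. -/
lemma ae_viscous_le (h : LerayBesov T ν σ β C u₀ f u G p) (hκ : IsMollifier A ℓ κ κ₁ κ₂) :
    ∀ᵐ s ∂(volume.restrict (Ioo 0 T)), -(ν * ∑ j, dotK (corr κ (κ₂ j)) (u s) (u s))
      ≤ ν * ∫ x, ∑ j, ‖G s x j‖ ^ 2 := by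
  have hG : ∀ᵐ s ∂(volume.restrict (Ioo 0 T)), ∀ j, MemLp (fun x => G s x j) 2 volume :=
    ae_all_iff.2 fun j => ae_slice_memLp (v := fun s x => G s x j) (by norm_num) (by norm_num)
      (h.leray.gradient_memLp j)
  filter_upwards [ae_slice_memLp (by norm_num) (by norm_num) h.memLp_two, hG, h.leray.gradient]
    with s h2 hGs hw
  rw [← mul_neg, ← Finset.sum_neg_distrib,
    integral_finsetSum _ fun j _ => (hGs j).integrable_norm_pow (by norm_num)]
  refine mul_le_mul_of_nonneg_left (Finset.sum_le_sum fun j _ => ?_) h.ν_pos.le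
  rw [hκ.dotK_snd h2 hGs hw j, neg_neg]
  exact inner_sub_dotK_nonneg (continuous_corr hκ.smooth.continuous hκ.smooth.continuous)
    hκ.corr_even (integral_corr_self hκ) (corr_self_nonneg hκ) (hGs j)

/-- The dissipation against a time cut-off in terms of the kinetic energy. -/
lemma dissipation_eq (h : LerayBesov T ν σ β C u₀ f u G p) {ψ : ℝ → ℝ} (hψ : IsTimeCutoff T ψ) :
    dissipation ν T f u G p (fun t _ => ψ t)
      = 1 / 2 * (∫ s in Ioo 0 T, deriv ψ s * ∫ x, ‖u s x‖ ^ 2)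
        + ∫ s in Ioo 0 T, ψ s * ∫ x, inner ℝ (f s x) (u s x) := by
  have hp : ∀ (j : Fin d) (c : ℝ), pderiv j (fun _ : Torus d => c) = fun _ => 0 := fun j c => by
    funext x
    simp [pderiv]
  have hl : ∀ (c : ℝ) (x : Torus d), laplacian (fun _ : Torus d => c) x = 0 := fun c x => by
    simp [laplacian, hp]
  have cψ := hψ.1.continuous
  have cψ' := hψ.1.continuous_deriv (by simp)
  have i1 := integrable_time_mul cψ' h.integrable_velocity_sq
  have i2 := integrable_time_mul cψ h.integrable_power
  have i3 := (integrable_time_mul cψ h.integrable_gradient_sq).const_mul ν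
  have e1 := integral_spaceTime i1
  have e2 := integral_spaceTime i2
  simp only [integral_const_mul] at e1 e2
  have e3 : ∫ z, ν * (∑ j, ‖G z.1 z.2 j‖ ^ 2) * ψ z.1 ∂(spaceTime d T)
      = ∫ z, ν * (ψ z.1 * ∑ j, ‖G z.1 z.2 j‖ ^ 2) ∂(spaceTime d T) :=
    integral_congr_ae (ae_of_all _ fun z => by simp only; ring)
  -- A test function independent of `x` annihilates all spatial fluxes, pressure included. The
  -- viscous part of the defect then cancels the explicit viscous term of `ε[u]`.
  have e4 : defect ν T f u G p (fun t _ => ψ t)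
      = ∫ z, ((1 / 2 * (deriv ψ z.1 * ‖u z.1 z.2‖ ^ 2) + ψ z.1 * inner ℝ (f z.1 z.2) (u z.1 z.2))
        - ν * (ψ z.1 * ∑ j, ‖G z.1 z.2 j‖ ^ 2)) ∂(spaceTime d T) := by
    refine integral_congr_ae (ae_of_all _ fun z => ?_)
    simp only [hp, hl, tderiv]
    rw [real_inner_comm]
    simp
    ring
  rw [dissipation, e3, e4, integral_sub ((i1.const_mul _).fun_add i2) i3,
    integral_add (i1.const_mul _) i2, integral_const_mul, integral_const_mul, e1, e2]
  ring

end LerayBesov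

end

section

/-! ### Bounds of the dissipation at a given scale -/

variable {d : ℕ} {T : ℝ}

lemma abs_setIntegral_le {X : ℝ → ℝ} {B : ℝ} (hB : 0 ≤ B) {s t : Set ℝ} (hst : s ⊆ t)
    (hX : ∫⁻ r in t, ‖X r‖ₑ ≤ ENNReal.ofReal B) : |∫ r in s, X r| ≤ B := by
  have h := (enorm_integral_le_lintegral_enorm _).trans ((lintegral_mono_set hst).trans hX)
  rwa [← ofReal_norm, ENNReal.ofReal_le_ofReal_iff hB] at h

lemma IsTimeCutoff.isTimeTest {ψ : ℝ → ℝ} (hψ : IsTimeCutoff T ψ) : IsTimeTest T ψ := by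
  obtain ⟨h1, -, a, b, -, hb, h⟩ := hψ
  refine ⟨h1, (b + T) / 2, by linarith, fun t ht => h t fun hm => ?_⟩
  linarith [hm.2]

lemma IsTimeCutoff.zero {ψ : ℝ → ℝ} (hψ : IsTimeCutoff T ψ) : ψ 0 = 0 := by
  obtain ⟨-, -, a, b, ha, -, h⟩ := hψ
  exact h 0 fun hm => by linarith [hm.1]

lemma IsTimeCutoff.exists_bound_deriv {ψ : ℝ → ℝ} (hψ : IsTimeCutoff T ψ) :
    ∃ M, 0 ≤ M ∧ ∀ t, |deriv ψ t| ≤ M := by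
  obtain ⟨h1, -, a, b, -, -, h⟩ := hψ
  have hc : HasCompactSupport ψ := HasCompactSupport.intro isCompact_Icc h
  obtain ⟨M, hM⟩ := hc.deriv.exists_bound_of_continuous (h1.continuous_deriv (by simp))
  exact ⟨M, (norm_nonneg _).trans (hM 0), hM⟩

namespace LerayBesov

variable {ν σ β C : ℝ} {u₀ : Torus d → Vec d} {f u : ℝ → Torus d → Vec d}
    {G : ℝ → Torus d → Fin d → Vec d} {p : ℝ → Torus d → ℝ}

variable {A ℓ : ℝ} {κ : Torus d → ℝ} {κ₁ κ₂ : Fin d → Torus d → ℝ}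

lemma fluxBound_nonneg (hA : 0 ≤ A) (hC : 0 ≤ C) (hℓ : 0 ≤ ℓ) :
    0 ≤ d * (d * (A / ℓ * (C * ℓ ^ β) ^ 3)) := by positivity

lemma mollified_balance (h : LerayBesov T ν σ β C u₀ f u G p) (hκ : IsMollifier A ℓ κ κ₁ κ₂) :
    HasWeakTimeDeriv T (fun s => dotK (corr κ κ) (u s) (u s)) (dotK (corr κ κ) u₀ u₀)
      (fun s => 2 * balanceRate ν (corr κ κ) (fun j => corr κ (κ₁ j)) (fun j => corr κ (κ₂ j))
        (f s) (u s)) :=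
  h.leray.mollified_balance h.memLp_two h.data.force_memLp h.data.initial_memLp hκ h.T_pos

lemma integrableOn_gradient_energy (h : LerayBesov T ν σ β C u₀ f u G p) :
    IntegrableOn (fun s => ∫ x, ∑ j, ‖G s x j‖ ^ 2) (Ioo 0 T) :=
  h.integrable_gradient_sq.integral_prod_left

lemma integrableOn_kinetic_energy (h : LerayBesov T ν σ β C u₀ f u G p) :
    IntegrableOn (fun s => ∫ x, ‖u s x‖ ^ 2) (Ioo 0 T) :=
  h.integrable_velocity_sq.integral_prod_left

lemma integrableOn_force_power (h : LerayBesov T ν σ β C u₀ f u G p) :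
    IntegrableOn (fun s => ∫ x, inner ℝ (f s x) (u s x)) (Ioo 0 T) :=
  h.integrable_power.integral_prod_left

/-- The dissipation against a cut-off exceeds the viscous dissipation by at most the errors of
the mollified balance. -/
lemma dissipation_le_of_scale (h : LerayBesov T ν σ β C u₀ f u G p)
    (hκ : IsMollifier A ℓ κ κ₁ κ₂) (hA : 0 ≤ A) (hℓ0 : 0 < ℓ) (hℓ1 : ℓ ≤ 1)
    {ψ : ℝ → ℝ} (hψ : IsTimeCutoff T ψ) {M : ℝ} (hM0 : 0 ≤ M) (hM : ∀ t, |deriv ψ t| ≤ M) :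
    dissipation ν T f u G p (fun t _ => ψ t)
      ≤ viscousDissipation ν T G
        + (balanceError d T A σ β C ℓ + M * velocityBound T β C ℓ) := by
  have cψ := hψ.1.continuous
  have cψ' := hψ.1.continuous_deriv (by simp)
  have hψ1 : ∀ t, |ψ t| ≤ 1 := fun t => abs_le.2 ⟨by linarith [(hψ.2.1 t).1], (hψ.2.1 t).2⟩
  have iE := integrableOn_time_mul cψ' h.integrableOn_kinetic_energy
  have iW := integrableOn_time_mul cψ' (h.integrableOn_energy hκ)
  have iP := integrableOn_time_mul cψ h.integrableOn_force_power
  have iQ := integrableOn_time_mul cψ (h.integrableOn_force hκ)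
  have iF := integrableOn_time_mul cψ (h.integrableOn_flux hκ)
  have iV := integrableOn_time_mul cψ (h.integrableOn_viscous hκ)
  have hbal := h.mollified_balance hκ ψ hψ.isTimeTest
  have e : ∫ s in Ioo 0 T, ψ s * (2 * balanceRate ν (corr κ κ) (fun j => corr κ (κ₁ j))
        (fun j => corr κ (κ₂ j)) (f s) (u s))
      = 2 * ((∫ s in Ioo 0 T, ψ s * fluxK (fun j => corr κ (κ₁ j)) (u s))
        + (∫ s in Ioo 0 T, ψ s * (ν * ∑ j, dotK (corr κ (κ₂ j)) (u s) (u s)))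
        + ∫ s in Ioo 0 T, ψ s * dotK (corr κ κ) (f s) (u s)) := by
    rw [← integral_add iF iV, ← integral_add (iF.fun_add iV) iQ, ← integral_const_mul]
    refine integral_congr_ae (ae_of_all _ fun s => ?_)
    simp only [balanceRate]
    ring
  rw [e, hψ.zero, zero_mul, add_zero] at hbal
  have b1 := abs_integral_mul_le hM0 (by have := velocityBound_nonneg T β C ℓ; positivity) hM
    (h.lintegral_energy_le hκ hℓ0 hℓ1)
  have b2 := abs_integral_mul_le zero_le_one
    (add_nonneg (dataBound_nonneg σ C ℓ) (velocityBound_nonneg T β C ℓ)) hψ1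
    (h.lintegral_force_le hκ hℓ0 hℓ1)
  have b3 := abs_integral_mul_le zero_le_one (fluxBound_nonneg hA h.C_nonneg hℓ0.le) hψ1
    (h.lintegral_fluxK_le hκ hℓ0 hℓ1)
  simp only [mul_sub] at b1 b2
  rw [integral_sub iE iW] at b1
  rw [integral_sub iP iQ] at b2
  -- The viscous term is compared with the true dissipation rather than with `ν ℓ^(2β-2)`: the lemma
  -- is used with `ν` fixed and `ℓ → 0`, where that power blows up if `β < 1`.
  have b4 : -(∫ s in Ioo 0 T, ψ s * (ν * ∑ j, dotK (corr κ (κ₂ j)) (u s) (u s)))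
      ≤ viscousDissipation ν T G := by
    rw [← integral_neg, viscousDissipation, ← integral_const_mul]
    refine integral_mono_ae iV.neg (h.integrableOn_gradient_energy.const_mul ν) ?_
    filter_upwards [h.ae_viscous_le hκ] with s hs
    have h0 : 0 ≤ ν * ∫ x, ∑ j, ‖G s x j‖ ^ 2 :=
      mul_nonneg h.ν_pos.le (integral_nonneg fun x => Finset.sum_nonneg fun j _ => sq_nonneg _)
    obtain ⟨p0, p1⟩ := hψ.2.1 s
    nlinarith
  rw [h.dissipation_eq hψ, balanceError]
  have := (abs_le.1 b1).2
  have := (abs_le.1 b2).2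
  have := (abs_le.1 b3).1
  linarith

/-- The bound of the viscous dissipation at scale `ℓ`. -/
def dissipationBound (d : ℕ) (T A σ β C ν ℓ : ℝ) : ℝ :=
  dataBound σ C ℓ + balanceError d T A σ β C ℓ
    + ν * (d * (A / ℓ ^ 2 * velocityBound T β C ℓ))

/-- The viscous dissipation is controlled at every scale. -/
lemma viscousDissipation_le (h : LerayBesov T ν σ β C u₀ f u G p)
    (hκ : IsMollifier A ℓ κ κ₁ κ₂) (hA : 0 ≤ A) (hℓ0 : 0 < ℓ) (hℓ1 : ℓ ≤ 1) :
    viscousDissipation ν T G ≤ dissipationBound d T A σ β C ν ℓ := by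
  have hT := h.T_pos
  have iG := h.integrableOn_gradient_energy
  have iR : IntegrableOn (fun s => 2 * balanceRate ν (corr κ κ) (fun j => corr κ (κ₁ j))
      (fun j => corr κ (κ₂ j)) (f s) (u s)) (Ioo 0 T) :=
    (((h.integrableOn_flux hκ).add (h.integrableOn_viscous hκ)).add
      (h.integrableOn_force hκ)).const_mul 2
  -- The energy inequality minus half the mollified balance on `(0,t)`. The kinetic energy at time
  -- `t` can be dropped, since it exceeds its mollified counterpart; the rest are errors at scale
  -- `ℓ`.
  have key : ∀ᵐ t ∂(volume.restrict (Ioo 0 T)), ν * ∫ s in Ioo 0 t, ∫ x, ∑ j, ‖G s x j‖ ^ 2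
      ≤ dissipationBound d T A σ β C ν ℓ := by
    filter_upwards [h.leray.energy_inequality,
      (h.mollified_balance hκ).ae_eq hT (h.integrableOn_energy hκ) iR,
      ae_slice_memLp (by norm_num) (by norm_num) h.memLp_two, ae_restrict_mem measurableSet_Ioo]
      with t h1 h2 h3 ht
    have hsub : Ioo 0 t ⊆ Ioo 0 T := Ioo_subset_Ioo_right ht.2.le
    have hst := spaceTime_mono (d := d) ht.2.le
    rw [integral_spaceTime (h.integrable_gradient_sq.mono_measure hst)] at h1
    simp_rw [real_inner_comm (f _ _) (u _ _)] at h1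
    rw [integral_spaceTime (h.integrable_power.mono_measure hst)] at h1
    have h4 := inner_sub_dotK_nonneg (continuous_corr hκ.smooth.continuous hκ.smooth.continuous)
      hκ.corr_even (integral_corr_self hκ) (corr_self_nonneg hκ) h3
    have iF := (h.integrableOn_flux hκ).mono_set hsub
    have iV := (h.integrableOn_viscous hκ).mono_set hsub
    have iP := h.integrableOn_force_power.mono_set hsub
    have iQ := (h.integrableOn_force hκ).mono_set hsub
    have e : ∫ s in (0 : ℝ)..t, 2 * balanceRate ν (corr κ κ) (fun j => corr κ (κ₁ j))
          (fun j => corr κ (κ₂ j)) (f s) (u s)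
        = 2 * ((∫ s in Ioo 0 t, fluxK (fun j => corr κ (κ₁ j)) (u s))
          + (∫ s in Ioo 0 t, ν * ∑ j, dotK (corr κ (κ₂ j)) (u s) (u s))
          + ∫ s in Ioo 0 t, dotK (corr κ κ) (f s) (u s)) := by
      rw [intervalIntegral.integral_of_le ht.1.le, integral_Ioc_eq_integral_Ioo,
        integral_const_mul, ← integral_add iF iV, ← integral_add (iF.fun_add iV) iQ]
      rfl
    rw [e] at h2
    have b1 := h.initial_energy_le hκ hℓ0 hℓ1
    have b2 := abs_setIntegral_le
      (add_nonneg (dataBound_nonneg σ C ℓ) (velocityBound_nonneg T β C ℓ)) hsub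
      (h.lintegral_force_le hκ hℓ0 hℓ1)
    rw [integral_sub iP iQ] at b2
    have b3 := abs_setIntegral_le (fluxBound_nonneg hA h.C_nonneg hℓ0.le) hsub
      (h.lintegral_fluxK_le hκ hℓ0 hℓ1)
    have hvb := velocityBound_nonneg T β C ℓ
    have b4 : -(∫ s in Ioo 0 t, ν * ∑ j, dotK (corr κ (κ₂ j)) (u s) (u s))
        ≤ ν * (d * (A / ℓ ^ 2 * velocityBound T β C ℓ)) := by
      rw [integral_const_mul, integral_finsetSum _ fun j _ =>
        (h.leray.integrableOn_dotK h.memLp_two hκ.smooth.continuous (hκ.smooth_snd j).continuous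
          h.memLp_two).mono_set hsub, ← mul_neg, ← Finset.sum_neg_distrib]
      refine mul_le_mul_of_nonneg_left ?_ h.ν_pos.le
      refine (Finset.sum_le_sum fun j _ => (neg_le_abs _).trans (abs_setIntegral_le
        (by positivity) hsub (h.lintegral_viscous_le hκ hℓ0 hℓ1 j))).trans_eq ?_
      simp
    rw [dissipationBound, balanceError]
    have := (abs_le.1 b2).2
    have := (abs_le.1 b3).1
    linarith
  set B := dissipationBound d T A σ β C ν ℓ
  -- The bound is known only for almost every `t < T`; continuity of the primitive carries it to `t
  -- = T`. Writing the inequality as `max (Φ t) B = B` makes it an equality of continuous functions.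
  set Φ : ℝ → ℝ := fun t => 0 + ∫ s in (0 : ℝ)..t, ν * ∫ x, ∑ j, ‖G s x j‖ ^ 2 with hΦ
  have cΦ : ContinuousOn Φ (Icc 0 T) := by
    have := (primitive_absolutelyContinuous hT (iG.const_mul ν) 0).continuousOn
    rwa [uIcc_of_le hT.le] at this
  have hΦt : ∀ t, 0 ≤ t → Φ t = ν * ∫ s in Ioo 0 t, ∫ x, ∑ j, ‖G s x j‖ ^ 2 := fun t ht => by
    simp only [hΦ]
    rw [zero_add, intervalIntegral.integral_of_le ht, integral_Ioc_eq_integral_Ioo,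
      integral_const_mul]
  have hae : (fun t => max (Φ t) B) =ᵐ[volume.restrict (Icc 0 T)] fun _ => B := by
    rw [← restrict_Ioo_eq_restrict_Icc]
    filter_upwards [key, ae_restrict_mem measurableSet_Ioo] with t h1 ht
    rw [← hΦt t ht.1.le] at h1
    exact max_eq_right h1
  have heq := Measure.eqOn_Icc_of_ae_eq volume hT.ne hae (cΦ.sup continuousOn_const)
    continuousOn_const (right_mem_Icc.2 hT.le)
  rw [viscousDissipation, ← hΦt T hT.le]
  exact max_eq_right_iff.1 heq

end LerayBesov

end

section

/-! ### Slow variation and the choice of scale -/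

/-- A slowly varying function is not bounded by a positive power at zero. -/
lemma SlowlyVaryingAtZero.not_le_rpow {L : ℝ → ℝ} (hL : SlowlyVaryingAtZero L) {δ K : ℝ}
    (hδ : 0 < δ) : ¬ ∀ ν, 0 < ν → ν ≤ 1 → L ν ≤ K * ν ^ δ := by
  intro hK
  -- Near zero, halving the argument multiplies `L` by more than `q`, because the ratio tends to
  -- `1`; the assumed power bound shrinks by `q²`. Iterating the halving gives the contradiction.
  set q : ℝ := (1 / 2) ^ (δ / 2) with hq
  have q0 : 0 < q := by positivity
  have q1 : q < 1 := Real.rpow_lt_one (by norm_num) (by norm_num) (by positivity)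
  have hqq : (1 / 2 : ℝ) ^ δ = q * q := by
    rw [hq, ← Real.rpow_add (by norm_num)]
    congr 1
    ring
  have hev := (hL.2 (1 / 2) (by norm_num)).eventually (lt_mem_nhds q1)
  obtain ⟨η, hη, hsub⟩ := mem_nhdsGT_iff_exists_Ioo_subset.1 hev
  -- The starting point lies below `η`, for the ratio estimate, and is at most `1`, for the assumed
  -- power bound; both persist under halving.
  set x := min (η / 2) 1 with hx
  have hη0 : (0 : ℝ) < η := hη
  have x0 : 0 < x := lt_min (by linarith) one_pos
  have xη : x < η := (min_le_left _ _).trans_lt (by linarith)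
  have x1 : x ≤ 1 := min_le_right _ _
  have p0 : ∀ n : ℕ, 0 < (1 / 2 : ℝ) ^ n := fun n => by positivity
  have p1 : ∀ n : ℕ, (1 / 2 : ℝ) ^ n ≤ 1 := fun n => pow_le_one₀ (by norm_num) (by norm_num)
  have hlow : ∀ n : ℕ, q ^ n * L x ≤ L ((1 / 2) ^ n * x) := by
    intro n
    induction n with
    | zero => simp
    | succ n ih =>
      have y0 : 0 < (1 / 2 : ℝ) ^ n * x := mul_pos (p0 n) x0
      have y1 : (1 / 2 : ℝ) ^ n * x < η := by nlinarith [p1 n]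
      have h1 : q < L (1 / 2 * ((1 / 2) ^ n * x)) / L ((1 / 2) ^ n * x) := hsub ⟨y0, y1⟩
      rw [lt_div_iff₀ (hL.1 _ y0)] at h1
      rw [pow_succ', pow_succ', mul_assoc, mul_assoc]
      exact (mul_le_mul_of_nonneg_left ih q0.le).trans h1.le
  have hup : ∀ n : ℕ, L x ≤ K * x ^ δ * q ^ n := by
    intro n
    have y0 : 0 < (1 / 2 : ℝ) ^ n * x := mul_pos (p0 n) x0
    have h1 := (hlow n).trans (hK _ y0 (mul_le_one₀ (p1 n) x0.le x1))
    rw [Real.mul_rpow (p0 n).le x0.le, ← Real.rpow_pow_comm (by norm_num), hqq, mul_pow] at h1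
    have h2 : q ^ n * L x ≤ q ^ n * (K * x ^ δ * q ^ n) := h1.trans_eq (by ring)
    exact le_of_mul_le_mul_left h2 (by positivity)
  have hlim : Tendsto (fun n : ℕ => K * x ^ δ * q ^ n) atTop (𝓝 (K * x ^ δ * 0)) :=
    (tendsto_pow_atTop_nhds_zero_of_lt_one q0.le q1).const_mul _
  have := ge_of_tendsto' hlim hup
  rw [mul_zero] at this
  exact absurd (hL.1 x x0) (not_lt.2 this)

/-! ### Power laws of the error terms, the limit of vanishing scale, and scales tied to the
viscosity -/

variable {d : ℕ} {T : ℝ}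

namespace LerayBesov

variable {ν σ β C : ℝ} {u₀ : Torus d → Vec d} {f u : ℝ → Torus d → Vec d}
    {G : ℝ → Torus d → Fin d → Vec d} {p : ℝ → Torus d → ℝ} {A ℓ : ℝ}

lemma dataBound_eq (hℓ : 0 < ℓ) : dataBound σ C ℓ = C ^ 2 * ℓ ^ (2 * σ) := by
  rw [dataBound, mul_pow, ← Real.rpow_natCast (ℓ ^ σ), ← Real.rpow_mul hℓ.le]
  push_cast
  rw [mul_comm σ]

lemma velocityBound_eq (hℓ : 0 < ℓ) :
    velocityBound T β C ℓ = (C * T ^ (1 / 6 : ℝ)) ^ 2 * ℓ ^ (2 * β) := by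
  rw [velocityBound, mul_right_comm, mul_pow, ← Real.rpow_natCast (ℓ ^ β), ← Real.rpow_mul hℓ.le]
  push_cast
  rw [mul_comm β]

lemma flux_bound_eq (hℓ : 0 < ℓ) :
    A / ℓ * (C * ℓ ^ β) ^ 3 = A * C ^ 3 * ℓ ^ (3 * β - 1) := by
  rw [mul_pow, Real.rpow_sub_one hℓ.ne', ← Real.rpow_natCast (ℓ ^ β), ← Real.rpow_mul hℓ.le]
  push_cast
  rw [mul_comm β]
  ring

lemma viscous_bound_eq (hℓ : 0 < ℓ) : A / ℓ ^ 2 * velocityBound T β C ℓ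
    = A * (C * T ^ (1 / 6 : ℝ)) ^ 2 * ℓ ^ (2 * β - 2) := by
  rw [velocityBound_eq hℓ, Real.rpow_sub hℓ, Real.rpow_two]
  ring

lemma tendsto_rpow_nhdsGT_zero {a : ℝ} (ha : 0 < a) :
    Tendsto (fun ℓ : ℝ => ℓ ^ a) (𝓝[>] 0) (𝓝 0) := by
  have := (Real.continuousAt_rpow_const 0 a (Or.inr ha.le)).tendsto
  rw [Real.zero_rpow ha.ne'] at this
  exact this.mono_left nhdsWithin_le_nhds

/-- Above the Onsager exponent there is no anomalous dissipation. -/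
theorem dissipation_le (h : LerayBesov T ν σ β C u₀ f u G p) (hβ : 1 < 3 * β)
    {ψ : ℝ → ℝ} (hψ : IsTimeCutoff T ψ) :
    dissipation ν T f u G p (fun t _ => ψ t) ≤ viscousDissipation ν T G := by
  obtain ⟨A, hA, hmol⟩ := exists_isMollifier d
  obtain ⟨M, hM0, hM⟩ := hψ.exists_bound_deriv
  have hσ := h.σ_pos
  have hβ0 := h.β_pos
  have hv : Tendsto (fun ℓ => velocityBound T β C ℓ) (𝓝[>] 0) (𝓝 0) := by
    have := (tendsto_rpow_nhdsGT_zero (a := 2 * β) (by positivity)).const_mul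
      ((C * T ^ (1 / 6 : ℝ)) ^ 2)
    rw [mul_zero] at this
    exact this.congr' (eventually_mem_nhdsWithin.mono fun ℓ hℓ => (velocityBound_eq hℓ).symm)
  have hd : Tendsto (fun ℓ => dataBound σ C ℓ) (𝓝[>] 0) (𝓝 0) := by
    have := (tendsto_rpow_nhdsGT_zero (a := 2 * σ) (by positivity)).const_mul (C ^ 2)
    rw [mul_zero] at this
    exact this.congr' (eventually_mem_nhdsWithin.mono fun ℓ hℓ => (dataBound_eq hℓ).symm)
  have hf : Tendsto (fun ℓ => A / ℓ * (C * ℓ ^ β) ^ 3) (𝓝[>] 0) (𝓝 0) := by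
    have := (tendsto_rpow_nhdsGT_zero (a := 3 * β - 1) (by linarith)).const_mul (A * C ^ 3)
    rw [mul_zero] at this
    exact this.congr' (eventually_mem_nhdsWithin.mono fun ℓ hℓ => (flux_bound_eq hℓ).symm)
  -- Viscosity and cut-off are fixed, so `M` is a constant. Every error is a positive power of `ℓ`,
  -- the flux because `3β > 1`.
  have hlim : Tendsto (fun ℓ => viscousDissipation ν T G
      + (balanceError d T A σ β C ℓ + M * velocityBound T β C ℓ)) (𝓝[>] 0)
      (𝓝 (viscousDissipation ν T G + (d * (d * 0) + (0 + 0) + M * 0))) :=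
    ((((hf.const_mul _).const_mul _).add (hd.add hv)).add (hv.const_mul M)).const_add _
  simp only [mul_zero, add_zero] at hlim
  refine ge_of_tendsto hlim ?_
  filter_upwards [Ioc_mem_nhdsGT zero_lt_one] with ℓ hℓ
  obtain ⟨κ, κ₁, κ₂, hκ⟩ := hmol ℓ hℓ.1 hℓ.2
  exact h.dissipation_le_of_scale hκ hA hℓ.1 hℓ.2 hψ hM0 hM

/-- The total dissipation is controlled at every scale. -/
theorem totalDissipation_le (h : LerayBesov T ν σ β C u₀ f u G p) (hβ : 1 < 3 * β)
    {κ : Torus d → ℝ} {κ₁ κ₂ : Fin d → Torus d → ℝ} (hκ : IsMollifier A ℓ κ κ₁ κ₂)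
    (hA : 0 ≤ A) (hℓ0 : 0 < ℓ) (hℓ1 : ℓ ≤ 1) :
    totalDissipation ν T f u G p ≤ ENNReal.ofReal (dissipationBound d T A σ β C ν ℓ) :=
  iSup₂_le fun _ hψ => ENNReal.ofReal_le_ofReal
    ((h.dissipation_le hβ hψ).trans (h.viscousDissipation_le hκ hA hℓ0 hℓ1))

/-- The bound of the dissipation at the scale `ν ^ γ`. -/
lemma dissipationBound_rpow_le (hA : 0 ≤ A) (hC : 0 ≤ C) {γ s : ℝ}
    (h1 : s ≤ 2 * γ * σ) (h2 : s ≤ γ * (3 * β - 1)) (h3 : s ≤ 2 * γ * β)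
    (h4 : s ≤ 1 + γ * (2 * β - 2)) (hν0 : 0 < ν) (hν1 : ν ≤ 1) :
    dissipationBound d T A σ β C ν (ν ^ γ)
      ≤ (2 * C ^ 2 + d * (d * (A * C ^ 3)) + (C * T ^ (1 / 6 : ℝ)) ^ 2
        + d * (A * (C * T ^ (1 / 6 : ℝ)) ^ 2)) * ν ^ s := by
  have hℓ : 0 < ν ^ γ := Real.rpow_pos_of_pos hν0 γ
  have hle : ∀ a, s ≤ a → ν ^ a ≤ ν ^ s := fun a ha =>
    Real.rpow_le_rpow_of_exponent_ge hν0 hν1 ha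
  have hd : dataBound σ C (ν ^ γ) ≤ C ^ 2 * ν ^ s := by
    rw [dataBound_eq hℓ, ← Real.rpow_mul hν0.le]
    exact mul_le_mul_of_nonneg_left (hle _ (h1.trans_eq (by ring))) (by positivity)
  have hv : velocityBound T β C (ν ^ γ) ≤ (C * T ^ (1 / 6 : ℝ)) ^ 2 * ν ^ s := by
    rw [velocityBound_eq hℓ, ← Real.rpow_mul hν0.le]
    exact mul_le_mul_of_nonneg_left (hle _ (h3.trans_eq (by ring))) (by positivity)
  have hf : A / ν ^ γ * (C * (ν ^ γ) ^ β) ^ 3 ≤ A * C ^ 3 * ν ^ s := by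
    rw [flux_bound_eq hℓ, ← Real.rpow_mul hν0.le]
    exact mul_le_mul_of_nonneg_left (hle _ h2) (by positivity)
  have hw : ν * (A / (ν ^ γ) ^ 2 * velocityBound T β C (ν ^ γ))
      ≤ A * (C * T ^ (1 / 6 : ℝ)) ^ 2 * ν ^ s := by
    have e : ν * ν ^ (γ * (2 * β - 2)) = ν ^ (1 + γ * (2 * β - 2)) := by
      rw [Real.rpow_add hν0, Real.rpow_one]
    rw [viscous_bound_eq hℓ, ← Real.rpow_mul hν0.le, mul_left_comm, e]
    exact mul_le_mul_of_nonneg_left (hle _ h4) (by positivity)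
  rw [dissipationBound, balanceError, mul_left_comm ν]
  have hd0 : (0 : ℝ) ≤ d := Nat.cast_nonneg d
  have f1 := mul_le_mul_of_nonneg_left (mul_le_mul_of_nonneg_left hf hd0) hd0
  have f2 := mul_le_mul_of_nonneg_left hw hd0
  linarith

end LerayBesov

lemma le_ofReal_of_le_coe {x : ℝ≥0∞} {C : ℝ≥0} {C' : ℝ} (h : x ≤ C) (hC : (C : ℝ) ≤ C') :
    x ≤ ENNReal.ofReal C' :=
  h.trans (by rw [← ENNReal.ofReal_coe_nnreal]; exact ENNReal.ofReal_le_ofReal hC)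

end

end NSE

end

/-! ### Choice of exponents and conclusion -/

theorem theorem1 (d : ℕ) (T : ℝ) (hT : 0 < T)
    -- the exponents of the dissipation and of the data
    (α : ℝ) (hα₀ : 0 ≤ α) (hα₁ : α < 1)
    (σ : ℝ) (hσ₀ : 0 < σ) (hσ₁ : σ ≤ 1) (hσα : 2 * α / (3 - α) < σ)
    (L : ℝ → ℝ) (hL : SlowlyVaryingAtZero L)
    -- the family of Leray solutions, indexed by the viscosity
    (u₀ : ℝ → Torus d → Vec d) (f u : ℝ → ℝ → Torus d → Vec d)
    (G : ℝ → ℝ → Torus d → Fin d → Vec d) (p : ℝ → ℝ → Torus d → ℝ)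
    (hdata : ∀ ν, 0 < ν → IsData T (u₀ ν) (f ν))
    (hu : ∀ ν, 0 < ν → IsLeraySolution ν T (u₀ ν) (f ν) (u ν) (G ν) (p ν))
    -- the data are bounded uniformly in the viscosity
    (hu₀B : ∃ C : ℝ≥0, ∀ ν, 0 < ν → besovNorm σ 2 (u₀ ν) ≤ C)
    (hfB : ∃ C : ℝ≥0, ∀ ν, 0 < ν → timeBesovNorm T 2 σ 2 (f ν) ≤ C)
    -- the lower bound on the dissipation
    (hdiss : ∀ ν, 0 < ν →
      ENNReal.ofReal (ν ^ α * L ν) ≤ totalDissipation ν T (f ν) (u ν) (G ν) (p ν)) :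
    ∀ ε : ℝ, 0 < ε →
      ¬ ∃ C : ℝ≥0, ∀ ν, 0 < ν →
        timeBesovNorm T 3 ((1 + α) / (3 - α) + ε) 3 (u ν) ≤ C := by
  rintro ε hε ⟨C₃, h₃⟩
  obtain ⟨C₁, h₁⟩ := hu₀B
  obtain ⟨C₂, h₂⟩ := hfB
  obtain ⟨A, hA, hmol⟩ := exists_isMollifier d
  set β := (1 + α) / (3 - α) + ε with hβ
  set C : ℝ := C₁ + C₂ + C₃ with hC
  have c1 := C₁.coe_nonneg
  have c2 := C₂.coe_nonneg
  have c3 := C₃.coe_nonneg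
  have h3α : 0 < 3 - α := by linarith
  set γ := (3 - α) / 4 with hγ
  have hγ0 : 0 < γ := by positivity
  have hβ0 : 0 < β := by positivity
  have hγβ : γ * β = (1 + α) / 4 + γ * ε := by
    rw [hγ, hβ]
    field_simp
  have hσγ : α < 2 * γ * σ := by
    rw [div_lt_iff₀ h3α] at hσα
    rw [hγ]
    linarith
  have hγε : 0 < γ * ε := by positivity
  have hβ1 : 1 < 3 * β := by
    have : γ * 1 < γ * (3 * β) := by
      rw [mul_left_comm, hγβ]
      linarith
    exact lt_of_mul_lt_mul_left this hγ0.le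
  -- The exponents of `ν` are `2γσ` for the data, `α + 3γε` for the flux, `α + 2γε` for viscosity
  -- and `(1+α)/2 + 2γε` for the velocity increments. All exceed `α`, the last because `α < 1`.
  obtain ⟨δ, hδ0, hδ1, hδ2, hδ3⟩ : ∃ δ, 0 < δ ∧ α + δ ≤ 2 * γ * σ ∧ δ ≤ γ * ε
      ∧ α + δ ≤ (1 + α) / 2 := by
    refine ⟨min (2 * γ * σ - α) (min (γ * ε) ((1 - α) / 2)), ?_, ?_, ?_, ?_⟩
    · exact lt_min (by linarith) (lt_min hγε (by linarith))
    · linarith [min_le_left (2 * γ * σ - α) (min (γ * ε) ((1 - α) / 2))]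
    · exact (min_le_right _ _).trans (min_le_left _ _)
    · linarith [(min_le_right (2 * γ * σ - α) (min (γ * ε) ((1 - α) / 2))).trans
        (min_le_right _ _)]
  refine hL.not_le_rpow (K := 2 * C ^ 2 + d * (d * (A * C ^ 3)) + (C * T ^ (1 / 6 : ℝ)) ^ 2
        + d * (A * (C * T ^ (1 / 6 : ℝ)) ^ 2)) hδ0 fun ν hν0 hν1 => ?_
  have h : LerayBesov T ν σ β C (u₀ ν) (f ν) (u ν) (G ν) (p ν) :=
    { T_pos := hT
      ν_pos := hν0
      σ_pos := hσ₀
      β_pos := hβ0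
      C_nonneg := by positivity
      data := hdata ν hν0
      leray := hu ν hν0
      initial_le := le_ofReal_of_le_coe (h₁ ν hν0) (by linarith)
      force_le := le_ofReal_of_le_coe (h₂ ν hν0) (by linarith)
      velocity_le := le_ofReal_of_le_coe (h₃ ν hν0) (by linarith) }
  have hℓ0 : 0 < ν ^ γ := Real.rpow_pos_of_pos hν0 γ
  have hℓ1 : ν ^ γ ≤ 1 := Real.rpow_le_one hν0.le hν1 hγ0.le
  obtain ⟨κ, κ₁, κ₂, hκ⟩ := hmol _ hℓ0 hℓ1
  have hpos : 0 < ν ^ α * L ν := mul_pos (Real.rpow_pos_of_pos hν0 α) (hL.1 ν hν0)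
  have hb := (hdiss ν hν0).trans (h.totalDissipation_le hβ1 hκ hA hℓ0 hℓ1)
  -- Strict positivity of `ν^α L(ν)` excludes the case in which truncation at zero makes the
  -- comparison vacuous.
  have hb' := (ENNReal.ofReal_le_ofReal_iff'.1 hb).resolve_right (not_le.2 hpos)
  have hs := hb'.trans (LerayBesov.dissipationBound_rpow_le hA h.C_nonneg (s := α + δ)
    hδ1 (by linarith) (by linarith) (by linarith) hν0 hν1)
  rw [Real.rpow_add hν0, mul_left_comm] at hs
  exact le_of_mul_le_mul_left hs (Real.rpow_pos_of_pos hν0 α)
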